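/- **Setting.** Let $\mathfrak g$ be a simple complex Lie algebra of simply-laced type, $I$ the vertex set of its Dynkin diagram, $n=|I|$, $\alpha_i$ the simple roots, $\Phi_+$ the set of positive roots, $N=|\Phi_+|$, $h=2N/n$ the (dual) Coxeter number, $w_0$ the longest element of the Weyl group $W$, and $i\mapsto i^*$ the involution with $w_0(\alpha_i)=-\alpha_{i^*}$. Let $Q$ be an orientation of the Dynkin diagram and $\xi:I\to\mathbb Z$ a height function adapted to $Q$, i.e. $\xi(j)=\xi(i)-1$ whenever $i\to j$ in $Q$. A word $(i_1,i_2,\dots)$ is adapted to $Q$ if $i_1$ is a source of $Q$, $i_2$ is a source of the quiver $s_{i_1}(Q)$ obtained by reversing all arrows at $i_1$, and so on; $\tau_Q\in W$ is the unique Coxeter element having reduced expressions adapted to $Q$. Fix a reduced expression $(i_1,\dots,i_N)$ of $w_0$ adapted to $Q$ and extend it to an infinite sequence by setting, for $1\le k\le N$ and $m\ge 0$, $i_{k+Nm}=i_k$ if $m$ is even and $i_{k+Nm}=i_k^*$ if $m$ is odd. Put $I^{\le\xi}=\{(i,p)\mid i\in I,\ p\in\xi(i)+2\mathbb Z_{\le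 0}\}$ and let $\varphi:I^{\le\xi}\to\mathbb Z_{\ge1}$ be the bijection with inverse $\varphi^{-1}(t)=(i_t,\ \xi(i_t)-2N_Q(t)+2)$, where $N_Q(t)=\#\{k\le t\mid i_k=i_t\}$. Let $\gamma_j$ be the sum of the $\alpha_k$ over all $k$ admitting a (possibly trivial) path from $k$ to $j$ in $Q$; define positive roots $\beta_t$, $t\ge1$, by $\beta_{\varphi(j,\xi(j))}=\gamma_j$ and $\beta_{\varphi(j,s-2)}=\pm\tau_Q(\beta_{\varphi(j,s)})$, the sign being the one that gives a positive root. Let $C(z)$ be the quantum Cartan matrix ($C_{ii}(z)=z+z^{-1}$, $C_{ij}(z)=-1$ if $i,j$ are adjacent, $0$ otherwise); for $m\geq 1$ let $\tilde C_{ij}(m)$ be the coefficient of $z^m$ in the expansion of the $(i,j)$ entry of $C(z)^{-1}$ as a power series in $z$, and let $\tilde C_{ij}(m)=0$ for $m\le0$. Let $\mathcal Y^{\le\xi}=\mathbb Z[Y_{i,p}^{\pm1},(i,p)\in I^{\le\xi}]$ and let $\widetilde D_\xi:\mathbb C\otimes\mathcal Y^{\le\xi}\to\mathbb C(\alpha_1,\dots,\alpha_n)$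 be the $\mathbb{C}$-algebra morphism with $$\widetilde D_\xi(Y_{i,p})=\prod_{(j,s)\in I^{\le\xi}}\beta_{\varphi(j,s)}^{\tilde C_{ij}(s-p-1)-\tilde C_{ij}(s-p+1)}\qquad((i,p)\in I^{\le\xi}).$$ Let $q\in\mathbb C^\times$ be not a root of unity. For $(i,p)\in I^{\le\xi}$ let $X_{i,p}=L(Y_{i,p}Y_{i,p+2}\cdots Y_{i,\xi(i)})$ be the Kirillov–Reshetikhin module, i.e. the finite-dimensional simple module over the quantum affine algebra (with trivial central charge) with this highest $l$-weight, where $Y_{i,p}=Y_{i,q^p}$. Let $\widetilde\chi_q$ be the truncated $q$-character: $\widetilde\chi_q(V)=\sum_m\dim(V_m)\,m$, summed over the monomials $m$ of $\mathcal Y^{\le\xi}$, where $V_m$ is the $l$-weight space of $V$ of $l$-weight $m$. For $t\ge1$ let $x_t=[X_{\varphi^{-1}(t)}]$ (the $t$-th initial cluster variable of Hernandez–Leclerc's cluster structure on $\mathbb C\otimes K_0(\mathcal C^{\le\xi})$), and let $\iota$ be the embedding given by the truncated $q$-character, so that $\iota(x_t)=\widetilde\chi_q(X_{\varphi^{-1}(t)})$.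 **Statement.** (1) For every $(i,p)\in I^{\le\xi}$ with $p\le\xi(i)-2h+2$ one has $$\widetilde D_\xi\big(Y_{i,p}Y_{i,p+2}\cdots Y_{i,p+2h-2}\big)=1.$$ (2) For every $t\ge1$ one has $\widetilde D_\xi(\iota(x_{t+2N}))=\widetilde D_\xi(\iota(x_t))$. -/

import Mathlib

noncomputable section

namespace HernandezLeclerc

/-! # The set `I^{≤ ξ}` -/

/-- `(i, p) ∈ I^{≤ ξ}`, that is `p ∈ ξ(i) + 2 ℤ_{≤ 0}`. -/
def MemLE {I : Type*} (ξ : I → ℤ) (i : I) (p : ℤ) : Prop := ∃ k : ℕ, p = ξ i - 2 * k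

/-- The set `I^{≤ ξ}`. -/
abbrev ILE {I : Type*} (ξ : I → ℤ) := {y : I × ℤ // MemLE ξ y.1 y.2}

/-- If `(i, p) ∈ I^{≤ ξ}` and `p ≤ ξ(i) - 2h + 2`, then `(i, p + 2k) ∈ I^{≤ ξ}` for `k < h`. -/
theorem MemLE.shift {I : Type*} {ξ : I → ℤ} {i : I} {p : ℤ} {h k : ℕ} (hp : MemLE ξ i p)
    (hle : p ≤ ξ i - 2 * h + 2) (hk : k < h) : MemLE ξ i (p + 2 * k) := by
  obtain ⟨d, hd⟩ := hp
  exact ⟨d - k, by omega⟩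

/-! # Dynkin data -/

section Dynkin

variable {I : Type*} [Fintype I] [DecidableEq I]

/-- The Cartan matrix of a simply-laced diagram: `2` on the diagonal, `-1` for neighbours. -/
def cartan (G : SimpleGraph I) [DecidableRel G.Adj] : Matrix I I ℤ :=
  fun i j => if i = j then 2 else if G.Adj i j then -1 else 0

/-- `G` is the Dynkin diagram of a simple complex Lie algebra of simply-laced type (types
`A`, `D`, `E`): it is connected (in particular non-empty) and its Cartan matrix is positive
definite. -/
def IsSimplyLacedDynkin (G : SimpleGraph I) [DecidableRel G.Adj] : Prop :=
  G.Connected ∧ ((cartan G).map (Int.cast : ℤ → ℝ)).PosDef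

/-- The simple root `α_i`, in the root lattice `Γ = ⨁ ℤ α_i` identified with `I → ℤ`. -/
def simpleRoot (i : I) : I → ℤ := Pi.single i 1

/-- The simple coroot, as a linear form on the root lattice: `v ↦ (α_i, v)`. -/
def simpleCoroot (G : SimpleGraph I) [DecidableRel G.Adj] (i : I) : Module.Dual ℤ (I → ℤ) :=
  (LinearMap.proj i).comp (cartan G).mulVecLin

theorem simpleCoroot_simpleRoot (G : SimpleGraph I) [DecidableRel G.Adj] (i : I) :
    simpleCoroot G i (simpleRoot i) = 2 := by
  simp [simpleCoroot, simpleRoot, cartan]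

/-- The simple reflection `s_i`, acting on the root lattice by `v ↦ v - (α_i, v) α_i`. -/
def simpleReflection (G : SimpleGraph I) [DecidableRel G.Adj] (i : I) :
    (I → ℤ) ≃ₗ[ℤ] (I → ℤ) :=
  Module.reflection (simpleCoroot_simpleRoot G i)

/-- The Weyl group `W`, acting on the root lattice. -/
def weylGroup (G : SimpleGraph I) [DecidableRel G.Adj] :
    Subgroup ((I → ℤ) ≃ₗ[ℤ] (I → ℤ)) :=
  Subgroup.closure (Set.range (simpleReflection G))

/-- The set `Φ` of roots: the `W`-conjugates of the simple roots. -/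
def roots (G : SimpleGraph I) [DecidableRel G.Adj] : Set (I → ℤ) :=
  {β | ∃ w ∈ weylGroup G, ∃ i, β = w (simpleRoot i)}

/-- The set `Φ₊` of positive roots. -/
def positiveRoots (G : SimpleGraph I) [DecidableRel G.Adj] : Set (I → ℤ) :=
  {β | β ∈ roots G ∧ ∀ i, 0 ≤ β i}

/-- The number `N` of positive roots. -/
def numPos (G : SimpleGraph I) [DecidableRel G.Adj] : ℕ := Nat.card (positiveRoots G)

/-- The (dual) Coxeter number `h = 2N/n` (the division is exact for a Dynkin diagram). -/
def coxeterNumber (G : SimpleGraph I) [DecidableRel G.Adj] : ℕ :=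
  2 * numPos G / Fintype.card I

/-- `w` is the longest element `w₀` of `W`: the element which makes all positive roots negative. -/
def IsLongest (G : SimpleGraph I) [DecidableRel G.Adj] (w : (I → ℤ) ≃ₗ[ℤ] (I → ℤ)) : Prop :=
  w ∈ weylGroup G ∧ ∀ β ∈ positiveRoots G, -(w β) ∈ positiveRoots G

/-- The vertex `i*` such that `w₀(α_i) = -α_{i*}`. -/
def dualVertex (G : SimpleGraph I) [DecidableRel G.Adj] (i : I) : I :=
  @Classical.epsilon I ⟨i⟩ fun j => ∃ w, IsLongest G w ∧ w (simpleRoot i) = -simpleRoot j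

/-- The product `s_{i_1} s_{i_2} ⋯ s_{i_k}` attached to a word. -/
def wordProd (G : SimpleGraph I) [DecidableRel G.Adj] (l : List I) :
    (I → ℤ) ≃ₗ[ℤ] (I → ℤ) :=
  (l.map (simpleReflection G)).prod

/-! ## Orientations and adapted words -/

/-- `Q` is an orientation of the graph `G`: every edge carries exactly one arrow. -/
def IsOrientation (G : SimpleGraph I) (Q : Digraph I) : Prop :=
  (∀ i j, Q.Adj i j → G.Adj i j) ∧ ∀ i j, G.Adj i j → (Q.Adj i j ↔ ¬ Q.Adj j i)

/-- `i` is a source of `Q`: no arrow ends at `i`. -/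
def IsSource (Q : Digraph I) (i : I) : Prop := ∀ j, ¬ Q.Adj j i

/-- The quiver `s_i(Q)`: all arrows with source or target `i` are reversed. -/
def reflectQuiver (i : I) (Q : Digraph I) : Digraph I where
  Adj a b := if a = i ∨ b = i then Q.Adj b a else Q.Adj a b

/-- The word `(i_1, …, i_k)` is adapted to `Q`: `i_1` is a source of `Q`, `i_2` is a source of
`s_{i_1}(Q)`, and so on. -/
def IsAdapted : Digraph I → List I → Prop
  | _, [] => True
  | Q, i :: l => IsSource Q i ∧ IsAdapted (reflectQuiver i Q) l

/-- `τ` is a Coxeter element having a reduced expression adapted to `Q`. -/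
def IsAdaptedCoxeter (G : SimpleGraph I) [DecidableRel G.Adj] (Q : Digraph I)
    (τ : (I → ℤ) ≃ₗ[ℤ] (I → ℤ)) : Prop :=
  ∃ l : List I, l.Nodup ∧ (∀ i, i ∈ l) ∧ IsAdapted Q l ∧ τ = wordProd G l

/-- The Coxeter element `τ_Q`: the unique one having reduced expressions adapted to `Q`. -/
def coxeter (G : SimpleGraph I) [DecidableRel G.Adj] (Q : Digraph I) :
    (I → ℤ) ≃ₗ[ℤ] (I → ℤ) :=
  Classical.epsilon (IsAdaptedCoxeter G Q)

/-- `(w 1, …, w N)` is a reduced expression of `w₀` adapted to `Q` (as `N` is the length of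
`w₀`, every word of length `N` representing `w₀` is reduced).  The values of `w` outside
`1, …, N` play no role. -/
def IsAdaptedReducedWord (G : SimpleGraph I) [DecidableRel G.Adj] (Q : Digraph I)
    (w : ℕ → I) : Prop :=
  IsLongest G (wordProd G ((List.range (numPos G)).map fun k => w (k + 1))) ∧
    IsAdapted Q ((List.range (numPos G)).map fun k => w (k + 1))

/-- The infinite word `(i_1, i_2, …)` extending `(w 1, …, w N)`: `i_{k + N m}` is `i_k` if `m` is
even and `i_k*` if `m` is odd, for `1 ≤ k ≤ N`. (Only the values at `t ≥ 1` are meaningful.) -/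
def hatWord (G : SimpleGraph I) [DecidableRel G.Adj] (w : ℕ → I) (t : ℕ) : I :=
  if Even ((t - 1) / numPos G) then w ((t - 1) % numPos G + 1)
  else dualVertex G (w ((t - 1) % numPos G + 1))

/-- `N_Q(t)`, the number of occurrences of the letter `i_t` among `i_1, …, i_t`. -/
def occurrences (G : SimpleGraph I) [DecidableRel G.Adj] (w : ℕ → I) (t : ℕ) : ℕ :=
  ((Finset.Icc 1 t).filter fun k => hatWord G w k = hatWord G w t).card

/-! ## The roots attached to the elements of `I^{≤ ξ}` -/

/-- The element `(i, ξ(i) - 2d)` of `I^{≤ ξ}`. -/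
def atDepth (ξ : I → ℤ) (i : I) (d : ℕ) : ILE ξ := ⟨(i, ξ i - 2 * d), d, rfl⟩

/-- The number `d = (ξ(i) - p) / 2` attached to `(i, p) ∈ I^{≤ ξ}`. -/
def depth {ξ : I → ℤ} (y : ILE ξ) : ℕ := ((ξ y.1.1 - y.1.2) / 2).toNat

/-- The bijection `φ⁻¹` from the positive integers to `I^{≤ ξ}`:
`φ⁻¹(t) = (i_t, ξ(i_t) - 2 N_Q(t) + 2)`. -/
def phiInv (G : SimpleGraph I) [DecidableRel G.Adj] (ξ : I → ℤ) (w : ℕ → I) (t : ℕ) : ILE ξ :=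
  atDepth ξ (hatWord G w t) (occurrences G w t - 1)

open Classical in
/-- The root `γ_i`, the sum of the `α_j` over all `j` admitting a path from `j` to `i` in `Q`. -/
def gammaRoot (Q : Digraph I) (i : I) : I → ℤ :=
  fun j => if Relation.ReflTransGen Q.Adj j i then 1 else 0

open Classical in
/-- The positive roots `β_{φ(j, ξ(j) - 2m)}`, for `m = 0, 1, 2, …`: one starts with `γ_j`, applies
`τ_Q`, and changes the sign whenever the result is not a positive root. -/
def betaSeq (G : SimpleGraph I) [DecidableRel G.Adj] (Q : Digraph I) (j : I) : ℕ → I → ℤ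
  | 0 => gammaRoot Q j
  | m + 1 =>
    if coxeter G Q (betaSeq G Q j m) ∈ positiveRoots G then coxeter G Q (betaSeq G Q j m)
    else -coxeter G Q (betaSeq G Q j m)

/-- The root `β_{φ(j,s)}`, for `(j, s) ∈ I^{≤ ξ}`. -/
def beta (G : SimpleGraph I) [DecidableRel G.Adj] (Q : Digraph I) {ξ : I → ℤ} (y : ILE ξ) :
    I → ℤ :=
  betaSeq G Q y.1.1 (depth y)

theorem betaSeq_ne_zero (G : SimpleGraph I) [DecidableRel G.Adj] (Q : Digraph I) (j : I) (m : ℕ) :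
    betaSeq G Q j m ≠ 0 := by
  induction m with
  | zero =>
    intro h
    have := congrFun h j
    simp [betaSeq, gammaRoot, Relation.ReflTransGen.refl] at this
  | succ m ih =>
    have h : coxeter G Q (betaSeq G Q j m) ≠ 0 := by simpa using ih
    rw [betaSeq]
    split_ifs
    · exact h
    · simpa using ih

/-! ## The inverse quantum Cartan matrix -/

/-- The quantum Cartan matrix `C(z)`, with entries in the ring of Laurent series in `z`. -/
def quantumCartan (G : SimpleGraph I) [DecidableRel G.Adj] : Matrix I I (LaurentSeries ℤ) :=
  fun i j => if i = j then HahnSeries.single 1 1 + HahnSeries.single (-1) 1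
    else if G.Adj i j then -1 else 0

/-- The integers `C̃_{ij}(m)`: for `m ≥ 1`, the coefficient of `z ^ m` in the entry `(i, j)` of the
inverse of `C(z)`; for `m ≤ 0`, zero. -/
def cTilde (G : SimpleGraph I) [DecidableRel G.Adj] (i j : I) (m : ℤ) : ℤ :=
  if 1 ≤ m then ((quantumCartan G)⁻¹ i j).coeff m else 0

/-! ## The morphism `D̃_ξ` -/

/-- The field `ℂ(α_1, …, α_n)`. -/
abbrev RatField (I : Type*) := FractionRing (MvPolynomial I ℂ)

/-- The root lattice inside `ℂ(α_1, …, α_n)`. -/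
def linForm (β : I → ℤ) : RatField I :=
  algebraMap (MvPolynomial I ℂ) (RatField I) (∑ i, MvPolynomial.C (β i : ℂ) * MvPolynomial.X i)

theorem linForm_ne_zero {β : I → ℤ} (h : β ≠ 0) : linForm β ≠ 0 := by
  obtain ⟨i, hi⟩ := Function.ne_iff.1 h
  intro h0
  rw [linForm, map_eq_zero_iff _ (IsFractionRing.injective _ _)] at h0
  have := congrArg (MvPolynomial.eval (Pi.single i (1 : ℂ))) h0
  simp [Pi.single_apply] at this
  exact hi (by simpa using this)

/-- The non-zero element `β_{φ(j,s)}` of `ℂ(α_1, …, α_n)`. -/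
def betaUnit (G : SimpleGraph I) [DecidableRel G.Adj] (Q : Digraph I) {ξ : I → ℤ} (y : ILE ξ) :
    (RatField I)ˣ :=
  Units.mk0 (linForm (beta G Q y)) (linForm_ne_zero (betaSeq_ne_zero G Q _ _))

/-- The value of `D̃_ξ` on `Y_{i,p}`.  The product has only finitely many factors different
from `1`, as those with `s < p` are trivial. -/
def dTildeY (G : SimpleGraph I) [DecidableRel G.Adj] (Q : Digraph I) (ξ : I → ℤ) (x : ILE ξ) :
    (RatField I)ˣ :=
  ∏ᶠ y : ILE ξ, betaUnit G Q y ^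
    (cTilde G x.1.1 y.1.1 (y.1.2 - x.1.2 - 1) - cTilde G x.1.1 y.1.1 (y.1.2 - x.1.2 + 1))

/-- The complexified torus `ℂ ⊗ 𝒴^{≤ ξ}`: Laurent polynomials with complex coefficients in the
variables `Y_{i,p}`, `(i, p) ∈ I^{≤ ξ}`; a monomial is given by its exponents. -/
abbrev Torus (ξ : I → ℤ) := AddMonoidAlgebra ℂ (ILE ξ →₀ ℤ)

/-- The variable `Y_{i,p}`. -/
def Y {ξ : I → ℤ} (y : ILE ξ) : Torus ξ := AddMonoidAlgebra.single (Finsupp.single y 1) 1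

/-- The algebra morphism `D̃_ξ : ℂ ⊗ 𝒴^{≤ ξ} → ℂ(α_1, …, α_n)`, the one given by `dTildeY` on the
variables. -/
def dTilde (G : SimpleGraph I) [DecidableRel G.Adj] (Q : Digraph I) (ξ : I → ℤ) :
    Torus ξ →ₐ[ℂ] RatField I :=
  AddMonoidAlgebra.lift ℂ (RatField I) (ILE ξ →₀ ℤ)
    ((Units.coeHom (RatField I)).comp
      (AddMonoidHom.toMultiplicativeLeft (Finsupp.liftAddHom fun y =>
        zmultiplesHom (Additive (RatField I)ˣ) (Additive.ofMul (dTildeY G Q ξ y)))))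

theorem dTilde_Y (G : SimpleGraph I) [DecidableRel G.Adj] (Q : Digraph I) (ξ : I → ℤ)
    (y : ILE ξ) : dTilde G Q ξ (Y y) = dTildeY G Q ξ y := by
  simp [dTilde, Y]

end Dynkin

/-! # Quantum affine algebras and (truncated) `q`-characters -/

section Quantum

variable {I : Type*} [Fintype I] [DecidableEq I]

/-- The quantum integer `[n]_q = (q^n - q^{-n}) / (q - q^{-1})`. -/
def qInt (q : ℂˣ) (n : ℤ) : ℂ :=
  (((q ^ n : ℂˣ) : ℂ) - ((q ^ (-n) : ℂˣ) : ℂ)) / ((q : ℂ) - ((q⁻¹ : ℂˣ) : ℂ))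

/-- Generators of the quantum affine algebra in Drinfeld's realization.  A sign `ε = ±1` selects
between the two members of a family: `x ε i r` is `x^ε_{i,r}`, `k ε i` is `k_i^ε`, and `φ ε i r` is
`φ^ε_{i,r}`. -/
inductive Gen (I : Type*) : Type _
  | x (ε : ℤˣ) (i : I) (r : ℤ)
  | k (ε : ℤˣ) (i : I)
  | h (i : I) (r : ℤ)
  | φ (ε : ℤˣ) (i : I) (r : ℤ)

section Rel

/-- The generators inside the free algebra. -/
abbrev gx (ε : ℤˣ) (i : I) (r : ℤ) : FreeAlgebra ℂ (Gen I) := FreeAlgebra.ι ℂ (Gen.x ε i r)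
/-- The generators inside the free algebra. -/
abbrev gk (ε : ℤˣ) (i : I) : FreeAlgebra ℂ (Gen I) := FreeAlgebra.ι ℂ (Gen.k ε i)
/-- The generators inside the free algebra. -/
abbrev gh (i : I) (r : ℤ) : FreeAlgebra ℂ (Gen I) := FreeAlgebra.ι ℂ (Gen.h i r)
/-- The generators inside the free algebra. -/
abbrev gφ (ε : ℤˣ) (i : I) (r : ℤ) : FreeAlgebra ℂ (Gen I) := FreeAlgebra.ι ℂ (Gen.φ ε i r)

/-- The expression whose symmetrization in `r₁, r₂` is the cubic Serre relation. -/
def serreTerm (q : ℂˣ) (ε : ℤˣ) (i j : I) (r₁ r₂ s : ℤ) : FreeAlgebra ℂ (Gen I) :=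
  gx ε i r₁ * gx ε i r₂ * gx ε j s - qInt q 2 • (gx ε i r₁ * gx ε j s * gx ε i r₂)
    + gx ε j s * gx ε i r₁ * gx ε i r₂

/-- Drinfeld's relations for the quantum affine algebra with trivial central charge (the
quantum loop algebra), in simply-laced type. -/
inductive Rel (G : SimpleGraph I) [DecidableRel G.Adj] (q : ℂˣ) :
    FreeAlgebra ℂ (Gen I) → FreeAlgebra ℂ (Gen I) → Prop
  /-- `k_i` and `k_i⁻¹` are inverse to each other. -/
  | k_inv (ε : ℤˣ) (i : I) : Rel G q (gk ε i * gk (-ε) i) 1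
  | k_comm (ε ε' : ℤˣ) (i j : I) : Rel G q (gk ε i * gk ε' j) (gk ε' j * gk ε i)
  /-- There is no generator `h_{i,0}`. -/
  | h_zero (i : I) : Rel G q (gh i 0) 0
  | k_h_comm (ε : ℤˣ) (i j : I) (r : ℤ) : Rel G q (gk ε i * gh j r) (gh j r * gk ε i)
  | h_comm (i j : I) (r s : ℤ) : Rel G q (gh i r * gh j s) (gh j s * gh i r)
  /-- The four families below say that
  `∑_{r ≥ 0} φ^ε_{i, ε r} u^r = k_i^ε exp(ε (q - q⁻¹) ∑_{r ≥ 1} h_{i, ε r} u^r)`,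
  through its constant term and its logarithmic derivative. -/
  | φ_vanish (ε : ℤˣ) (i : I) (r : ℤ) (hr : (ε : ℤ) * r < 0) : Rel G q (gφ ε i r) 0
  | φ_zero (ε : ℤˣ) (i : I) : Rel G q (gφ ε i 0) (gk ε i)
  | φ_succ (ε : ℤˣ) (i : I) (r : ℕ) :
      Rel G q (((r : ℂ) + 1) • gφ ε i ((ε : ℤ) * (r + 1)))
        ((((ε : ℤ) : ℂ) * ((q : ℂ) - ((q⁻¹ : ℂˣ) : ℂ))) •
          ∑ s ∈ Finset.range (r + 1),
            ((s : ℂ) + 1) • (gh i ((ε : ℤ) * (s + 1)) * gφ ε i ((ε : ℤ) * ((r : ℤ) - s))))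
  | k_x (ε ε' : ℤˣ) (i j : I) (r : ℤ) :
      Rel G q (gk ε i * gx ε' j r)
        (((q ^ ((ε : ℤ) * ε' * cartan G i j) : ℂˣ) : ℂ) • (gx ε' j r * gk ε i))
  | h_x (ε : ℤˣ) (i j : I) (r s : ℤ) (hr : r ≠ 0) :
      Rel G q (gh i r * gx ε j s - gx ε j s * gh i r)
        ((((ε : ℤ) : ℂ) * (qInt q (r * cartan G i j) / (r : ℂ))) • gx ε j (r + s))
  | x_x (ε : ℤˣ) (i j : I) (r s : ℤ) :
      Rel G q
        (gx ε i (r + 1) * gx ε j s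
          - ((q ^ ((ε : ℤ) * cartan G i j) : ℂˣ) : ℂ) • (gx ε j s * gx ε i (r + 1)))
        (((q ^ ((ε : ℤ) * cartan G i j) : ℂˣ) : ℂ) • (gx ε i r * gx ε j (s + 1))
          - gx ε j (s + 1) * gx ε i r)
  | xp_xm (i j : I) (r s : ℤ) :
      Rel G q (gx 1 i r * gx (-1) j s - gx (-1) j s * gx 1 i r)
        (if i = j then
          ((q : ℂ) - ((q⁻¹ : ℂˣ) : ℂ))⁻¹ • (gφ 1 i (r + s) - gφ (-1) i (r + s)) else 0)
  /-- The Drinfeld–Serre relation for neighbours. -/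
  | serre_adj (ε : ℤˣ) (i j : I) (r₁ r₂ s : ℤ) (hij : G.Adj i j) :
      Rel G q (serreTerm q ε i j r₁ r₂ s + serreTerm q ε i j r₂ r₁ s) 0
  /-- The Drinfeld–Serre relation for distinct vertices which are not neighbours. -/
  | serre_nonadj (ε : ℤˣ) (i j : I) (r s : ℤ) (hne : i ≠ j) (hij : ¬ G.Adj i j) :
      Rel G q (gx ε i r * gx ε j s) (gx ε j s * gx ε i r)

end Rel

/-- The quantum affine algebra (with trivial central charge). -/
abbrev QAff (G : SimpleGraph I) [DecidableRel G.Adj] (q : ℂˣ) : Type _ := RingQuot (Rel G q)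

/-- The image of a generator in the quantum affine algebra. -/
def QAff.gen (G : SimpleGraph I) [DecidableRel G.Adj] (q : ℂˣ) (g : Gen I) : QAff G q :=
  RingQuot.mkAlgHom ℂ (Rel G q) (FreeAlgebra.ι ℂ g)

/-- Monomials in the `Y_{i,a}^{±1}`, `i ∈ I`, `a ∈ ℂˣ`, given by their exponents. -/
abbrev LMonomial (I : Type*) := I × ℂˣ →₀ ℤ

/-- The eigenvalue of `k_i` attached to the monomial `∏ Y_{i,a}^{u_{i,a}}`, namely
`q ^ (∑_a u_{i,a})`. -/
def kValue (q : ℂˣ) (m : LMonomial I) (i : I) : ℂ :=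
  ((q ^ (m.sum fun y u => if y.1 = i then u else 0) : ℂˣ) : ℂ)

/-- The eigenvalue of `h_{i,r}` attached to the monomial `∏ Y_{i,a}^{u_{i,a}}`, namely
`([r]_q / r) ∑_a u_{i,a} a^r`.  Equivalently, both series `φ^±_i(z) = ∑_r φ^±_{i,r} z^r` have as
eigenvalue the rational function `∏_a (q (1 - a q⁻¹ z) / (1 - a q z)) ^ u_{i,a}`, expanded at `0`
respectively at `∞`. -/
def hValue (q : ℂˣ) (m : LMonomial I) (i : I) (r : ℤ) : ℂ :=
  qInt q r / (r : ℂ) * m.sum fun y u => if y.1 = i then (u : ℂ) * ((y.2 ^ r : ℂˣ) : ℂ) else 0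

section Modules

variable (G : SimpleGraph I) [DecidableRel G.Adj] (q : ℂˣ)
  (V : Type*) [AddCommGroup V] [Module ℂ V] [Module (QAff G q) V] [IsScalarTower ℂ (QAff G q) V]

/-- The action of a generator on a module. -/
def act (g : Gen I) : Module.End ℂ V := Algebra.lsmul ℂ ℂ V (QAff.gen G q g)

/-- The `l`-weight space `V_m`: the common generalized eigenspace of the loop-Cartan
subalgebra (generated by the `k_i^{±1}` and the `h_{i,r}`) with the eigenvalues attached to `m`. -/
def lWeightSpace (m : LMonomial I) : Submodule ℂ V :=
  (⨅ i : I, (act G q V (Gen.k 1 i)).maxGenEigenspace (kValue q m i)) ⊓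
    ⨅ (i : I) (r : ℤ) (_ : r ≠ 0), (act G q V (Gen.h i r)).maxGenEigenspace (hValue q m i r)

/-- `V` is (a copy of) the simple module `L(m)`: the finite-dimensional simple module with
highest `l`-weight `m`. -/
structure IsSimpleOfHighestLWeight (m : LMonomial I) : Prop where
  finiteDimensional : FiniteDimensional ℂ V
  simple : IsSimpleModule (QAff G q) V
  exists_highest : ∃ v : V, v ≠ 0 ∧
    (∀ i r, act G q V (Gen.x 1 i r) v = 0) ∧
    (∀ i, act G q V (Gen.k 1 i) v = kValue q m i • v) ∧
    (∀ i r, r ≠ 0 → act G q V (Gen.h i r) v = hValue q m i r • v)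

/-- A monomial in the `Y_{i,p}^{±1}`, `(i, p) ∈ I^{≤ ξ}`, as a monomial in the `Y_{i,a}^{±1}`,
through `Y_{i,p} = Y_{i,q^p}`. -/
def toLMonomial {ξ : I → ℤ} (m : ILE ξ →₀ ℤ) : LMonomial I :=
  m.mapDomain fun y => (y.1.1, q ^ y.1.2)

/-- The truncated `q`-character `χ̃_q(V) = ∑_m dim(V_m) m`, where the sum is restricted to the
monomials `m` belonging to `𝒴^{≤ ξ}`; only finitely many terms are non-zero when `V` is
finite-dimensional. -/
def truncatedQChar (ξ : I → ℤ) : Torus ξ :=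
  ∑ᶠ m : ILE ξ →₀ ℤ,
    AddMonoidAlgebra.single m (Module.finrank ℂ (lWeightSpace G q V (toLMonomial q m)) : ℂ)

/-- The monomial `Y_{i,p} Y_{i,p+2} ⋯ Y_{i,ξ(i)}`, for `(i, p) ∈ I^{≤ ξ}`. -/
def krMonomial {ξ : I → ℤ} (y : ILE ξ) : ILE ξ →₀ ℤ :=
  ∑ d ∈ Finset.range (depth y + 1), Finsupp.single (atDepth ξ y.1.1 d) 1

/-- `V` is (a copy of) the Kirillov–Reshetikhin module
`X_{i,p} = L(Y_{i,p} Y_{i,p+2} ⋯ Y_{i,ξ(i)})`. -/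
def IsKR {ξ : I → ℤ} (y : ILE ξ) : Prop :=
  IsSimpleOfHighestLWeight G q V (toLMonomial q (krMonomial y))

end Modules

end Quantum

end HernandezLeclerc

end

noncomputable section

set_option linter.unusedSectionVars false

/-! Part (1) is a telescoping argument. In the product over `k < h`, the exponent of the root at
`(j, s)` collapses to `C̃_{ij}(s - p + 1 - 2h) - C̃_{ij}(s - p + 1)`. Since the roots of column `j`
are `h`-periodic in the depth, the two terms cancel against each other after a shift by `h`, and
only the `h` topmost roots of each column survive, with exponent `-C̃_{ij}(s - p + 1)`
(`prod_range_shift_div`).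

For these, the bound on `p` allows `C̃` to be replaced by its odd extension to all integers (`cheb`,
`cheb_eq_zero`). That extension satisfies the mesh relations `x_j(d) + x_j(d+1) = ∑ (neighbouring
terms)`, and so do the roots `τ_Q^d(γ_j)` (`isMesh_rootAt`). As the `γ_j` form a basis of the root
lattice, the exponent is `f(τ_Q^d(γ_j))` for one linear form `f` (`exists_linearMap_rootAt`).

If `c_j` is the number of letters `j` in the adapted word of `w₀`, then `τ_Q^{c_j}(γ_j) = -γ_{j*}`
(`rootAt_count`) and `c_j + c_{j*} = h` (`count_add_count_dualVertex`). Passing from `τ_Q^d(γ_{j*})`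
to its opposite leaves the positive root `β` unchanged and reverses the sign of `f`, so the lower
part of column `j` cancels the upper part of column `j*` (`prod_rootUnit_eq_one`).

Part (2) reduces to part (1). Every `l`-weight of `X_{i,p}` other than the highest one contains the
factor `A_{i,q^{ξ(i)+1}}^{-1}`, hence involves a variable outside `I^{≤ξ}`; so the truncated
`q`-character is the highest monomial (`IsKR.truncatedQChar_eq`). Adding `2N` to `t` keeps the
letter `i_t` and adds `h` to its number of occurrences (`occurrences_add`), so the two monomials
differ by `h` consecutive variables `Y_{i,p}`, whose product has image `1`. -/

namespace HernandezLeclerc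

/-! ### Root systems from the positive definite form; the longest element. -/

section Roots

open Matrix

variable {I : Type*} [Fintype I] [DecidableEq I] {G : SimpleGraph I} [DecidableRel G.Adj]

/-- The invariant bilinear form on the root lattice. -/
def form (G : SimpleGraph I) [DecidableRel G.Adj] (x y : I → ℤ) : ℤ := x ⬝ᵥ cartan G *ᵥ y

theorem form_add_left (x y z : I → ℤ) : form G (x + y) z = form G x z + form G y z := by
  simp [form, add_dotProduct]

theorem form_add_right (x y z : I → ℤ) : form G x (y + z) = form G x y + form G x z := by
  simp [form, mulVec_add]

theorem form_smul_left (c : ℤ) (x y : I → ℤ) : form G (c • x) y = c * form G x y :=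
  smul_dotProduct c x _

theorem form_smul_right (c : ℤ) (x y : I → ℤ) : form G x (c • y) = c * form G x y := by
  rw [form, mulVec_smul, dotProduct_smul]
  rfl

theorem cartan_transpose : (cartan G)ᵀ = cartan G := by
  ext i j
  simp [cartan, eq_comm, G.adj_comm]

theorem form_comm (x y : I → ℤ) : form G x y = form G y x := by
  rw [form, form, dotProduct_mulVec, ← mulVec_transpose, cartan_transpose, dotProduct_comm]

theorem form_simpleRoot_left (i : I) (x : I → ℤ) :
    form G (simpleRoot i) x = (cartan G *ᵥ x) i := by
  simp [form, simpleRoot]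

theorem form_simpleRoot_self (i : I) : form G (simpleRoot i) (simpleRoot i) = 2 := by
  rw [form_simpleRoot_left]
  simp [simpleRoot, cartan]

theorem simpleReflection_apply (i : I) (x : I → ℤ) :
    simpleReflection G i x = x - form G (simpleRoot i) x • simpleRoot i := by
  rw [form_simpleRoot_left, simpleReflection, Module.reflection_apply]
  simp [simpleCoroot]

theorem simpleReflection_apply_of_ne {i j : I} (h : j ≠ i) (x : I → ℤ) :
    simpleReflection G i x j = x j := by
  simp [simpleReflection_apply, simpleRoot, h]

theorem simpleReflection_simpleRoot_self (i : I) :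
    simpleReflection G i (simpleRoot i) = -simpleRoot i := by
  rw [simpleReflection_apply, form_simpleRoot_self]
  module

theorem simpleReflection_simpleRoot_of_ne {i j : I} (h : j ≠ i) :
    simpleReflection G i (simpleRoot j) =
      simpleRoot j + if G.Adj i j then simpleRoot i else 0 := by
  rw [simpleReflection_apply, form_simpleRoot_left]
  simp only [simpleRoot, mulVec_single_one, col_apply, cartan, h.symm, if_false]
  split_ifs <;> simp

theorem simpleReflection_mul_self (i : I) : simpleReflection G i * simpleReflection G i = 1 := by
  ext1 x
  exact Module.involutive_reflection (simpleCoroot_simpleRoot G i) x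

theorem simpleReflection_inv (i : I) : (simpleReflection G i)⁻¹ = simpleReflection G i :=
  inv_eq_of_mul_eq_one_left (simpleReflection_mul_self i)

theorem simpleReflection_involutive (i : I) (x : I → ℤ) :
    simpleReflection G i (simpleReflection G i x) = x :=
  Module.involutive_reflection (simpleCoroot_simpleRoot G i) x

theorem form_simpleReflection (i : I) (x : I → ℤ) :
    form G (simpleReflection G i x) (simpleReflection G i x) = form G x x := by
  rw [simpleReflection_apply, sub_eq_add_neg, ← neg_smul]
  simp only [form_add_left, form_add_right, form_smul_left, form_smul_right,
    form_simpleRoot_self, form_comm x (simpleRoot i)]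
  ring

theorem simpleReflection_mem (i : I) : simpleReflection G i ∈ weylGroup G :=
  Subgroup.subset_closure ⟨i, rfl⟩

theorem wordProd_mem (l : List I) : wordProd G l ∈ weylGroup G := by
  refine Subgroup.list_prod_mem _ fun x hx => ?_
  obtain ⟨i, -, rfl⟩ := List.mem_map.1 hx
  exact simpleReflection_mem i

@[simp] theorem wordProd_nil : wordProd G ([] : List I) = 1 := rfl

theorem wordProd_cons (i : I) (l : List I) :
    wordProd G (i :: l) = simpleReflection G i * wordProd G l := by
  simp [wordProd]

theorem wordProd_append (l l' : List I) :
    wordProd G (l ++ l') = wordProd G l * wordProd G l' := by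
  simp [wordProd]

theorem wordProd_reverse (l : List I) : wordProd G l.reverse = (wordProd G l)⁻¹ := by
  induction l with
  | nil => simp
  | cons i l ih =>
    rw [List.reverse_cons, wordProd_append, ih, wordProd_cons, wordProd_cons, _root_.mul_inv_rev,
      simpleReflection_inv]
    simp

theorem exists_wordProd {x : (I → ℤ) ≃ₗ[ℤ] (I → ℤ)} (hx : x ∈ weylGroup G) :
    ∃ l : List I, wordProd G l = x := by
  induction hx using Subgroup.closure_induction with
  | mem x h => obtain ⟨i, rfl⟩ := h; exact ⟨[i], by simp [wordProd]⟩
  | one => exact ⟨[], rfl⟩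
  | mul x y _ _ hx hy =>
    obtain ⟨l, rfl⟩ := hx
    obtain ⟨l', rfl⟩ := hy
    exact ⟨l ++ l', wordProd_append l l'⟩
  | inv x _ hx =>
    obtain ⟨l, rfl⟩ := hx
    exact ⟨l.reverse, wordProd_reverse l⟩

theorem form_apply_of_mem {x : (I → ℤ) ≃ₗ[ℤ] (I → ℤ)} (hx : x ∈ weylGroup G) (v : I → ℤ) :
    form G (x v) (x v) = form G v v := by
  obtain ⟨l, rfl⟩ := exists_wordProd hx
  induction l with
  | nil => rfl
  | cons i l ih =>
    rw [wordProd_cons, LinearEquiv.mul_apply, form_simpleReflection, ih (wordProd_mem l)]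

theorem form_self_of_mem_roots {β : I → ℤ} (h : β ∈ roots G) : form G β β = 2 := by
  obtain ⟨w, hw, i, rfl⟩ := h
  rw [form_apply_of_mem hw, form_simpleRoot_self]

theorem simpleRoot_mem_roots (i : I) : simpleRoot i ∈ roots G := ⟨1, one_mem _, i, rfl⟩

theorem apply_mem_roots {x : (I → ℤ) ≃ₗ[ℤ] (I → ℤ)} (hx : x ∈ weylGroup G) {β : I → ℤ}
    (h : β ∈ roots G) : x β ∈ roots G := by
  obtain ⟨w, hw, i, rfl⟩ := h
  exact ⟨x * w, mul_mem hx hw, i, rfl⟩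

theorem neg_mem_roots {β : I → ℤ} (h : β ∈ roots G) : -β ∈ roots G := by
  obtain ⟨w, hw, i, rfl⟩ := h
  exact ⟨w * simpleReflection G i, mul_mem hw (simpleReflection_mem i), i, by
    simp [simpleReflection_simpleRoot_self]⟩

theorem simpleRoot_mem_positiveRoots (i : I) : simpleRoot i ∈ positiveRoots G :=
  ⟨simpleRoot_mem_roots i, fun j => by
    by_cases h : j = i
    · subst h; simp [simpleRoot]
    · simp [simpleRoot, h]⟩

/-- The root lattice is even because the diagonal of the Cartan matrix is. Together with positivity
this gives the gap `(x, x) ≥ 2` for `x ≠ 0`. -/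
theorem even_form_self (x : I → ℤ) : Even (form G x x) := by
  have hx : x = ∑ i, x i • simpleRoot i := by
    ext j
    simp [simpleRoot, Pi.single_apply]
  rw [hx]
  refine Finset.sum_induction _ (fun y => Even (form G y y)) (fun a b ha hb => ?_) ?_
    fun i _ => ?_
  · rw [form_add_left, form_add_right, form_add_right, form_comm b a]
    have : form G a a + form G a b + (form G a b + form G b b) =
      form G a a + form G b b + 2 * form G a b := by ring
    rw [this]
    exact (ha.add hb).add (even_two_mul _)
  · simp [form]
  · rw [form_smul_left, form_smul_right, form_simpleRoot_self]
    exact ((even_two.mul_left _).mul_left _)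

theorem form_self_pos (hG : IsSimplyLacedDynkin G) {x : I → ℤ} (hx : x ≠ 0) :
    0 < form G x x := by
  have h0 : (fun i => (x i : ℝ)) ≠ 0 := fun h => hx <| by
    ext i
    simpa using congrFun h i
  have h := hG.2.dotProduct_mulVec_pos h0
  have : star (fun i => (x i : ℝ)) ⬝ᵥ ((cartan G).map (Int.cast : ℤ → ℝ)) *ᵥ
      (fun i => (x i : ℝ)) = ((form G x x : ℤ) : ℝ) := by
    simp [form, dotProduct, mulVec]
  rw [this] at h
  exact_mod_cast h

theorem two_le_form_self (hG : IsSimplyLacedDynkin G) {x : I → ℤ} (hx : x ≠ 0) :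
    2 ≤ form G x x := by
  have h1 := form_self_pos hG hx
  obtain ⟨k, hk⟩ := even_form_self (G := G) x
  omega

/-- Write `β = p - m` with `p`, `m` nonnegative of disjoint supports. Off-diagonal Cartan entries
are `≤ 0`, so `(p, m) ≤ 0` and `2 = (β, β) ≥ (p, p) + (m, m)`; if both parts were nonzero the right
side would be at least `4`. -/
theorem nonneg_or_nonpos_of_mem_roots (hG : IsSimplyLacedDynkin G) {β : I → ℤ}
    (h : β ∈ roots G) : (∀ i, 0 ≤ β i) ∨ ∀ i, β i ≤ 0 := by
  set p : I → ℤ := fun i => max (β i) 0 with hp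
  set m : I → ℤ := fun i => max (-β i) 0 with hm
  have hpm : β = p + (-1 : ℤ) • m := by
    ext i
    simp only [hp, hm, Pi.add_apply, Pi.smul_apply, smul_eq_mul]
    omega
  have hle : form G p m ≤ 0 := by
    simp only [form, dotProduct, mulVec, Finset.mul_sum]
    refine Finset.sum_nonpos fun i _ => Finset.sum_nonpos fun j _ => ?_
    have hpi : 0 ≤ p i := le_max_right _ _
    have hmj : 0 ≤ m j := le_max_right _ _
    by_cases hij : i = j
    · subst hij
      have : p i = 0 ∨ m i = 0 := by simp only [hp, hm]; omega
      rcases this with h | h <;> simp [h]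
    · have : cartan G i j ≤ 0 := by
        simp only [cartan, hij, if_false]
        split_ifs <;> simp
      exact mul_nonpos_of_nonneg_of_nonpos hpi (mul_nonpos_of_nonpos_of_nonneg this hmj)
  have h2 := form_self_of_mem_roots h
  rw [hpm, form_add_left, form_add_right, form_add_right] at h2
  simp only [form_smul_left, form_smul_right, form_comm m p] at h2
  by_cases hp0 : p = 0
  · right
    intro i
    have := congrFun hp0 i
    simp only [hp, Pi.zero_apply] at this
    omega
  by_cases hm0 : m = 0
  · left
    intro i
    have := congrFun hm0 i
    simp only [hm, Pi.zero_apply] at this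
    omega
  have h3 := two_le_form_self hG hp0
  have h4 := two_le_form_self hG hm0
  linarith

theorem ne_zero_of_mem_roots {β : I → ℤ} (h : β ∈ roots G) : β ≠ 0 := by
  rintro rfl
  simpa [form] using form_self_of_mem_roots h

theorem mem_positiveRoots_or_neg (hG : IsSimplyLacedDynkin G) {β : I → ℤ} (h : β ∈ roots G) :
    β ∈ positiveRoots G ∨ -β ∈ positiveRoots G := by
  rcases nonneg_or_nonpos_of_mem_roots hG h with h' | h'
  · exact .inl ⟨h, h'⟩
  · exact .inr ⟨neg_mem_roots h, fun i => by simpa using h' i⟩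

theorem neg_notMem_positiveRoots {β : I → ℤ} (h : β ∈ positiveRoots G) :
    -β ∉ positiveRoots G := fun h' => ne_zero_of_mem_roots h.1 <| by
  ext i
  have h1 := h.2 i
  have h2 := h'.2 i
  simp at h2 ⊢
  omega

theorem cartan_mulVec_injective (hG : IsSimplyLacedDynkin G) {x : I → ℤ}
    (h : cartan G *ᵥ x = 0) : x = 0 := by
  by_contra hx
  have := form_self_pos hG hx
  simp [form, h] at this

/-- Positivity of `(β ± α_i, β ± α_i)` bounds `(α_i, β)` by `2` in absolute value, and `β` is
determined by these numbers because the Cartan matrix is injective. -/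
theorem finite_roots (hG : IsSimplyLacedDynkin G) : (roots G).Finite := by
  have hinj : Function.Injective (fun x : I → ℤ => cartan G *ᵥ x) := fun x y hxy => by
    have : cartan G *ᵥ (x - y) = 0 := by
      rw [mulVec_sub]
      exact sub_eq_zero.2 hxy
    exact sub_eq_zero.1 (cartan_mulVec_injective hG this)
  refine Set.Finite.of_finite_image (f := fun x : I → ℤ => cartan G *ᵥ x)
    (Set.Finite.subset (Set.Finite.pi' fun _ : I => Set.finite_Icc (-2 : ℤ) 2) ?_)
    hinj.injOn
  rintro _ ⟨β, hβ, rfl⟩ i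
  have h2 := form_self_of_mem_roots hβ
  have hb : ∀ c : ℤ, 0 ≤ form G (β + c • simpleRoot i) (β + c • simpleRoot i) := fun c => by
    by_cases h0 : β + c • simpleRoot i = 0
    · rw [h0]
      simp [form]
    · exact (form_self_pos hG h0).le
  have h1 := hb 1
  have h3 := hb (-1)
  simp only [form_add_left, form_add_right, form_smul_left, form_smul_right,
    form_comm β (simpleRoot i), form_simpleRoot_self, h2] at h1 h3
  rw [form_simpleRoot_left] at h1 h3
  simp only [Set.mem_Icc]
  constructor <;> linarith

theorem finite_positiveRoots (hG : IsSimplyLacedDynkin G) : (positiveRoots G).Finite :=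
  (finite_roots hG).subset fun _ h => h.1

/-- The simple reflection `s_i` permutes the positive roots other than `α_i`. -/
theorem eq_simpleRoot_of_neg {i : I} {β : I → ℤ} (h : β ∈ positiveRoots G)
    (h' : -simpleReflection G i β ∈ positiveRoots G) : β = simpleRoot i := by
  -- `s_i` changes only the coordinate at `i`, so all the other coordinates of `β` are both `≥ 0`
  -- and `≤ 0`. The norm `2` then fixes the multiple.
  have hβ : β = β i • simpleRoot i := by
    ext j
    by_cases hj : j = i
    · subst hj; simp [simpleRoot]
    · have h1 := h.2 j
      have h2 := h'.2 j
      rw [Pi.neg_apply, simpleReflection_apply_of_ne hj] at h2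
      simp only [simpleRoot, Pi.smul_apply, smul_eq_mul, Pi.single_apply, hj, if_false]
      omega
  have h2 := form_self_of_mem_roots h.1
  rw [hβ, form_smul_left, form_smul_right, form_simpleRoot_self] at h2
  have h3 : β i = 1 := by nlinarith [h.2 i]
  rw [hβ, h3, one_smul]

/-- Apply the letters to `β` one at a time: at the first letter `i` that makes the current root
negative, that root must be `α_i`. This lists the inversions of a word, reduced or not. -/
theorem exists_split_of_neg (hG : IsSimplyLacedDynkin G) (l : List I) {β : I → ℤ}
    (h : β ∈ positiveRoots G) (h' : -(wordProd G l)⁻¹ β ∈ positiveRoots G) :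
    ∃ l₁ i l₂, l = l₁ ++ i :: l₂ ∧ β = wordProd G l₁ (simpleRoot i) := by
  induction l generalizing β with
  | nil => exact (neg_notMem_positiveRoots h (by simpa using h')).elim
  | cons i l ih =>
    rcases mem_positiveRoots_or_neg hG (apply_mem_roots (simpleReflection_mem i) h.1)
      with hs | hs
    · have h'' : -(wordProd G l)⁻¹ (simpleReflection G i β) ∈ positiveRoots G := by
        simpa [wordProd_cons, simpleReflection_inv] using h'
      obtain ⟨l₁, j, l₂, rfl, hj⟩ := ih hs h''
      refine ⟨i :: l₁, j, l₂, rfl, ?_⟩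
      rw [wordProd_cons, LinearEquiv.mul_apply, ← hj, simpleReflection_involutive]
    · exact ⟨[], i, l, rfl, by simpa using eq_simpleRoot_of_neg h hs⟩

/-- By invariance of the form, `x s_α x⁻¹ = s_{x(α)}`. -/
theorem conj_simpleReflection {x : (I → ℤ) ≃ₗ[ℤ] (I → ℤ)} (hx : x ∈ weylGroup G) {i j : I}
    (h : x (simpleRoot i) = simpleRoot j) :
    simpleReflection G j * x = x * simpleReflection G i := by
  ext1 v
  simp only [LinearEquiv.mul_apply, simpleReflection_apply, map_sub, map_smul, h]
  have key : form G (simpleRoot j) (x v) = form G (simpleRoot i) v := by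
    have h1 := form_apply_of_mem hx (simpleRoot i + v)
    rw [map_add, h] at h1
    simp only [form_add_left, form_add_right, form_simpleRoot_self, form_apply_of_mem hx,
      form_comm (x v) (simpleRoot j), form_comm v (simpleRoot i)] at h1
    linarith
  rw [key]

/-- This is the deletion condition. If a word `l ++ [i]` keeps `α_i` positive, then `l` sends `α_i`
to a negative root, so some letter `j` of `l` satisfies `s_j y = y s_i` for the part `y` of `l`
after it; both `j` and the final `i` can be deleted, and the word gets shorter. -/
theorem eq_one_of_forall_mem_positiveRoots (hG : IsSimplyLacedDynkin G)
    {x : (I → ℤ) ≃ₗ[ℤ] (I → ℤ)} (hx : x ∈ weylGroup G)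
    (h : ∀ β ∈ positiveRoots G, x β ∈ positiveRoots G) : x = 1 := by
  obtain ⟨l, rfl⟩ := exists_wordProd hx
  induction hn : l.length using Nat.strong_induction_on generalizing l with
  | _ n ih =>
    rcases List.eq_nil_or_concat l with rfl | ⟨l, i, rfl⟩
    · rfl
    rw [List.concat_eq_append] at *
    have h1 := h _ (simpleRoot_mem_positiveRoots i)
    simp only [wordProd_append, wordProd_cons, wordProd_nil, mul_one, LinearEquiv.mul_apply,
      simpleReflection_simpleRoot_self, map_neg] at h1
    obtain ⟨l₁, j, l₂, hl, hj⟩ := exists_split_of_neg hG l.reverse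
      (simpleRoot_mem_positiveRoots i) (by rwa [wordProd_reverse, inv_inv])
    have hl' : l = l₂.reverse ++ j :: l₁.reverse := by
      rw [← List.reverse_reverse l, hl]
      simp
    have hj' : wordProd G l₁.reverse (simpleRoot i) = simpleRoot j := by
      rw [hj, wordProd_reverse, ← LinearEquiv.mul_apply, inv_mul_cancel]
      rfl
    have heq : wordProd G (l ++ [i]) = wordProd G (l₂.reverse ++ l₁.reverse) := by
      rw [hl', wordProd_append, wordProd_append, wordProd_cons, wordProd_append,
        conj_simpleReflection (wordProd_mem _) hj', wordProd_cons, wordProd_nil, mul_one,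
        mul_assoc, mul_assoc, simpleReflection_mul_self, mul_one]
    rw [heq] at h ⊢
    refine ih _ ?_ _ (wordProd_mem _) h rfl
    rw [← hn, hl']
    simp

/-! ## The longest element -/

/-- The product preserves positive roots. Consequently `w₀` is unique and an involution. -/
theorem IsLongest.mul_self (hG : IsSimplyLacedDynkin G) {x y : (I → ℤ) ≃ₗ[ℤ] (I → ℤ)}
    (hx : IsLongest G x) (hy : IsLongest G y) : x * y = 1 :=
  eq_one_of_forall_mem_positiveRoots hG (mul_mem hx.1 hy.1) fun β hβ => by
    have := hx.2 _ (hy.2 β hβ)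
    simpa using this

/-- Count heights: with `β = -x(α_i) = ∑ β_j α_j` one gets `α_i = ∑ β_j (-x(α_j))`, where every
`-x(α_j)` is a positive root, of height at least `1`. Since `α_i` has height `1`, at most one `β_j`
is nonzero, and it equals `1`. -/
theorem IsLongest.exists_simpleRoot (hG : IsSimplyLacedDynkin G) {x : (I → ℤ) ≃ₗ[ℤ] (I → ℤ)}
    (hx : IsLongest G x) (i : I) : ∃ j, x (simpleRoot i) = -simpleRoot j := by
  have hxx : ∀ v, x (x v) = v := fun v =>
    LinearEquiv.congr_fun (hx.mul_self hG hx) v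
  set β := -x (simpleRoot i) with hβ
  have hpos : β ∈ positiveRoots G := hx.2 _ (simpleRoot_mem_positiveRoots i)
  have hsum : simpleRoot i = ∑ j, β j • -x (simpleRoot j) := by
    have h1 : β = ∑ j, β j • simpleRoot j := by
      ext k
      simp [simpleRoot, Pi.single_apply]
    have h2 : simpleRoot i = -x β := by rw [hβ, map_neg, hxx, neg_neg]
    conv_lhs => rw [h2, h1, map_sum, ← Finset.sum_neg_distrib]
    exact Finset.sum_congr rfl fun j _ => by rw [map_smul, smul_neg]
  have hδ : ∀ j, 1 ≤ ∑ k, (-x (simpleRoot j)) k := fun j => by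
    have h1 := hx.2 _ (simpleRoot_mem_positiveRoots j)
    obtain ⟨k, hk⟩ := Function.ne_iff.1 (ne_zero_of_mem_roots h1.1)
    have h2 := Finset.single_le_sum (fun k _ => h1.2 k) (Finset.mem_univ k)
    have h3 := h1.2 k
    rw [Pi.zero_apply] at hk
    omega
  have hht : ∑ j, β j * ∑ k, (-x (simpleRoot j)) k = 1 := by
    have h1 : ∑ k, simpleRoot i k = 1 := by simp [simpleRoot]
    rw [hsum] at h1
    simp only [Finset.sum_apply, Pi.smul_apply, smul_eq_mul] at h1
    rw [Finset.sum_comm] at h1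
    simpa only [Finset.mul_sum] using h1
  have hle : ∑ j, β j ≤ 1 := by
    rw [← hht]
    exact Finset.sum_le_sum fun j _ => le_mul_of_one_le_right (hpos.2 j) (hδ j)
  obtain ⟨j, hj⟩ := Function.ne_iff.1 (ne_zero_of_mem_roots hpos.1)
  refine ⟨j, ?_⟩
  rw [← neg_eq_iff_eq_neg]
  change β = _
  have hj0 := hpos.2 j
  rw [Pi.zero_apply] at hj
  rw [← Finset.add_sum_erase _ _ (Finset.mem_univ j)] at hle
  ext k
  by_cases hk : k = j
  · subst hk
    have := Finset.sum_nonneg fun l (_ : l ∈ Finset.univ.erase k) => hpos.2 l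
    simp only [simpleRoot, Pi.single_eq_same]
    omega
  · have h1 := Finset.single_le_sum (fun l _ => hpos.2 l)
      (Finset.mem_erase.2 ⟨hk, Finset.mem_univ k⟩)
    have h2 := hpos.2 k
    simp only [simpleRoot, Pi.single_apply, hk, if_false]
    omega

theorem simpleRoot_injective : Function.Injective (simpleRoot : I → I → ℤ) := fun i j h => by
  have := congrFun h i
  by_contra hij
  simp [simpleRoot, hij] at this

/-- Uniqueness of the longest element makes the choice in `dualVertex` independent of the witness
`w`. -/
theorem IsLongest.apply_simpleRoot (hG : IsSimplyLacedDynkin G)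
    {x : (I → ℤ) ≃ₗ[ℤ] (I → ℤ)} (hx : IsLongest G x) (i : I) :
    x (simpleRoot i) = -simpleRoot (dualVertex G i) := by
  have hex : ∃ j, ∃ w, IsLongest G w ∧ w (simpleRoot i) = -simpleRoot j := by
    obtain ⟨j, hj⟩ := hx.exists_simpleRoot hG i
    exact ⟨j, x, hx, hj⟩
  have hspec := @Classical.epsilon_spec_aux I ⟨i⟩ _ hex
  obtain ⟨w, hw, hwi⟩ := hspec
  have : x = w := by
    rw [← mul_left_inj x, hx.mul_self hG hx, hw.mul_self hG hx]
  rw [this, hwi]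
  rfl

theorem IsLongest.dualVertex_dualVertex (hG : IsSimplyLacedDynkin G)
    {x : (I → ℤ) ≃ₗ[ℤ] (I → ℤ)} (hx : IsLongest G x) (i : I) :
    dualVertex G (dualVertex G i) = i := by
  have h := LinearEquiv.congr_fun (hx.mul_self hG hx) (simpleRoot i)
  rw [LinearEquiv.mul_apply, hx.apply_simpleRoot hG, map_neg, hx.apply_simpleRoot hG,
    neg_neg] at h
  exact simpleRoot_injective h

end Roots

end HernandezLeclerc

namespace HernandezLeclerc

/-! ### Height functions, adapted words and mesh mutations. -/

section Quivers

variable {I : Type*} [Fintype I] [DecidableEq I] {G : SimpleGraph I} [DecidableRel G.Adj]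

/-! ## Quivers given by height functions -/

/-- `η` is a height function adapted to some orientation of `G`. -/
def IsHeight (G : SimpleGraph I) (η : I → ℤ) : Prop :=
  ∀ i j, G.Adj i j → η j = η i - 1 ∨ η i = η j - 1

/-- The orientation of `G` to which the height function `η` is adapted. -/
def heightQuiver (G : SimpleGraph I) (η : I → ℤ) : Digraph I where
  Adj i j := G.Adj i j ∧ η j = η i - 1

/-- The height function obtained by firing the vertices of a word. -/
def lowered (η : I → ℤ) (l : List I) : I → ℤ := fun j => η j - 2 * (l.count j : ℤ)

theorem lowered_lowered (η : I → ℤ) (l l' : List I) :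
    lowered (lowered η l) l' = lowered η (l ++ l') := by
  ext j
  simp only [lowered, List.count_append]
  push_cast
  ring

/-- The orientation is recovered from the heights, so reflecting quivers becomes arithmetic on
height functions. -/
theorem heightQuiver_eq {Q : Digraph I} (hQ : IsOrientation G Q) {ξ : I → ℤ}
    (hξ : ∀ i j, Q.Adj i j → ξ j = ξ i - 1) : Q = heightQuiver G ξ := by
  ext i j
  refine ⟨fun h => ⟨hQ.1 i j h, hξ i j h⟩, fun ⟨h, h'⟩ => ?_⟩
  rw [hQ.2 i j h]
  intro hji
  have := hξ j i hji
  omega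

theorem isHeight_of_isOrientation {Q : Digraph I} (hQ : IsOrientation G Q) {ξ : I → ℤ}
    (hξ : ∀ i j, Q.Adj i j → ξ j = ξ i - 1) : IsHeight G ξ := fun i j h => by
  by_cases hji : Q.Adj j i
  · exact .inr (hξ j i hji)
  · exact .inl (hξ i j ((hQ.2 i j h).2 hji))

theorem height_of_isSource {η : I → ℤ} (hη : IsHeight G η) {i : I}
    (h : IsSource (heightQuiver G η) i) {k : I} (hk : G.Adj i k) : η k = η i - 1 :=
  (hη i k hk).resolve_right fun h' => h k ⟨hk.symm, h'⟩

/-- All neighbours of a source lie exactly one below it; lowering the source by `2` puts it one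
below them, which reverses precisely the arrows at `i`. -/
theorem reflectQuiver_heightQuiver {η : I → ℤ} (hη : IsHeight G η) {i : I}
    (h : IsSource (heightQuiver G η) i) :
    reflectQuiver i (heightQuiver G η) = heightQuiver G (lowered η [i]) := by
  ext a b
  simp only [reflectQuiver, heightQuiver, lowered, List.count_singleton']
  by_cases ha : a = i
  · subst ha
    by_cases hb : b = a
    · subst hb; simp
    · simp only [true_or, if_true, hb, Ne.symm hb, if_false]
      constructor
      · rintro ⟨h1, h2⟩
        have := height_of_isSource hη h h1.symm
        omega
      · rintro ⟨h1, h2⟩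
        have := height_of_isSource hη h h1
        omega
  · by_cases hb : b = i
    · subst hb
      simp only [or_true, if_true, ha, Ne.symm ha, if_false]
      constructor
      · rintro ⟨h1, h2⟩
        exact ⟨h1.symm, by omega⟩
      · rintro ⟨h1, h2⟩
        exact ⟨h1.symm, by omega⟩
    · simp [ha, hb, Ne.symm ha, Ne.symm hb]

theorem isHeight_lowered {η : I → ℤ} (hη : IsHeight G η) {i : I}
    (h : IsSource (heightQuiver G η) i) : IsHeight G (lowered η [i]) := by
  intro a b hab
  simp only [lowered, List.count_singleton']
  have h1 := hη a b hab
  by_cases ha : a = i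
  · subst ha
    have h2 := height_of_isSource hη h hab
    simp only [if_true, hab.ne, if_false]
    omega
  · by_cases hb : b = i
    · subst hb
      have h2 := height_of_isSource hη h hab.symm
      simp only [if_true, hab.ne', if_false]
      omega
    · simp only [Ne.symm ha, Ne.symm hb, if_false]
      omega

theorem IsAdapted.induction {motive : (I → ℤ) → List I → Prop}
    (nil : ∀ η, IsHeight G η → motive η [])
    (cons : ∀ η i l, IsHeight G η → (∀ k, G.Adj i k → η k = η i - 1) →
      IsHeight G (lowered η [i]) → IsAdapted (heightQuiver G (lowered η [i])) l →
      motive (lowered η [i]) l → motive η (i :: l))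
    (l : List I) (η : I → ℤ) (hη : IsHeight G η) (h : IsAdapted (heightQuiver G η) l) :
    motive η l := by
  induction l generalizing η with
  | nil => exact nil η hη
  | cons i l ih =>
    obtain ⟨h1, h2⟩ := h
    rw [reflectQuiver_heightQuiver hη h1] at h2
    have h3 := isHeight_lowered hη h1
    exact cons η i l hη (fun k hk => height_of_isSource hη h1 hk) h3 h2 (ih _ h3 h2)

theorem isAdapted_append_left {Q : Digraph I} {l l' : List I} (h : IsAdapted Q (l ++ l')) :
    IsAdapted Q l := by
  induction l generalizing Q with
  | nil => trivial
  | cons i l ih => exact ⟨h.1, ih h.2⟩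

/-- After a prefix of an adapted word, the next letter is a local maximum of the height. -/
theorem height_of_isAdapted_append {i : I} {l₂ : List I} (l₁ : List I) (η : I → ℤ)
    (hη : IsHeight G η) (h : IsAdapted (heightQuiver G η) (l₁ ++ i :: l₂)) (k : I)
    (hk : G.Adj i k) : lowered η l₁ k = lowered η l₁ i - 1 := by
  induction l₁ generalizing η with
  | nil => simpa [lowered] using height_of_isSource hη h.1 hk
  | cons j l₁ ih =>
    obtain ⟨h1, h2⟩ := h
    rw [reflectQuiver_heightQuiver hη h1] at h2
    have := ih _ (isHeight_lowered hη h1) h2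
    rwa [lowered_lowered] at this

theorem isHeight_lowered_of_isAdapted (l : List I) (η : I → ℤ)
    (hη : IsHeight G η) (h : IsAdapted (heightQuiver G η) l) : IsHeight G (lowered η l) := by
  refine IsAdapted.induction (motive := fun η l => IsHeight G (lowered η l)) ?_ ?_ l η hη h
  · intro η hη
    have : lowered η [] = η := by ext j; simp [lowered]
    rwa [this]
  · intro η i l _ _ _ _ ih
    rwa [lowered_lowered] at ih

/-- Induction along the arrows of the quiver of a height function. -/
theorem height_induction (η : I → ℤ) {p : I → Prop}
    (h : ∀ j, (∀ k, η k = η j + 1 → p k) → p j) (j : I) : p j := by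
  have hwf : WellFounded fun a b : I => η b < η a :=
    @Finite.wellFounded_of_trans_of_irrefl I _ _ ⟨fun _ _ _ h1 h2 => h2.trans h1⟩
      ⟨fun _ => lt_irrefl _⟩
  induction j using hwf.induction with
  | _ j ih => exact h j fun k hk => ih k (by omega)

/-! ## Systems of roots attached to an adapted word -/

/-- `W` and `u` are related by `u_j = W α_j + ∑_{k → j} u_k`. -/
def IsRootSystemAt (G : SimpleGraph I) [DecidableRel G.Adj] (η : I → ℤ)
    (W : (I → ℤ) ≃ₗ[ℤ] (I → ℤ)) (u : I → I → ℤ) : Prop :=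
  ∀ j, u j = W (simpleRoot j) + ∑ k, if G.Adj k j ∧ η j = η k - 1 then u k else 0

/-- The mesh mutation at `i`. -/
def fire (G : SimpleGraph I) [DecidableRel G.Adj] (i : I) (u : I → I → ℤ) : I → I → ℤ :=
  Function.update u i (-u i + ∑ k, if G.Adj i k then u k else 0)

/-- The mesh mutations along a word. -/
def fireList (G : SimpleGraph I) [DecidableRel G.Adj] : List I → (I → I → ℤ) → I → I → ℤ
  | [], u => u
  | i :: l, u => fireList G l (fire G i u)

theorem IsRootSystemAt.of_source {η : I → ℤ} {W : (I → ℤ) ≃ₗ[ℤ] (I → ℤ)} {u : I → I → ℤ}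
    (h : IsRootSystemAt G η W u) {i : I} (hi : ∀ k, G.Adj i k → η k = η i - 1) :
    u i = W (simpleRoot i) := by
  rw [h i, Finset.sum_eq_zero, add_zero]
  intro k _
  rw [if_neg]
  rintro ⟨h1, h2⟩
  have := hi k h1.symm
  omega

/-- At a source `u_i = W α_i`. After firing, `i` is a sink: `W s_i α_i = -W α_i` and its sum runs
over all neighbours, which is the mesh mutation. A neighbour `j` loses the arrow `i → j`, but `W s_i
α_j = W α_j + W α_i` supplies the missing `u_i`. -/
theorem IsRootSystemAt.fire {η : I → ℤ} {W : (I → ℤ) ≃ₗ[ℤ] (I → ℤ)} {u : I → I → ℤ}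
    (h : IsRootSystemAt G η W u) {i : I} (hi : ∀ k, G.Adj i k → η k = η i - 1) :
    IsRootSystemAt G (lowered η [i]) (W * simpleReflection G i) (fire G i u) := by
  intro j
  have hui := h.of_source hi
  by_cases hj : j = i
  · subst hj
    simp only [HernandezLeclerc.fire, Function.update_self, LinearEquiv.mul_apply,
      simpleReflection_simpleRoot_self, map_neg, hui]
    congr 1
    refine Finset.sum_congr rfl fun k _ => ?_
    by_cases hk : G.Adj j k
    · have h1 := hi k hk
      have h2 : j ≠ k := hk.ne
      simp only [hk, hk.symm, lowered, List.count_singleton', if_true, h2, if_false, true_and]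
      rw [if_pos (by omega), Function.update_of_ne h2.symm]
    · simp [hk, G.adj_comm k j]
  · simp only [HernandezLeclerc.fire, Function.update_of_ne hj, LinearEquiv.mul_apply,
      simpleReflection_simpleRoot_of_ne hj, map_add]
    rw [h j, add_assoc]
    congr 1
    rw [← Finset.add_sum_erase _ _ (Finset.mem_univ i),
      ← Finset.add_sum_erase (a := i) (f := fun k => if G.Adj k j ∧ lowered η [i] j =
        lowered η [i] k - 1 then _ else _) _ (Finset.mem_univ i), ← add_assoc]
    congr 1
    · by_cases hij : G.Adj i j
      · have h1 := hi j hij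
        simp only [hij, lowered, List.count_singleton', if_true, Ne.symm hj, if_false, true_and,
          hui]
        rw [if_pos (by omega), if_neg (by omega), add_zero]
      · simp [hij]
    · refine Finset.sum_congr rfl fun k hk => ?_
      have hki := Finset.ne_of_mem_erase hk
      simp only [lowered, List.count_singleton', Ne.symm hki, Ne.symm hj, if_false,
        Function.update_of_ne hki]
      simp

theorem isRootSystemAt_fireList (l : List I) (η : I → ℤ) (hη : IsHeight G η)
    (hl : IsAdapted (heightQuiver G η) l) (W : (I → ℤ) ≃ₗ[ℤ] (I → ℤ)) (u : I → I → ℤ)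
    (h : IsRootSystemAt G η W u) :
    IsRootSystemAt G (lowered η l) (W * wordProd G l) (fireList G l u) := by
  revert W u
  refine IsAdapted.induction (motive := fun η l => ∀ W u, IsRootSystemAt G η W u →
    IsRootSystemAt G (lowered η l) (W * wordProd G l) (fireList G l u)) ?_ ?_ l η hη hl
  · intro η _ W u h
    have : lowered η [] = η := by ext j; simp [lowered]
    simpa [this, fireList] using h
  · intro η i l _ hi _ _ ih W u h
    have := ih _ _ (h.fire hi)
    rw [lowered_lowered] at this
    simpa [wordProd_cons, fireList, mul_assoc] using this

/-- The relation is a recursion along arrows, well-founded because arrows lower the height. -/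
theorem IsRootSystemAt.unique {η : I → ℤ} {W : (I → ℤ) ≃ₗ[ℤ] (I → ℤ)} {u u' : I → I → ℤ}
    (h : IsRootSystemAt G η W u) (h' : IsRootSystemAt G η W u') : u = u' := by
  ext1 j
  induction j using height_induction η with
  | h j ih =>
    rw [h j, h' j]
    congr 1
    refine Finset.sum_congr rfl fun k _ => ?_
    split_ifs with hk
    · exact ih k (by omega)
    · rfl

theorem IsRootSystemAt.map {η : I → ℤ} {W : (I → ℤ) ≃ₗ[ℤ] (I → ℤ)} {u : I → I → ℤ}
    (h : IsRootSystemAt G η W u) (x : (I → ℤ) ≃ₗ[ℤ] (I → ℤ)) :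
    IsRootSystemAt G η (x * W) fun j => x (u j) := by
  intro j
  beta_reduce
  conv_lhs => rw [h j]
  simp only [map_add, map_sum, LinearEquiv.mul_apply]
  congr 1
  refine Finset.sum_congr rfl fun k _ => ?_
  split_ifs <;> simp

theorem fireList_of_notMem (l : List I) (u : I → I → ℤ) {j : I} (hj : j ∉ l) :
    fireList G l u j = u j := by
  induction l generalizing u with
  | nil => rfl
  | cons i l ih =>
    rw [fireList, ih _ fun h => hj (List.mem_cons_of_mem _ h), fire,
      Function.update_of_ne (by rintro rfl; exact hj List.mem_cons_self)]

/-- No letter repeats, so each listed vertex fires once. When `j` fires, it is a local maximum of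
the height: a neighbour that started above it has already fired, one that started below has not. -/
theorem fireList_mesh (l : List I) (η : I → ℤ) (hη : IsHeight G η)
    (hl : IsAdapted (heightQuiver G η) l) (hnd : l.Nodup) (u : I → I → ℤ) (j : I) (hj : j ∈ l) :
    u j + fireList G l u j = ∑ k, if G.Adj j k then
      (if η k = η j + 1 then fireList G l u k else u k) else 0 := by
  revert hnd u j hj
  refine IsAdapted.induction (motive := fun η l => l.Nodup → ∀ (u : I → I → ℤ) (j : I),
    j ∈ l → u j + fireList G l u j = ∑ k, if G.Adj j k then
      (if η k = η j + 1 then fireList G l u k else u k) else 0) ?_ ?_ l η hη hl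
  · simp
  · intro η i l _ hi _ _ ih hnd u j hj
    rw [List.nodup_cons] at hnd
    by_cases hji : j = i
    · subst hji
      rw [fireList, fireList_of_notMem l _ hnd.1, fire, Function.update_self, add_neg_cancel_left]
      refine Finset.sum_congr rfl fun k _ => ?_
      by_cases hk : G.Adj j k
      · have := hi k hk
        rw [if_pos hk, if_pos hk, if_neg (by omega)]
      · simp [hk]
    · have h := ih hnd.2 (fire G i u) j (by simpa [hji] using hj)
      have hj' : fire G i u j = u j := by simp [fire, hji]
      rw [hj'] at h
      rw [fireList, h]
      refine Finset.sum_congr rfl fun k _ => ?_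
      by_cases hk : G.Adj j k
      · rw [if_pos hk, if_pos hk]
        by_cases hki : k = i
        · subst hki
          have := hi j hk.symm
          simp only [lowered, List.count_singleton', if_true, Ne.symm hji, if_false]
          rw [if_neg (by push_cast; omega), if_pos (by omega), fireList_of_notMem l _ hnd.1]
        · have : fire G i u k = u k := by simp [fire, hki]
          simp [lowered, Ne.symm hki, Ne.symm hji, this]
      · simp [hk]

/-- `B` satisfies the mesh relations of the quiver of `ξ`. -/
def IsMesh (G : SimpleGraph I) [DecidableRel G.Adj] (ξ : I → ℤ) (B : I → ℕ → I → ℤ) : Prop :=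
  ∀ j d, B j d + B j (d + 1) = ∑ k, if G.Adj j k then
    (if ξ k = ξ j + 1 then B k (d + 1) else B k d) else 0

/-- A mesh mutation at `i` moves a solution `B` of the mesh relations one step down in column `i`:
at a source, the depths of the neighbours are exactly those in the mesh relation starting at the
current depth of `i`. -/
theorem IsMesh.fireList_eq {ξ : I → ℤ} {B : I → ℕ → I → ℤ} (hB : IsMesh G ξ B)
    (hξ : IsHeight G ξ) (l : List I) (η : I → ℤ) (hη : IsHeight G η)
    (hl : IsAdapted (heightQuiver G η) l) (n : I → ℕ) (hn : ∀ j, η j = ξ j - 2 * (n j : ℤ)) :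
    fireList G l (fun j => B j (n j)) = fun j => B j (n j + l.count j) := by
  revert n hn
  refine IsAdapted.induction (motive := fun η l => ∀ (n : I → ℕ),
    (∀ j, η j = ξ j - 2 * (n j : ℤ)) →
    fireList G l (fun j => B j (n j)) = fun j => B j (n j + l.count j)) ?_ ?_ l η hη hl
  · intro η _ n _
    simp [fireList]
  · intro η i l hη hi _ _ ih n hn
    have hfire : fire G i (fun j => B j (n j)) = fun j => B j (n j + [i].count j) := by
      ext1 j
      by_cases hj : j = i
      · subst hj
        simp only [fire, Function.update_self, List.count_singleton_self]
        rw [neg_add_eq_iff_eq_add, hB j (n j)]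
        refine Finset.sum_congr rfl fun k _ => ?_
        by_cases hk : G.Adj j k
        · rw [if_pos hk, if_pos hk]
          have h1 := hi k hk
          rw [hn, hn] at h1
          have h2 := hξ j k hk
          split_ifs with h3
          · have : n k = n j + 1 := by omega
            rw [this]
          · have : n k = n j := by omega
            rw [this]
        · simp [hk]
      · simp [fire, hj, Ne.symm hj]
    rw [fireList, hfire, ih (fun j => n j + [i].count j)]
    · ext1 j
      simp only [List.count_cons, List.count_nil]
      congr 1
      ring
    · intro j
      simp only [lowered, hn]
      push_cast
      ring

end Quivers

end HernandezLeclerc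

namespace HernandezLeclerc

/-! ### The roots `τ_Q^d(γ_j)`: mesh relations, and the antiperiodicity given by `w₀`. -/

section Repetition

variable {I : Type*} [Fintype I] [DecidableEq I] {G : SimpleGraph I} [DecidableRel G.Adj]

/-! ## The roots `γ_j` -/

theorem height_le_of_reflTransGen {η : I → ℤ} {i j : I}
    (h : Relation.ReflTransGen (heightQuiver G η).Adj i j) : η j ≤ η i := by
  induction h with
  | refl => rfl
  | tail _ h ih => have := h.2; omega

theorem eq_of_reflTransGen_of_le {η : I → ℤ} {i j : I}
    (h : Relation.ReflTransGen (heightQuiver G η).Adj i j) (hle : η i ≤ η j) : i = j := by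
  rcases Relation.ReflTransGen.cases_head h with h | ⟨k, h1, h2⟩
  · exact h
  · have := height_le_of_reflTransGen h2
    have := h1.2
    omega

/-- On the indicator of a set of vertices, the form is twice the number of vertices minus the number
of arrows among them, each arrow being counted at its tail. -/
theorem form_indicator (R : I → Prop) [DecidablePred R] {η : I → ℤ} (hη : IsHeight G η) :
    form G (fun i => if R i then 1 else 0) (fun i => if R i then 1 else 0) =
      2 * ∑ l, if R l then 1 - ∑ k, (if R k ∧ G.Adj l k ∧ η k = η l - 1 then 1 else 0)
        else 0 := by
  set a : I → I → ℤ := fun l k => if R l ∧ R k ∧ G.Adj l k ∧ η k = η l - 1 then 1 else 0 with ha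
  have h1 : form G (fun i => if R i then 1 else 0) (fun i => if R i then 1 else 0) =
      ∑ l, ∑ k, ((if l = k then (if R l then 2 else 0) else 0) - (a l k + a k l)) := by
    simp only [form, dotProduct, Matrix.mulVec, Finset.mul_sum]
    refine Finset.sum_congr rfl fun l _ => Finset.sum_congr rfl fun k _ => ?_
    simp only [ha, cartan]
    by_cases hlk : l = k
    · subst hlk
      by_cases hl : R l <;> simp [hl]
    · by_cases hl : R l
      · by_cases hk : R k
        · by_cases hadj : G.Adj l k
          · have h2 := hη l k hadj
            simp only [hlk, hl, hk, hadj, hadj.symm, if_true, if_false, true_and]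
            rcases h2 with h2 | h2
            · rw [if_pos h2, if_neg (by omega)]; norm_num
            · rw [if_pos h2, if_neg (by omega)]; norm_num
          · simp [hlk, hl, hk, hadj, G.adj_comm k l]
        · simp [hlk, hl, hk]
      · simp [hlk, hl]
  have h2 : ∑ l, ∑ k, a k l = ∑ l, ∑ k, a l k := Finset.sum_comm
  rw [h1]
  simp only [Finset.sum_sub_distrib, Finset.sum_add_distrib, h2, Finset.sum_ite_eq,
    Finset.mem_univ, if_true]
  rw [← two_mul, Finset.mul_sum, Finset.mul_sum, ← Finset.sum_sub_distrib]
  refine Finset.sum_congr rfl fun l _ => ?_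
  by_cases hl : R l
  · simp only [ha, hl, true_and, if_true]
    ring
  · simp [ha, hl]

/-- In a Dynkin quiver a vertex has at most one arrow towards the vertices above a given one. -/
theorem eq_of_adj_of_reflTransGen (hG : IsSimplyLacedDynkin G) {η : I → ℤ} (hη : IsHeight G η)
    {j l k k' : I} (hlk : (heightQuiver G η).Adj l k) (hlk' : (heightQuiver G η).Adj l k')
    (hk : Relation.ReflTransGen (heightQuiver G η).Adj k j)
    (hk' : Relation.ReflTransGen (heightQuiver G η).Adj k' j) : k = k' := by
  classical
  by_contra hne
  set R : I → Prop := fun i => Relation.ReflTransGen (heightQuiver G η).Adj i j with hR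
  have hRj : R j := Relation.ReflTransGen.refl
  have hpos : 0 < form G (fun i => if R i then 1 else 0) (fun i => if R i then 1 else 0) := by
    refine form_self_pos hG fun h => ?_
    have := congrFun h j
    simp [hRj] at this
  rw [form_indicator R hη] at hpos
  have hlj : l ≠ j := by
    rintro rfl
    have := height_le_of_reflTransGen hk
    have := hlk.2
    omega
  -- `o l` counts the arrows from `l` into the set `R` of vertices having a path to `j`. Each vertex
  -- of `R` other than `j` has at least one; a vertex with two would give at least as many arrows as
  -- vertices, contradicting positivity of the form on the indicator of `R`.
  set o : I → ℤ := fun l => ∑ k, (if R k ∧ G.Adj l k ∧ η k = η l - 1 then (1 : ℤ) else 0) with ho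
  have hnn : ∀ l k, 0 ≤ (if R k ∧ G.Adj l k ∧ η k = η l - 1 then (1 : ℤ) else 0) := by
    intro l k; split_ifs <;> simp
  have ho0 : ∀ l, 0 ≤ o l := fun l => Finset.sum_nonneg fun k _ => hnn l k
  have ho1 : ∀ l, R l → l ≠ j → 1 ≤ o l := by
    intro l hl hne
    obtain ⟨k, h1, h2⟩ := (Relation.ReflTransGen.cases_head hl).resolve_left hne
    refine le_trans ?_ (Finset.single_le_sum (fun k _ => hnn l k) (Finset.mem_univ k))
    rw [if_pos ⟨h2, h1⟩]
  have ho2 : 2 ≤ o l := by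
    rw [ho]
    refine le_trans ?_ (Finset.add_le_sum (fun k _ => hnn l k) (Finset.mem_univ k)
      (Finset.mem_univ k') hne)
    rw [if_pos ⟨hk, hlk⟩, if_pos ⟨hk', hlk'⟩]
    norm_num
  have hl : R l := Relation.ReflTransGen.head hlk hk
  have hsum : ∑ l, (if R l then 1 - o l else 0) ≤ 0 := by
    rw [← Finset.add_sum_erase _ _ (Finset.mem_univ j),
      ← Finset.add_sum_erase _ _ (Finset.mem_erase.2 ⟨hlj, Finset.mem_univ l⟩), if_pos hRj,
      if_pos hl]
    have h1 : ∑ x ∈ (Finset.univ.erase j).erase l, (if R x then 1 - o x else 0) ≤ 0 := by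
      refine Finset.sum_nonpos fun x hx => ?_
      split_ifs with h
      · have := ho1 x h (Finset.ne_of_mem_erase (Finset.mem_of_mem_erase hx))
        omega
      · rfl
    have h2 := ho0 j
    linarith
  linarith

/-- Two paths from `l` to `j` can never branch, by `eq_of_adj_of_reflTransGen`, so they end with the
same arrow. -/
theorem eq_of_reflTransGen_of_adj (hG : IsSimplyLacedDynkin G) {η : I → ℤ} (hη : IsHeight G η)
    {j l k k' : I} (hk : (heightQuiver G η).Adj k j) (hk' : (heightQuiver G η).Adj k' j)
    (hl : Relation.ReflTransGen (heightQuiver G η).Adj l k)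
    (hl' : Relation.ReflTransGen (heightQuiver G η).Adj l k') : k = k' := by
  have hkh := hk.2
  have hkh' := hk'.2
  induction hl using Relation.ReflTransGen.head_induction_on with
  | refl => exact eq_of_reflTransGen_of_le hl' (by omega)
  | @head a c hac hc ih =>
    rcases Relation.ReflTransGen.cases_head hl' with rfl | ⟨c', h1, h2⟩
    · have := height_le_of_reflTransGen hc
      have := hac.2
      omega
    · have : c = c' := eq_of_adj_of_reflTransGen hG hη hac h1 (hc.tail hk) (h2.tail hk')
      subst this
      exact ih h2

/-- A vertex `l ≠ j` with a path to `j` reaches exactly one of the tails `k → j`, so it is counted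
once in `∑_{k → j} γ_k`. -/
theorem isRootSystemAt_gammaRoot (hG : IsSimplyLacedDynkin G) {η : I → ℤ} (hη : IsHeight G η) :
    IsRootSystemAt G η 1 (gammaRoot (heightQuiver G η)) := by
  classical
  intro j
  ext l
  have hsum : (∑ k, if G.Adj k j ∧ η j = η k - 1 then gammaRoot (heightQuiver G η) k
      else 0) l = ∑ k, if (heightQuiver G η).Adj k j ∧
        Relation.ReflTransGen (heightQuiver G η).Adj l k then 1 else 0 := by
    rw [Finset.sum_apply]
    refine Finset.sum_congr rfl fun k _ => ?_
    by_cases h : G.Adj k j ∧ η j = η k - 1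
    · rw [if_pos h]
      have h' : (heightQuiver G η).Adj k j := h
      simp [h', gammaRoot]
    · simp only [heightQuiver, h, false_and, if_false]
      rfl
  rw [Pi.add_apply, hsum]
  change _ = simpleRoot j l + _
  by_cases hlj : l = j
  · subst hlj
    rw [Finset.sum_eq_zero]
    · simp [gammaRoot, simpleRoot, Relation.ReflTransGen.refl]
    · intro k _
      rw [if_neg]
      rintro ⟨h1, h2⟩
      have := height_le_of_reflTransGen h2
      have := h1.2
      omega
  · simp only [simpleRoot, Pi.single_apply, hlj, if_false, zero_add]
    by_cases hp : Relation.ReflTransGen (heightQuiver G η).Adj l j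
    · obtain ⟨k, h1, h2⟩ := (Relation.ReflTransGen.cases_tail hp).resolve_left (Ne.symm hlj)
      rw [Finset.sum_eq_single k]
      · simp [gammaRoot, hp, h1, h2]
      · intro k' _ hk'
        rw [if_neg]
        rintro ⟨h3, h4⟩
        exact hk' (eq_of_reflTransGen_of_adj hG hη h3 h2 h4 h1)
      · simp
    · rw [Finset.sum_eq_zero]
      · simp [gammaRoot, hp]
      · intro k _
        rw [if_neg]
        rintro ⟨h1, h2⟩
        exact hp (h2.tail h1)

theorem gammaRoot_nonneg (Q : Digraph I) (j l : I) : 0 ≤ gammaRoot Q j l := by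
  classical
  simp only [gammaRoot]
  split_ifs <;> simp

theorem gammaRoot_self (Q : Digraph I) (j : I) : gammaRoot Q j j = 1 := by
  simp [gammaRoot, Relation.ReflTransGen.refl]

/-- Linear forms on the root lattice can be prescribed on the `γ_j`. -/
theorem exists_linearMap_gammaRoot (hG : IsSimplyLacedDynkin G) {η : I → ℤ}
    (hη : IsHeight G η) (x : I → ℤ) :
    ∃ f : (I → ℤ) →ₗ[ℤ] ℤ, (∀ j, f (gammaRoot (heightQuiver G η) j) = x j) ∧
      ∀ j, f (simpleRoot j) = x j - ∑ k, if G.Adj k j ∧ η j = η k - 1 then x k else 0 := by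
  -- These values on the simple roots are forced by `γ_j = α_j + ∑_{k → j} γ_k`.
  set y : I → ℤ := fun j => x j - ∑ k, if G.Adj k j ∧ η j = η k - 1 then x k else 0 with hy
  set f : (I → ℤ) →ₗ[ℤ] ℤ := ∑ i, y i • LinearMap.proj i with hf
  have hfs : ∀ j, f (simpleRoot j) = y j := fun j => by
    simp [hf, simpleRoot, Pi.single_apply]
  refine ⟨f, fun j => ?_, hfs⟩
  induction j using height_induction η with
  | h j ih =>
    rw [isRootSystemAt_gammaRoot hG hη j, map_add, map_sum]
    change f (simpleRoot j) + _ = _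
    rw [hfs, hy]
    have : ∑ k, f (if G.Adj k j ∧ η j = η k - 1 then gammaRoot (heightQuiver G η) k else 0) =
        ∑ k, if G.Adj k j ∧ η j = η k - 1 then x k else 0 := by
      refine Finset.sum_congr rfl fun k _ => ?_
      split_ifs with h
      · exact ih k (by omega)
      · simp
    rw [this]
    ring

/-! ## The Coxeter element -/

theorem isAdapted_concat {j : I} (l : List I) (η : I → ℤ) (hη : IsHeight G η)
    (h : IsAdapted (heightQuiver G η) l)
    (hj : ∀ k, G.Adj j k → lowered η l k = lowered η l j - 1) :
    IsAdapted (heightQuiver G η) (l ++ [j]) := by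
  induction l generalizing η with
  | nil =>
    refine ⟨fun k hk => ?_, trivial⟩
    have := hj k hk.1.symm
    simp only [lowered, List.count_nil] at this
    have := hk.2
    omega
  | cons i l ih =>
    obtain ⟨h1, h2⟩ := h
    refine ⟨h1, ?_⟩
    rw [reflectQuiver_heightQuiver hη h1] at h2 ⊢
    refine ih _ (isHeight_lowered hη h1) h2 ?_
    rwa [lowered_lowered]

/-- Listing the vertices by decreasing height gives an adapted word; this makes the choice defining
`coxeter` meaningful. The induction keeps the set of listed vertices closed under passing to a
greater height. -/
theorem exists_isAdaptedCoxeter {η : I → ℤ} (hη : IsHeight G η) :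
    ∃ τ, IsAdaptedCoxeter G (heightQuiver G η) τ := by
  have key : ∀ n ≤ Fintype.card I, ∃ l : List I, l.length = n ∧ l.Nodup ∧
      IsAdapted (heightQuiver G η) l ∧ ∀ k ∈ l, ∀ j, η k < η j → j ∈ l := by
    intro n
    induction n with
    | zero => exact fun _ => ⟨[], rfl, List.nodup_nil, trivial, by simp⟩
    | succ n ih =>
      intro hn
      obtain ⟨l, hlen, hnd, had, hup⟩ := ih (by omega)
      have hne : (Finset.univ.filter (· ∉ l)).Nonempty := by
        by_contra h
        rw [Finset.not_nonempty_iff_eq_empty, Finset.filter_eq_empty_iff] at h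
        have h2 : Finset.univ ⊆ l.toFinset := fun i _ => by
          simpa using h (Finset.mem_univ i)
        have h3 := Finset.card_le_card h2
        rw [List.toFinset_card_of_nodup hnd, Finset.card_univ] at h3
        omega
      obtain ⟨j, hj, hmax⟩ := Finset.exists_max_image _ η hne
      simp only [Finset.mem_filter, Finset.mem_univ, true_and] at hj hmax
      refine ⟨l ++ [j], by simp [hlen], ?_, isAdapted_concat l η hη had fun k hk => ?_, ?_⟩
      · rw [List.nodup_append]
        exact ⟨hnd, List.nodup_singleton j, by rintro a ha b hb rfl; simp_all⟩
      · have h1 := hη j k hk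
        simp only [lowered, List.count_eq_zero_of_not_mem hj]
        by_cases hkl : k ∈ l
        · rw [List.count_eq_one_of_mem hnd hkl]
          have : ¬ η k < η j := fun h => hj (hup k hkl j h)
          push_cast
          omega
        · rw [List.count_eq_zero_of_not_mem hkl]
          have := hmax k hkl
          push_cast
          omega
      · intro k hk i hki
        rw [List.mem_append, List.mem_singleton] at hk ⊢
        rcases hk with hk | rfl
        · exact .inl (hup k hk i hki)
        · by_contra h
          rw [not_or] at h
          have := hmax i h.1
          omega
  obtain ⟨l, hlen, hnd, had, -⟩ := key _ le_rfl
  refine ⟨_, l, hnd, fun i => ?_, had, rfl⟩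
  have : l.toFinset = Finset.univ := Finset.eq_univ_of_card _ (by
    rw [List.toFinset_card_of_nodup hnd, hlen])
  rw [← List.mem_toFinset, this]
  exact Finset.mem_univ i

theorem isAdaptedCoxeter_coxeter {η : I → ℤ} (hη : IsHeight G η) :
    IsAdaptedCoxeter G (heightQuiver G η) (coxeter G (heightQuiver G η)) :=
  Classical.epsilon_spec (exists_isAdaptedCoxeter hη)

/-- The root `τ_Q^d(γ_j)`. -/
def rootAt (G : SimpleGraph I) [DecidableRel G.Adj] (Q : Digraph I) (j : I) (d : ℕ) : I → ℤ :=
  (coxeter G Q ^ d) (gammaRoot Q j)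

theorem rootAt_zero (Q : Digraph I) (j : I) : rootAt G Q j 0 = gammaRoot Q j := rfl

theorem rootAt_succ (Q : Digraph I) (j : I) (d : ℕ) :
    rootAt G Q j (d + 1) = coxeter G Q (rootAt G Q j d) := by
  rw [rootAt, pow_succ']
  rfl

/-- Firing every vertex once lowers all heights by `2`, so the arrows are unchanged and both
families solve the same recursion. -/
theorem fireList_gammaRoot_coxeter (hG : IsSimplyLacedDynkin G) {η : I → ℤ}
    (hη : IsHeight G η) {l : List I} (hnd : l.Nodup) (hl : ∀ i, i ∈ l)
    (had : IsAdapted (heightQuiver G η) l) :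
    fireList G l (gammaRoot (heightQuiver G η)) =
      fun j => wordProd G l (gammaRoot (heightQuiver G η) j) := by
  have h0 := isRootSystemAt_gammaRoot hG hη
  have h1 := isRootSystemAt_fireList l η hη had 1 _ h0
  have h2 := h0.map (wordProd G l)
  rw [one_mul] at h1
  rw [mul_one] at h2
  refine IsRootSystemAt.unique (η := η) (fun j => ?_) h2
  have h3 := h1 j
  simp only [lowered, List.count_eq_one_of_mem hnd (hl _)] at h3
  refine h3.trans ?_
  congr 1
  refine Finset.sum_congr rfl fun k _ => ?_
  congr 1
  apply propext
  constructor
  · rintro ⟨h4, h5⟩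
    exact ⟨h4, by omega⟩
  · rintro ⟨h4, h5⟩
    exact ⟨h4, by omega⟩

/-- At depth `0` this is `fireList_mesh` for a Coxeter word; applying `τ_Q` carries the relation to
every depth. -/
theorem isMesh_rootAt (hG : IsSimplyLacedDynkin G) {η : I → ℤ} (hη : IsHeight G η) :
    IsMesh G η (rootAt G (heightQuiver G η)) := by
  obtain ⟨l, hnd, hl, had, hτ⟩ := isAdaptedCoxeter_coxeter hη
  intro j d
  induction d with
  | zero =>
    have h := fireList_mesh l η hη had hnd (gammaRoot (heightQuiver G η)) j (hl j)
    rw [fireList_gammaRoot_coxeter hG hη hnd hl had, ← hτ] at h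
    exact h
  | succ d ih =>
    rw [rootAt_succ _ j d, rootAt_succ _ j (d + 1), ← map_add, ih, map_sum]
    refine Finset.sum_congr rfl fun k _ => ?_
    split_ifs
    · rw [← rootAt_succ]
    · rw [← rootAt_succ]
    · simp

theorem coxeter_mem {η : I → ℤ} (hη : IsHeight G η) :
    coxeter G (heightQuiver G η) ∈ weylGroup G := by
  obtain ⟨l, -, -, -, hτ⟩ := isAdaptedCoxeter_coxeter hη
  rw [hτ]
  exact wordProd_mem l

theorem fireList_gammaRoot (hG : IsSimplyLacedDynkin G) {η : I → ℤ} (hη : IsHeight G η)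
    {l : List I} (had : IsAdapted (heightQuiver G η) l) :
    fireList G l (gammaRoot (heightQuiver G η)) =
      fun j => rootAt G (heightQuiver G η) j (l.count j) := by
  have := (isMesh_rootAt hG hη).fireList_eq hη l η hη had (fun _ => 0) (by simp)
  simpa [rootAt_zero] using this

/-- After firing `l₁`, the vertex `i` is a source, so its vector is `W α_i` with `W` the product of
`l₁`. On the other hand, the mesh relations identify it with `τ_Q^d(γ_i)`, where `d` counts the
earlier letters `i`. -/
theorem wordProd_simpleRoot (hG : IsSimplyLacedDynkin G) {η : I → ℤ} (hη : IsHeight G η)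
    {l₁ l₂ : List I} {i : I} (had : IsAdapted (heightQuiver G η) (l₁ ++ i :: l₂)) :
    wordProd G l₁ (simpleRoot i) = rootAt G (heightQuiver G η) i (l₁.count i) := by
  have h1 := isAdapted_append_left had
  have h2 := isRootSystemAt_fireList l₁ η hη h1 1 _ (isRootSystemAt_gammaRoot hG hη)
  have h3 := h2.of_source (height_of_isAdapted_append l₁ η hη had)
  rw [one_mul, fireList_gammaRoot hG hη h1] at h3
  exact h3.symm

theorem gammaRoot_mem_positiveRoots (hG : IsSimplyLacedDynkin G) {η : I → ℤ}
    (hη : IsHeight G η) (j : I) : gammaRoot (heightQuiver G η) j ∈ positiveRoots G := by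
  refine ⟨?_, gammaRoot_nonneg _ j⟩
  obtain ⟨l, hnd, hl, had, -⟩ := isAdaptedCoxeter_coxeter hη
  obtain ⟨l₁, l₂, rfl⟩ := List.append_of_mem (hl j)
  have h := wordProd_simpleRoot hG hη had
  have hj : j ∉ l₁ := fun hj => (List.nodup_append.1 hnd).2.2 j hj j List.mem_cons_self rfl
  rw [List.count_eq_zero_of_not_mem hj, rootAt_zero] at h
  exact ⟨_, wordProd_mem l₁, j, h.symm⟩

theorem rootAt_mem_roots (hG : IsSimplyLacedDynkin G) {η : I → ℤ} (hη : IsHeight G η) (j : I)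
    (d : ℕ) : rootAt G (heightQuiver G η) j d ∈ roots G :=
  apply_mem_roots (pow_mem (coxeter_mem hη) d) (gammaRoot_mem_positiveRoots hG hη j).1

/-! ## Adapted reduced words of the longest element -/

/-- All the roots attached to a reduced expression of the longest element are positive. -/
theorem wordProd_simpleRoot_mem_positiveRoots (hG : IsSimplyLacedDynkin G) {l : List I}
    (hl : IsLongest G (wordProd G l)) (hlen : l.length = numPos G) {l₁ l₂ : List I} {i : I}
    (h : l = l₁ ++ i :: l₂) : wordProd G l₁ (simpleRoot i) ∈ positiveRoots G := by
  classical
  set f : Fin l.length → I → ℤ := fun t => wordProd G (l.take t) (simpleRoot l[t]) with hf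
  set S := (finite_positiveRoots hG).toFinset with hS
  have hcard : S.card = numPos G := by
    rw [numPos, Nat.card_coe_set_eq, Set.ncard_eq_toFinset_card _ (finite_positiveRoots hG)]
  have hmem : ∀ {m₁ m₂ : List I} {k : I}, l = m₁ ++ k :: m₂ →
      wordProd G m₁ (simpleRoot k) ∈ Finset.univ.image f := by
    rintro m₁ m₂ k rfl
    refine Finset.mem_image.2 ⟨⟨m₁.length, by simp⟩, Finset.mem_univ _, ?_⟩
    simp [hf]
  -- `w₀` makes every positive root negative, so each one is among the `N` roots attached to the
  -- prefixes. Comparing cardinalities, these roots are exactly the positive ones.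
  have hsub : S ⊆ Finset.univ.image f := fun β hβ => by
    have hβ' : β ∈ positiveRoots G := by simpa [hS] using hβ
    have hinv : (wordProd G l)⁻¹ = wordProd G l :=
      inv_eq_of_mul_eq_one_left (hl.mul_self hG hl)
    obtain ⟨m₁, k, m₂, hm, rfl⟩ := exists_split_of_neg hG l hβ'
      (by rw [hinv]; exact hl.2 β hβ')
    exact hmem hm
  have heq := Finset.eq_of_subset_of_card_le hsub (by
    rw [hcard, ← hlen]
    exact Finset.card_image_le.trans (by simp))
  have := hmem h
  rw [← heq] at this
  simpa [hS] using this

/-- At the end of the word the recursion reads `u_j = w₀ α_j + ∑_{k → j} u_k` with `w₀ α_j`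
negative, so nonpositivity propagates along the arrows. -/
theorem rootAt_count_nonpos (hG : IsSimplyLacedDynkin G) {η : I → ℤ} (hη : IsHeight G η)
    {l : List I} (hl : IsLongest G (wordProd G l)) (had : IsAdapted (heightQuiver G η) l)
    (j i : I) : rootAt G (heightQuiver G η) j (l.count j) i ≤ 0 := by
  have h := isRootSystemAt_fireList l η hη had 1 _ (isRootSystemAt_gammaRoot hG hη)
  rw [one_mul, fireList_gammaRoot hG hη had] at h
  induction j using height_induction (lowered η l) with
  | h j ih =>
    have hj := h j
    beta_reduce at hj
    rw [hj, Pi.add_apply, Finset.sum_apply]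
    have h1 := (hl.2 _ (simpleRoot_mem_positiveRoots j)).2 i
    rw [Pi.neg_apply] at h1
    have h2 : ∑ k, (if G.Adj k j ∧ lowered η l j = lowered η l k - 1 then
        rootAt G (heightQuiver G η) k (l.count k) else 0) i ≤ 0 := by
      refine Finset.sum_nonpos fun k _ => ?_
      split_ifs with hk
      · exact ih k (by omega)
      · rfl
    omega

/-- The last letter `j` of the word produces the positive root `τ_Q^{c-1}(γ_j)`, with `c` the number
of letters `j`, whereas `τ_Q^c(γ_j)` is negative. So `-τ_Q^c(γ_j)` is a positive root made negative
by `τ_Q⁻¹`; the roots with this property are found among those of the prefixes of a Coxeter word,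
which are the `γ_i`. -/
theorem exists_rootAt_count (hG : IsSimplyLacedDynkin G) {η : I → ℤ} (hη : IsHeight G η)
    {l : List I} (hl : IsLongest G (wordProd G l)) (hlen : l.length = numPos G)
    (had : IsAdapted (heightQuiver G η) l) (j : I) :
    ∃ i, rootAt G (heightQuiver G η) j (l.count j) = -gammaRoot (heightQuiver G η) i := by
  have hj : j ∈ l := by
    by_contra hj
    have h := rootAt_count_nonpos hG hη hl had j j
    rw [List.count_eq_zero_of_not_mem hj, rootAt_zero, gammaRoot_self] at h
    omega
  -- Reversing the word splits it at the last occurrence of `j` instead of the first.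
  obtain ⟨l₂, l₁, hr, hj₂⟩ := List.eq_append_cons_of_mem (List.mem_reverse.2 hj)
  have hsplit : l = l₁.reverse ++ j :: l₂.reverse := by
    rw [← List.reverse_reverse l, hr]
    simp
  have hcount : l.count j = l₁.reverse.count j + 1 := by
    rw [hsplit]
    simp [List.count_eq_zero_of_not_mem hj₂]
  have hpos := wordProd_simpleRoot_mem_positiveRoots hG hl hlen hsplit
  rw [hsplit] at had
  rw [wordProd_simpleRoot hG hη had] at hpos
  rw [← hsplit] at had
  obtain ⟨c, hnd, hc, hcad, hτ⟩ := isAdaptedCoxeter_coxeter hη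
  set y := -rootAt G (heightQuiver G η) j (l.count j) with hy
  have hypos : y ∈ positiveRoots G :=
    ⟨neg_mem_roots (rootAt_mem_roots hG hη _ _), fun i => by
      have := rootAt_count_nonpos hG hη hl had j i
      rw [hy, Pi.neg_apply]
      omega⟩
  obtain ⟨c₁, i, c₂, hcs, hi⟩ := exists_split_of_neg hG c hypos (by
    rw [hy, hcount, rootAt_succ, map_neg, neg_neg, ← hτ, ← LinearEquiv.mul_apply,
      inv_mul_cancel]
    exact hpos)
  refine ⟨i, ?_⟩
  rw [hcs] at hcad hnd
  have hic : i ∉ c₁ := fun h => (List.nodup_append.1 hnd).2.2 i h i List.mem_cons_self rfl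
  rw [wordProd_simpleRoot hG hη hcad, List.count_eq_zero_of_not_mem hic, rootAt_zero] at hi
  rw [← hi, hy, neg_neg]

/-- The final recursion reads `γ_{σ j} = α_{j*} + ∑_{k → j} γ_{σ k}`. If `σ j ≠ j*`, the coordinate
at `σ j` must come from some `γ_{σ k}`; this gives paths both ways between `σ j` and `σ k`, so they
are equal, and then `γ_{σ j} ≥ α_{j*} + γ_{σ j}`, which is absurd. -/
theorem rootAt_count (hG : IsSimplyLacedDynkin G) {η : I → ℤ} (hη : IsHeight G η)
    {l : List I} (hl : IsLongest G (wordProd G l)) (hlen : l.length = numPos G)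
    (had : IsAdapted (heightQuiver G η) l) (j : I) :
    rootAt G (heightQuiver G η) j (l.count j) =
      -gammaRoot (heightQuiver G η) (dualVertex G j) := by
  classical
  choose σ hσ using exists_rootAt_count hG hη hl hlen had
  have h := isRootSystemAt_fireList l η hη had 1 _ (isRootSystemAt_gammaRoot hG hη) j
  rw [one_mul, fireList_gammaRoot hG hη had, hl.apply_simpleRoot hG] at h
  simp only [hσ] at h
  have h' : ∀ i, gammaRoot (heightQuiver G η) (σ j) i = simpleRoot (dualVertex G j) i +
      ∑ k, if G.Adj k j ∧ lowered η l j = lowered η l k - 1 then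
        gammaRoot (heightQuiver G η) (σ k) i else 0 := fun i => by
    have h1 := congrFun h i
    rw [Pi.neg_apply, Pi.add_apply, Pi.neg_apply, Finset.sum_apply] at h1
    have h2 : ∑ k, (if G.Adj k j ∧ lowered η l j = lowered η l k - 1 then
        -gammaRoot (heightQuiver G η) (σ k) else 0) i = -∑ k, if G.Adj k j ∧
        lowered η l j = lowered η l k - 1 then gammaRoot (heightQuiver G η) (σ k) i else 0 := by
      rw [← Finset.sum_neg_distrib]
      refine Finset.sum_congr rfl fun k _ => ?_
      split_ifs <;> simp
    rw [h2] at h1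
    omega
  have hnn : ∀ i k, 0 ≤ (if G.Adj k j ∧ lowered η l j = lowered η l k - 1 then
      gammaRoot (heightQuiver G η) (σ k) i else 0) := fun i k => by
    split_ifs
    · exact gammaRoot_nonneg _ _ _
    · rfl
  rw [hσ j]
  by_cases hne : σ j = dualVertex G j
  · rw [hne]
  exfalso
  have h1 := h' (σ j)
  rw [gammaRoot_self] at h1
  simp only [simpleRoot, Pi.single_apply, hne, if_false, zero_add] at h1
  obtain ⟨k, -, hk⟩ := Finset.exists_ne_zero_of_sum_ne_zero (h1 ▸ one_ne_zero)
  have hkc : G.Adj k j ∧ lowered η l j = lowered η l k - 1 := by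
    by_contra hc
    simp [hc] at hk
  rw [if_pos hkc] at hk
  have hle : ∀ i, simpleRoot (dualVertex G j) i + gammaRoot (heightQuiver G η) (σ k) i ≤
      gammaRoot (heightQuiver G η) (σ j) i := fun i => by
    rw [h' i]
    have := Finset.single_le_sum (fun k _ => hnn i k) (Finset.mem_univ k)
    rw [if_pos hkc] at this
    omega
  have hpath : ∀ {a b : I}, gammaRoot (heightQuiver G η) a b ≠ 0 →
      Relation.ReflTransGen (heightQuiver G η).Adj b a := fun {a b} hab => by
    by_contra hc
    simp [gammaRoot, hc] at hab
  have hp1 := hpath hk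
  have hp2 : Relation.ReflTransGen (heightQuiver G η).Adj (σ k) (σ j) := by
    refine hpath fun h0 => ?_
    have h2 := hle (σ k)
    have h3 := (simpleRoot_mem_positiveRoots (G := G) (dualVertex G j)).2 (σ k)
    rw [gammaRoot_self, h0] at h2
    omega
  have heq := eq_of_reflTransGen_of_le hp1 (height_le_of_reflTransGen hp2)
  have h2 := hle (dualVertex G j)
  rw [heq] at h2
  simp [simpleRoot] at h2

theorem dualVertex_injective (hG : IsSimplyLacedDynkin G) {x : (I → ℤ) ≃ₗ[ℤ] (I → ℤ)}
    (hx : IsLongest G x) : Function.Injective (dualVertex G : I → I) :=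
  Function.LeftInverse.injective (g := dualVertex G) (hx.dualVertex_dualVertex hG)

/-- Compare `γ_{j*} = α_{j*} + ∑_{i → j*} γ_i` with the final recursion `γ_{j*} = α_{j*} + ∑_{i → j}
γ_{i*}`. The linear form dual to `γ_{k*}` reads off whether the arrow is present in each. -/
theorem adj_dualVertex_iff (hG : IsSimplyLacedDynkin G) {η : I → ℤ} (hη : IsHeight G η)
    {l : List I} (hl : IsLongest G (wordProd G l)) (hlen : l.length = numPos G)
    (had : IsAdapted (heightQuiver G η) l) {k j : I} (hkj : k ≠ j) :
    (heightQuiver G (lowered η l)).Adj k j ↔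
      (heightQuiver G η).Adj (dualVertex G k) (dualVertex G j) := by
  classical
  have hinj := dualVertex_injective hG hl
  obtain ⟨f, hf1, hf2⟩ := exists_linearMap_gammaRoot hG hη (Pi.single (dualVertex G k) 1)
  have h := isRootSystemAt_fireList l η hη had 1 _ (isRootSystemAt_gammaRoot hG hη) j
  rw [one_mul, fireList_gammaRoot hG hη had, hl.apply_simpleRoot hG] at h
  simp only [rootAt_count hG hη hl hlen had] at h
  have h1 := congrArg f h
  have hs1 : (∑ i, if G.Adj i (dualVertex G j) ∧ η (dualVertex G j) = η i - 1 then
      (Pi.single (dualVertex G k) 1 : I → ℤ) i else 0) =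
      if (heightQuiver G η).Adj (dualVertex G k) (dualVertex G j) then 1 else 0 := by
    rw [Finset.sum_eq_single (dualVertex G k)]
    · rw [Pi.single_eq_same]
      exact if_congr Iff.rfl rfl rfl
    · intro i _ hi
      rw [Pi.single_eq_of_ne hi, ite_self]
    · simp
  have hs2 : (∑ i, f (if G.Adj i j ∧ lowered η l j = lowered η l i - 1 then
      -gammaRoot (heightQuiver G η) (dualVertex G i) else 0)) =
      if (heightQuiver G (lowered η l)).Adj k j then -1 else 0 := by
    rw [Finset.sum_eq_single k]
    · rw [apply_ite f, map_neg, hf1, Pi.single_eq_same, map_zero]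
      exact if_congr Iff.rfl rfl rfl
    · intro i _ hi
      rw [apply_ite f, map_neg, hf1, Pi.single_eq_of_ne (hinj.ne hi), map_zero, neg_zero,
        ite_self]
    · simp
  rw [map_neg, hf1, map_add, map_neg, hf2, map_sum, hs1, hs2,
    Pi.single_eq_of_ne (hinj.ne hkj.symm)] at h1
  split_ifs at h1 with h2 h3
  · exact ⟨fun _ => h2, fun _ => h3⟩
  · simp at h1
  · simp at h1
  · tauto

/-- Duality matches arrows, so `η(a*)` minus the final height of `a` is constant on the connected
diagram. Adding its values at `a` and `a*` shows that `c_a + c_{a*}` does not depend on `a`; summing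
over `a`, this constant is `2N/n`. -/
theorem count_add_count_dualVertex (hG : IsSimplyLacedDynkin G) {η : I → ℤ}
    (hη : IsHeight G η) {l : List I} (hl : IsLongest G (wordProd G l))
    (hlen : l.length = numPos G) (had : IsAdapted (heightQuiver G η) l) (j : I) :
    l.count j + l.count (dualVertex G j) = coxeterNumber G := by
  have hstep : ∀ a b, G.Adj a b → η (dualVertex G a) - lowered η l a =
      η (dualVertex G b) - lowered η l b := by
    intro a b hab
    have h1 := isHeight_lowered_of_isAdapted l η hη had a b hab
    rcases h1 with h1 | h1
    · have := ((adj_dualVertex_iff hG hη hl hlen had hab.ne).1 ⟨hab, h1⟩).2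
      omega
    · have := ((adj_dualVertex_iff hG hη hl hlen had hab.ne').1 ⟨hab.symm, h1⟩).2
      omega
  have hconst : ∀ a b, η (dualVertex G a) - lowered η l a =
      η (dualVertex G b) - lowered η l b := by
    intro a b
    obtain ⟨p⟩ := hG.1.preconnected a b
    induction p with
    | nil => rfl
    | cons h _ ih => exact (hstep _ _ h).trans ih
  have hinv := hl.dualVertex_dualVertex hG
  have hK : ∀ a, l.count a + l.count (dualVertex G a) =
      l.count j + l.count (dualVertex G j) := by
    intro a
    have h1 := hconst a j
    have h2 := hconst (dualVertex G a) (dualVertex G j)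
    simp only [lowered, hinv] at h1 h2
    omega
  have hsum : ∑ a, l.count a = numPos G := by
    rw [← hlen, ← Multiset.coe_card, ← Multiset.sum_count_eq_card (s := Finset.univ)]
    · simp
    · simp
  have hsum' : ∑ a, l.count (dualVertex G a) = numPos G := by
    rw [← hsum]
    exact Equiv.sum_comp (Function.Involutive.toPerm _ hinv) fun a => l.count a
  have htot : 2 * numPos G =
      Fintype.card I * (l.count j + l.count (dualVertex G j)) := by
    have : ∑ a, (l.count a + l.count (dualVertex G a)) = 2 * numPos G := by
      rw [Finset.sum_add_distrib, hsum, hsum', two_mul]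
    rw [← this, Finset.sum_congr rfl fun a _ => hK a]
    simp
  have hcard : 0 < Fintype.card I := Fintype.card_pos_iff.2 ⟨j⟩
  rw [coxeterNumber, htot, Nat.mul_div_cancel_left _ hcard]

theorem rootAt_count_add (hG : IsSimplyLacedDynkin G) {η : I → ℤ} (hη : IsHeight G η)
    {l : List I} (hl : IsLongest G (wordProd G l)) (hlen : l.length = numPos G)
    (had : IsAdapted (heightQuiver G η) l) (j : I) (d : ℕ) :
    rootAt G (heightQuiver G η) j (l.count j + d) =
      -rootAt G (heightQuiver G η) (dualVertex G j) d := by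
  have h := rootAt_count hG hη hl hlen had j
  induction d with
  | zero => exact h
  | succ d ih => rw [← add_assoc, rootAt_succ, ih, map_neg, ← rootAt_succ]

end Repetition

end HernandezLeclerc

namespace HernandezLeclerc

/-! ### The inverse quantum Cartan matrix and the product of `h` consecutive variables. -/

section Periodicity

variable {I : Type*} [Fintype I] [DecidableEq I] {G : SimpleGraph I} [DecidableRel G.Adj]

/-! ## The inverse quantum Cartan matrix -/

open Polynomial in
/-- The odd extension of `m ↦ C̃(m)` to all integers, by Chebyshev polynomials of the adjacency
matrix. -/
def cheb (G : SimpleGraph I) [DecidableRel G.Adj] (m : ℤ) : Matrix I I ℤ :=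
  aeval (G.adjMatrix ℤ) (Polynomial.Chebyshev.S ℤ (m - 1))

theorem cheb_zero : cheb G 0 = 0 := by simp [cheb]

theorem cheb_one : cheb G 1 = 1 := by simp [cheb]

theorem cheb_neg (m : ℤ) : cheb G (-m) = -cheb G m := by
  rw [cheb, cheb, Polynomial.Chebyshev.S_neg_sub_one, map_neg]

theorem cheb_add_one (m : ℤ) : cheb G (m + 1) + cheb G (m - 1) = G.adjMatrix ℤ * cheb G m := by
  have h := Polynomial.Chebyshev.S_add_two ℤ (m - 2)
  have h1 : m + 1 - 1 = m - 2 + 2 := by ring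
  have h2 : m - 1 - 1 = m - 2 := by ring
  have h3 : m - 1 = m - 2 + 1 := by ring
  simp only [cheb, h1, h2]
  rw [h3, h]
  simp

theorem cheb_commute (m : ℤ) : G.adjMatrix ℤ * cheb G m = cheb G m * G.adjMatrix ℤ := by
  have h := Polynomial.aeval_X (R := ℤ) (G.adjMatrix ℤ)
  conv_lhs => rw [← h, cheb, ← map_mul, mul_comm, map_mul, h]
  rfl

theorem cheb_mesh (i j : I) (m : ℤ) :
    cheb G (m + 1) i j + cheb G (m - 1) i j = ∑ k, if G.Adj j k then cheb G m i k else 0 := by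
  rw [← Matrix.add_apply, cheb_add_one, cheb_commute, Matrix.mul_apply]
  refine Finset.sum_congr rfl fun k _ => ?_
  simp [SimpleGraph.adjMatrix_apply, G.adj_comm k j]

/-- The coefficients vanish as long as `n` is at most the distance from `i` to `j`, and a height
function changes by `1` along each edge. -/
theorem cheb_eq_zero {ξ : I → ℤ} (hξ : IsHeight G ξ) (i : I) (n : ℕ) (j : I)
    (hn : (n : ℤ) ≤ ξ i - ξ j) : cheb G n i j = 0 := by
  induction n using Nat.strong_induction_on generalizing j with
  | _ n ih =>
    match n, ih, hn with
    | 0, _, _ => simp [cheb_zero]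
    | 1, _, hn =>
      have hij : i ≠ j := by rintro rfl; simp at hn
      simp [cheb_one, hij]
    | n + 2, ih, hn =>
      have h := cheb_mesh (G := G) i j (n + 1)
      have h1 : ((n : ℤ) + 1 - 1) = n := by ring
      have h2 : ((n + 2 : ℕ) : ℤ) = n + 1 + 1 := by push_cast; ring
      rw [h1, ih n (by omega) j (by omega), add_zero] at h
      rw [h2, h]
      refine Finset.sum_eq_zero fun k _ => ?_
      split_ifs with hk
      · have := hξ j k hk
        exact_mod_cast ih (n + 1) (by omega) k (by push_cast; omega)
      · rfl

theorem cTilde_eq_cheb (i j : I) {m : ℤ} (hm : 1 ≤ m) : cTilde G i j m = cheb G m i j := by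
  set X : Matrix I I (LaurentSeries ℤ) := fun i j =>
    HahnSeries.ofPowerSeries ℤ ℤ (PowerSeries.mk fun n => cheb G n i j) with hX
  have hcoeff : ∀ i j (n : ℤ), (X i j).coeff n = if 0 ≤ n then cheb G n i j else 0 := by
    intro i j n
    simp only [hX]
    have h := PowerSeries.coeff_coe (R := ℤ) (PowerSeries.mk fun n => cheb G n i j) n
    refine h.trans ?_
    by_cases hn : n < 0
    · rw [if_pos hn, if_neg (by omega)]
    · rw [if_neg hn, if_pos (by omega), PowerSeries.coeff_mk, Int.natAbs_of_nonneg (by omega)]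
  -- Off degree `0`, this is the three-term recursion with `cheb G 0 = 0`; in degree `0` the term
  -- `z⁻¹` picks out `cheb G 1 = 1`.
  have hmul : quantumCartan G * X = 1 := by
    ext i j n
    have hc : (quantumCartan G * X) i j = HahnSeries.single 1 1 * X i j +
        HahnSeries.single (-1) 1 * X i j - ∑ k, if G.Adj i k then X k j else 0 := by
      rw [Matrix.mul_apply, ← add_mul]
      have : ∀ k, quantumCartan G i k * X k j =
          (if i = k then (HahnSeries.single 1 1 + HahnSeries.single (-1) 1) * X k j else 0) -
            if G.Adj i k then X k j else 0 := by
        intro k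
        simp only [quantumCartan]
        by_cases hik : i = k
        · subst hik; simp
        · by_cases hadj : G.Adj i k <;> simp [hik, hadj]
      simp only [this, Finset.sum_sub_distrib, Finset.sum_ite_eq, Finset.mem_univ, if_true]
    have hs1 : (HahnSeries.single (1 : ℤ) (1 : ℤ) * X i j).coeff n = (X i j).coeff (n - 1) := by
      have := HahnSeries.coeff_single_mul_add (r := (1 : ℤ)) (x := X i j) (a := n - 1)
        (b := (1 : ℤ))
      simpa using this
    have hs2 : (HahnSeries.single (-1 : ℤ) (1 : ℤ) * X i j).coeff n = (X i j).coeff (n + 1) := by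
      have := HahnSeries.coeff_single_mul_add (r := (1 : ℤ)) (x := X i j) (a := n + 1)
        (b := (-1 : ℤ))
      simpa using this
    have hs3 : (∑ k, if G.Adj i k then X k j else 0).coeff n =
        ∑ k, if G.Adj i k then (X k j).coeff n else 0 := by
      rw [HahnSeries.coeff_sum]
      refine Finset.sum_congr rfl fun k _ => ?_
      split_ifs <;> simp
    rw [hc, HahnSeries.coeff_sub, HahnSeries.coeff_add, hs1, hs2, hs3]
    simp only [hcoeff]
    have hone : ((1 : Matrix I I (LaurentSeries ℤ)) i j).coeff n =
        if n = 0 then (1 : Matrix I I ℤ) i j else 0 := by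
      by_cases hij : i = j
      · subst hij; simp [HahnSeries.coeff_one]
      · simp [hij]
    rw [hone]
    rcases lt_trichotomy n 0 with hn | rfl | hn
    · rw [if_neg (by omega), if_neg (by omega : ¬ n = 0)]
      have h0 : (if 0 ≤ n + 1 then cheb G (n + 1) i j else 0) = 0 := by
        split_ifs
        · have : n + 1 = 0 := by omega
          simp [this, cheb_zero]
        · rfl
      rw [h0, Finset.sum_eq_zero]
      · simp
      · intro k _
        rw [if_neg (by omega : ¬ 0 ≤ n), ite_self]
    · simp [cheb_one, cheb_zero]
    · rw [if_pos (by omega), if_pos (by omega), if_neg (by omega)]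
      have h := congrFun (congrFun (cheb_add_one (G := G) n) i) j
      rw [Matrix.add_apply, Matrix.mul_apply] at h
      have h2 : ∑ k, (if G.Adj i k then (if 0 ≤ n then cheb G n k j else 0) else 0) =
          ∑ k, G.adjMatrix ℤ i k * cheb G n k j := by
        refine Finset.sum_congr rfl fun k _ => ?_
        rw [if_pos (by omega : 0 ≤ n), SimpleGraph.adjMatrix_apply]
        split_ifs <;> simp
      rw [h2, ← h]
      ring
  rw [cTilde, if_pos hm, Matrix.inv_eq_right_inv hmul, hcoeff, if_pos (by omega)]

/-! ## Signs of the roots -/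

theorem betaSeq_spec (hG : IsSimplyLacedDynkin G) {ξ : I → ℤ} (hξ : IsHeight G ξ) (j : I)
    (d : ℕ) : betaSeq G (heightQuiver G ξ) j d ∈ positiveRoots G ∧
      (betaSeq G (heightQuiver G ξ) j d = rootAt G (heightQuiver G ξ) j d ∨
        betaSeq G (heightQuiver G ξ) j d = -rootAt G (heightQuiver G ξ) j d) := by
  induction d with
  | zero => exact ⟨gammaRoot_mem_positiveRoots hG hξ j, .inl rfl⟩
  | succ d ih =>
    have hroot := apply_mem_roots (coxeter_mem hξ) ih.1.1
    rw [betaSeq, rootAt_succ]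
    split_ifs with h
    · refine ⟨h, ?_⟩
      rcases ih.2 with h2 | h2 <;> simp [h2]
    · refine ⟨(mem_positiveRoots_or_neg hG hroot).resolve_left h, ?_⟩
      rcases ih.2 with h2 | h2 <;> simp [h2]

theorem betaSeq_eq_of_rootAt (hG : IsSimplyLacedDynkin G) {ξ : I → ℤ} (hξ : IsHeight G ξ)
    {j j' : I} {d d' : ℕ}
    (h : rootAt G (heightQuiver G ξ) j d = rootAt G (heightQuiver G ξ) j' d' ∨
      rootAt G (heightQuiver G ξ) j d = -rootAt G (heightQuiver G ξ) j' d') :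
    betaSeq G (heightQuiver G ξ) j d = betaSeq G (heightQuiver G ξ) j' d' := by
  obtain ⟨h1, h2⟩ := betaSeq_spec hG hξ j d
  obtain ⟨h3, h4⟩ := betaSeq_spec hG hξ j' d'
  have key : betaSeq G (heightQuiver G ξ) j d = betaSeq G (heightQuiver G ξ) j' d' ∨
      betaSeq G (heightQuiver G ξ) j d = -betaSeq G (heightQuiver G ξ) j' d' := by
    rcases h with h | h <;> rcases h2 with h2 | h2 <;> rcases h4 with h4 | h4 <;>
      rw [h2, h4, h] <;> simp
  rcases key with h | h
  · exact h
  · exact (neg_notMem_positiveRoots h3 (h ▸ h1)).elim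

/-- A solution of the mesh relations is determined by its values at depth `0`. These can be matched
by a linear form on the `γ_j`, and composing that form with the roots gives a solution again. -/
theorem exists_linearMap_rootAt (hG : IsSimplyLacedDynkin G) {ξ : I → ℤ} (hξ : IsHeight G ξ)
    (x : I → ℕ → ℤ) (hx : ∀ j d, x j d + x j (d + 1) = ∑ k, if G.Adj j k then
      (if ξ k = ξ j + 1 then x k (d + 1) else x k d) else 0) :
    ∃ f : (I → ℤ) →ₗ[ℤ] ℤ, ∀ j d, f (rootAt G (heightQuiver G ξ) j d) = x j d := by
  obtain ⟨f, hf, -⟩ := exists_linearMap_gammaRoot hG hξ fun j => x j 0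
  refine ⟨f, fun j d => ?_⟩
  induction d generalizing j with
  | zero => exact hf j
  | succ d ih =>
    induction j using height_induction ξ with
    | h j ihj =>
      have h := congrArg f (isMesh_rootAt hG hξ j d)
      rw [map_add, map_sum, ih] at h
      have h2 : ∑ k, f (if G.Adj j k then (if ξ k = ξ j + 1 then
          rootAt G (heightQuiver G ξ) k (d + 1) else rootAt G (heightQuiver G ξ) k d) else 0) =
          x j d + x j (d + 1) := by
        rw [hx]
        refine Finset.sum_congr rfl fun k _ => ?_
        split_ifs with h1 h2
        · exact ihj k h2
        · exact ih k
        · simp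
      rw [h2] at h
      exact add_left_cancel h

/-! ## The product formula -/

/-- Depth below the height function identifies `I × ℕ` with `I^{≤ξ}`. -/
def ileEquiv (ξ : I → ℤ) : I × ℕ ≃ ILE ξ where
  toFun y := atDepth ξ y.1 y.2
  invFun y := (y.1.1, depth y)
  left_inv y := by
    ext
    · rfl
    · simp [atDepth, depth]
  right_inv y := by
    obtain ⟨⟨i, p⟩, d, hd⟩ := y
    apply Subtype.ext
    simp only at hd
    subst hd
    simp [atDepth, depth]

/-- The root `β_{φ(j, ξ(j) - 2d)}` as a unit of the field `ℂ(α_1, …, α_n)`. -/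
def rootUnit (G : SimpleGraph I) [DecidableRel G.Adj] (Q : Digraph I) (j : I) (d : ℕ) :
    (RatField I)ˣ :=
  Units.mk0 (linForm (betaSeq G Q j d)) (linForm_ne_zero (betaSeq_ne_zero G Q j d))

theorem depth_atDepth (ξ : I → ℤ) (j : I) (d : ℕ) : depth (atDepth ξ j d) = d :=
  congrArg Prod.snd ((ileEquiv ξ).left_inv (j, d))

theorem betaUnit_atDepth (Q : Digraph I) (ξ : I → ℤ) (j : I) (d : ℕ) :
    betaUnit G Q (atDepth ξ j d) = rootUnit G Q j d := by
  ext
  simp only [betaUnit, rootUnit, beta, depth_atDepth, Units.val_mk0]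
  rfl

theorem dTildeY_eq_prod (Q : Digraph I) (ξ : I → ℤ) (x : ILE ξ) (D : ℕ)
    (hD : ∀ j, ξ j - 2 * (D : ℤ) < x.1.2) :
    dTildeY G Q ξ x = ∏ j, ∏ d ∈ Finset.range D, rootUnit G Q j d ^
      (cTilde G x.1.1 j (ξ j - 2 * d - x.1.2 - 1) -
        cTilde G x.1.1 j (ξ j - 2 * d - x.1.2 + 1)) := by
  rw [dTildeY, ← finprod_comp_equiv (ileEquiv ξ),
    finprod_eq_prod_of_mulSupport_subset (s := Finset.univ ×ˢ Finset.range D),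
    Finset.prod_product]
  · refine Finset.prod_congr rfl fun j _ => Finset.prod_congr rfl fun d _ => ?_
    rw [show ileEquiv ξ (j, d) = atDepth ξ j d from rfl, betaUnit_atDepth]
    rfl
  · rintro ⟨j, d⟩ h
    by_contra hmem
    refine h ?_
    have hd : D ≤ d := by simpa using hmem
    have := hD j
    change betaUnit G Q _ ^ (cTilde G x.1.1 j (ξ j - 2 * d - x.1.2 - 1) -
        cTilde G x.1.1 j (ξ j - 2 * d - x.1.2 + 1)) = 1
    -- At depth `≥ D` one has `s < p`, so both arguments of `C̃` are `≤ 0`.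
    rw [cTilde, cTilde, if_neg (by omega), if_neg (by omega), sub_zero, zpow_zero]

theorem prod_zpow_eq_zpow_sum {A ι : Type*} [CommGroup A] (a : A) (f : ι → ℤ) (s : Finset ι) :
    ∏ k ∈ s, a ^ f k = a ^ ∑ k ∈ s, f k :=
  (map_sum (zmultiplesHom (Additive A) (Additive.ofMul a)) f s).symm

theorem prod_range_shift_div {A : Type*} [CommGroup A] (F : ℕ → A) (D h : ℕ)
    (hF : ∀ d, D ≤ d → F d = 1) :
    ∏ d ∈ Finset.range D, F (d + h) / F d = (∏ d ∈ Finset.range h, F d)⁻¹ := by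
  have h1 := Finset.prod_range_add F h D
  have h2 := Finset.prod_range_add F D h
  rw [Finset.prod_eq_one fun d _ => hF (D + d) (by omega), mul_one, add_comm, h1] at h2
  rw [Finset.prod_div_distrib, ← h2]
  simp only [add_comm _ h]
  rw [mul_comm, div_mul_cancel_left]

/-- Below depth `c_j`, column `j` repeats column `j*` with opposite roots: the positive root is the
same and the exponent changes sign. As `h = c_j + c_{j*}`, column `j` contributes its own first
`c_j` factors and the inverses of the first `c_{j*}` factors of column `j*`; these cancel over all
`j`. -/
theorem prod_rootUnit_eq_one (hG : IsSimplyLacedDynkin G) {ξ : I → ℤ} (hξ : IsHeight G ξ)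
    {l : List I} (hl : IsLongest G (wordProd G l)) (hlen : l.length = numPos G)
    (had : IsAdapted (heightQuiver G ξ) l) (f : (I → ℤ) →ₗ[ℤ] ℤ) :
    ∏ j, ∏ d ∈ Finset.range (coxeterNumber G), rootUnit G (heightQuiver G ξ) j d ^
      f (rootAt G (heightQuiver G ξ) j d) = 1 := by
  set F : I → ℕ → (RatField I)ˣ := fun j d => rootUnit G (heightQuiver G ξ) j d ^
      f (rootAt G (heightQuiver G ξ) j d) with hF
  have hanti : ∀ j d, F j (l.count j + d) = (F (dualVertex G j) d)⁻¹ := fun j d => by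
    have h1 := rootAt_count_add hG hξ hl hlen had j d
    have h2 := betaSeq_eq_of_rootAt hG hξ (.inr h1)
    simp only [hF, rootUnit, h1, h2, map_neg, zpow_neg]
  have hinv := hl.dualVertex_dualVertex hG
  have hperm : ∏ j, ∏ d ∈ Finset.range (l.count (dualVertex G j)), F (dualVertex G j) d =
      ∏ j, ∏ d ∈ Finset.range (l.count j), F j d :=
    Equiv.prod_comp (Function.Involutive.toPerm _ hinv)
      fun j => ∏ d ∈ Finset.range (l.count j), F j d
  calc ∏ j, ∏ d ∈ Finset.range (coxeterNumber G), F j d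
      = ∏ j, ((∏ d ∈ Finset.range (l.count j), F j d) *
          (∏ d ∈ Finset.range (l.count (dualVertex G j)), F (dualVertex G j) d)⁻¹) := by
        refine Finset.prod_congr rfl fun j _ => ?_
        rw [← count_add_count_dualVertex hG hξ hl hlen had j, Finset.prod_range_add]
        simp only [hanti, Finset.prod_inv_distrib]
    _ = 1 := by
        rw [Finset.prod_mul_distrib, Finset.prod_inv_distrib,
          hperm, mul_inv_cancel]

theorem prod_dTildeY_eq_one (hG : IsSimplyLacedDynkin G) {ξ : I → ℤ} (hξ : IsHeight G ξ)
    {l : List I} (hl : IsLongest G (wordProd G l)) (hlen : l.length = numPos G)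
    (had : IsAdapted (heightQuiver G ξ) l) {h : ℕ}
    (hh : h = coxeterNumber G) (i : I) (p : ℤ) (hle : p ≤ ξ i - 2 * (h : ℤ) + 2)
    (x : Fin h → ILE ξ)
    (hx : ∀ k, (x k).1 = (i, p + 2 * (k : ℕ))) :
    ∏ k, dTildeY G (heightQuiver G ξ) ξ (x k) = 1 := by
  set Q := heightQuiver G ξ with hQ
  -- Any depth past which every column lies below `p` would do; all products become finite.
  set D : ℕ := ∑ j, (ξ j).natAbs + p.natAbs + 1 with hDdef
  have hD : ∀ j, ξ j - 2 * (D : ℤ) < p := fun j => by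
    have := Finset.single_le_sum (f := fun j => (ξ j).natAbs) (fun _ _ => Nat.zero_le _)
      (Finset.mem_univ j)
    beta_reduce at this
    omega
  -- The exponents `C̃_{ij}(s - p + 1)`, extended oddly, satisfy the mesh relations in `(j, s)` and
  -- so come from a linear form.
  obtain ⟨f, hf⟩ := exists_linearMap_rootAt hG hξ
    (fun j d => cheb G (ξ j - 2 * d - p + 1) i j) (fun j d => by
      have hm := cheb_mesh (G := G) i j (ξ j - 2 * d - p)
      have h1 : ξ j - 2 * ((d + 1 : ℕ) : ℤ) - p + 1 = ξ j - 2 * d - p - 1 := by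
        push_cast; ring
      rw [h1, hm]
      refine Finset.sum_congr rfl fun k _ => ?_
      by_cases hk : G.Adj j k
      · rw [if_pos hk, if_pos hk]
        have := hξ j k hk
        split_ifs with h2
        · congr 2
          push_cast
          omega
        · congr 2
          omega
      · simp [hk])
  have hper : ∀ j d, rootUnit G Q j (d + h) = rootUnit G Q j d := fun j d => by
    have h1 : rootAt G Q j (d + h) = rootAt G Q j d := by
      have h2 : d + h = l.count j + (l.count (dualVertex G j) + d) := by
        rw [hh, ← count_add_count_dualVertex hG hξ hl hlen had j]
        ring
      rw [h2, rootAt_count_add hG hξ hl hlen had, rootAt_count_add hG hξ hl hlen had, neg_neg,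
        hl.dualVertex_dualVertex hG]
    ext
    simp only [rootUnit, Units.val_mk0]
    rw [hQ, betaSeq_eq_of_rootAt hG hξ (.inl h1)]
  set F : I → ℕ → (RatField I)ˣ := fun j d =>
    rootUnit G Q j d ^ cTilde G i j (ξ j - 2 * d - p + 1) with hF
  have hF1 : ∀ j d, D ≤ d → F j d = 1 := fun j d hd => by
    have := hD j
    simp only [hF]
    rw [cTilde, if_neg (by omega), zpow_zero]
  have hF2 : ∀ j, ∀ d ∈ Finset.range h, F j d = rootUnit G Q j d ^ f (rootAt G Q j d) := by
    intro j d hd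
    rw [Finset.mem_range] at hd
    rw [hf]
    by_cases hm : 1 ≤ ξ j - 2 * (d : ℤ) - p + 1
    · rw [← cTilde_eq_cheb i j hm]
    · have h0 : cheb G (ξ j - 2 * d - p + 1) i j = 0 := by
        obtain ⟨n, hn⟩ := Int.eq_ofNat_of_zero_le
          (show 0 ≤ -(ξ j - 2 * (d : ℤ) - p + 1) by omega)
        rw [← neg_neg (ξ j - 2 * (d : ℤ) - p + 1), hn, cheb_neg, Matrix.neg_apply,
          cheb_eq_zero hξ i n j (by omega), neg_zero]
      simp only [hF]
      rw [h0, cTilde, if_neg hm]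
  calc ∏ k, dTildeY G Q ξ (x k)
      = ∏ k : Fin h, ∏ j, ∏ d ∈ Finset.range D, rootUnit G Q j d ^
          (cTilde G i j (ξ j - 2 * d - (p + 2 * (k : ℕ)) - 1) -
            cTilde G i j (ξ j - 2 * d - (p + 2 * (k : ℕ)) + 1)) := by
        refine Finset.prod_congr rfl fun k _ => ?_
        rw [dTildeY_eq_prod Q ξ (x k) D, hx k]
        intro j
        have := hD j
        rw [hx k]
        dsimp only
        omega
    _ = ∏ j, ∏ d ∈ Finset.range D, F j (d + h) / F j d := by
        rw [Finset.prod_comm]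
        refine Finset.prod_congr rfl fun j _ => ?_
        rw [Finset.prod_comm]
        refine Finset.prod_congr rfl fun d _ => ?_
        simp only [hF]
        rw [hper, div_eq_mul_inv, ← zpow_sub, prod_zpow_eq_zpow_sum]
        congr 1
        -- The sum over `k` telescopes along `C̃_{ij}(m - 2k)` with `m = ξ(j) - 2d - p + 1`.
        have ht := Finset.sum_range_sub
          (fun k : ℕ => cTilde G i j (ξ j - 2 * d - p + 1 - 2 * k)) h
        rw [Fin.sum_univ_eq_sum_range (fun k => cTilde G i j (ξ j - 2 * d - (p + 2 * (k : ℕ)) - 1) -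
            cTilde G i j (ξ j - 2 * d - (p + 2 * (k : ℕ)) + 1)) h]
        calc _ = _ := Finset.sum_congr rfl fun k _ => by
              congr 2
              · push_cast; ring
              · ring
          _ = _ := ht
          _ = _ := by
            congr 2
            · push_cast; ring
            · push_cast; ring
    _ = (∏ j, ∏ d ∈ Finset.range h, F j d)⁻¹ := by
        rw [← Finset.prod_inv_distrib]
        exact Finset.prod_congr rfl fun j _ => prod_range_shift_div _ _ _ (hF1 j)
    _ = 1 := by
        subst hh
        rw [Finset.prod_congr rfl fun j _ => Finset.prod_congr rfl (hF2 j),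
          prod_rootUnit_eq_one hG hξ hl hlen had f, inv_one]

end Periodicity

end HernandezLeclerc

namespace HernandezLeclerc

/-! ### Simple modules over the quantum affine algebra; monomials and eigenvalues. -/

section Representations

open Module

variable {I : Type*} [Fintype I] [DecidableEq I] (G : SimpleGraph I) [DecidableRel G.Adj] (q : ℂˣ)
  (V : Type*) [AddCommGroup V] [Module ℂ V] [Module (QAff G q) V] [IsScalarTower ℂ (QAff G q) V]

/-- The representation of the free algebra on a module over the quantum affine algebra. -/
def freeAct : FreeAlgebra ℂ (Gen I) →ₐ[ℂ] End ℂ V :=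
  (Algebra.lsmul ℂ ℂ V).comp (RingQuot.mkAlgHom ℂ (Rel G q))

variable {G q V}

theorem freeAct_ι (g : Gen I) : freeAct G q V (FreeAlgebra.ι ℂ g) = act G q V g := rfl

theorem freeAct_eq_of_rel {a b : FreeAlgebra ℂ (Gen I)} (h : Rel G q a b) :
    freeAct G q V a = freeAct G q V b := by
  simp only [freeAct, AlgHom.comp_apply]
  rw [RingQuot.mkAlgHom_rel ℂ h]

theorem act_k_mul_inv (ε : ℤˣ) (i : I) :
    act G q V (Gen.k ε i) * act G q V (Gen.k (-ε) i) = 1 := by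
  simpa [freeAct_ι] using freeAct_eq_of_rel (V := V) (Rel.k_inv (G := G) (q := q) ε i)

theorem act_k_comm (ε ε' : ℤˣ) (i j : I) :
    Commute (act G q V (Gen.k ε i)) (act G q V (Gen.k ε' j)) := by
  simpa [freeAct_ι, commute_iff_eq] using
    freeAct_eq_of_rel (V := V) (Rel.k_comm (G := G) (q := q) ε ε' i j)

theorem act_h_zero (i : I) : act G q V (Gen.h i 0) = 0 := by
  simpa [freeAct_ι] using freeAct_eq_of_rel (V := V) (Rel.h_zero (G := G) (q := q) i)

theorem act_k_h_comm (ε : ℤˣ) (i j : I) (r : ℤ) :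
    Commute (act G q V (Gen.k ε i)) (act G q V (Gen.h j r)) := by
  simpa [freeAct_ι, commute_iff_eq] using
    freeAct_eq_of_rel (V := V) (Rel.k_h_comm (G := G) (q := q) ε i j r)

theorem act_h_comm (i j : I) (r s : ℤ) :
    Commute (act G q V (Gen.h i r)) (act G q V (Gen.h j s)) := by
  simpa [freeAct_ι, commute_iff_eq] using
    freeAct_eq_of_rel (V := V) (Rel.h_comm (G := G) (q := q) i j r s)

theorem act_phi_vanish (ε : ℤˣ) (i : I) (r : ℤ) (hr : (ε : ℤ) * r < 0) :
    act G q V (Gen.φ ε i r) = 0 := by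
  simpa [freeAct_ι] using freeAct_eq_of_rel (V := V) (Rel.φ_vanish (G := G) (q := q) ε i r hr)

theorem act_phi_zero (ε : ℤˣ) (i : I) :
    act G q V (Gen.φ ε i 0) = act G q V (Gen.k ε i) := by
  simpa [freeAct_ι] using freeAct_eq_of_rel (V := V) (Rel.φ_zero (G := G) (q := q) ε i)

theorem act_phi_succ (ε : ℤˣ) (i : I) (r : ℕ) (u : V) :
    ((r : ℂ) + 1) • act G q V (Gen.φ ε i ((ε : ℤ) * (r + 1))) u =
      (((ε : ℤ) : ℂ) * ((q : ℂ) - ((q⁻¹ : ℂˣ) : ℂ))) • ∑ s ∈ Finset.range (r + 1),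
        ((s : ℂ) + 1) • act G q V (Gen.h i ((ε : ℤ) * (s + 1)))
          (act G q V (Gen.φ ε i ((ε : ℤ) * ((r : ℤ) - s))) u) := by
  have h := freeAct_eq_of_rel (V := V) (Rel.φ_succ (G := G) (q := q) ε i r)
  rw [map_smul, map_smul, map_sum] at h
  simp only [map_smul, map_mul, freeAct_ι] at h
  have h2 := LinearMap.congr_fun h u
  simpa [LinearMap.sum_apply] using h2

theorem act_k_x (ε ε' : ℤˣ) (i j : I) (r : ℤ) :
    act G q V (Gen.k ε i) * act G q V (Gen.x ε' j r) =
      ((q ^ ((ε : ℤ) * ε' * cartan G i j) : ℂˣ) : ℂ) •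
        (act G q V (Gen.x ε' j r) * act G q V (Gen.k ε i)) := by
  have h := freeAct_eq_of_rel (V := V) (Rel.k_x (G := G) (q := q) ε ε' i j r)
  rwa [map_smul, map_mul, map_mul, freeAct_ι, freeAct_ι] at h

theorem act_h_x (ε : ℤˣ) (i j : I) (r s : ℤ) (hr : r ≠ 0) :
    act G q V (Gen.h i r) * act G q V (Gen.x ε j s) -
        act G q V (Gen.x ε j s) * act G q V (Gen.h i r) =
      (((ε : ℤ) : ℂ) * (qInt q (r * cartan G i j) / (r : ℂ))) •
        act G q V (Gen.x ε j (r + s)) := by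
  have h := freeAct_eq_of_rel (V := V) (Rel.h_x (G := G) (q := q) ε i j r s hr)
  rwa [map_smul, map_sub, map_mul, map_mul, freeAct_ι, freeAct_ι, freeAct_ι] at h

theorem act_xp_xm (i j : I) (r s : ℤ) (u : V) :
    act G q V (Gen.x 1 i r) (act G q V (Gen.x (-1) j s) u) =
      act G q V (Gen.x (-1) j s) (act G q V (Gen.x 1 i r) u) +
      if i = j then ((q : ℂ) - ((q⁻¹ : ℂˣ) : ℂ))⁻¹ •
        (act G q V (Gen.φ 1 i (r + s)) u - act G q V (Gen.φ (-1) i (r + s)) u) else 0 := by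
  have h := freeAct_eq_of_rel (V := V) (Rel.xp_xm (G := G) (q := q) i j r s)
  rw [map_sub, map_mul, map_mul, freeAct_ι, freeAct_ι] at h
  have h2 := LinearMap.congr_fun h u
  rw [LinearMap.sub_apply, sub_eq_iff_eq_add'] at h2
  refine h2.trans ?_
  congr 1
  split_ifs
  · rw [map_smul, map_sub, freeAct_ι, freeAct_ι]
    rfl
  · rw [map_zero]
    rfl

/-- A nonzero subspace of a simple module which is stable under the generators is everything. -/
theorem eq_top_of_stable (hs : IsSimpleModule (QAff G q) V) (S : Submodule ℂ V)
    (hS : ∀ g, ∀ u ∈ S, act G q V g u ∈ S) (hne : S ≠ ⊥) : S = ⊤ := by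
  have hfree : ∀ (a : FreeAlgebra ℂ (Gen I)), ∀ u ∈ S, freeAct G q V a u ∈ S := by
    intro a
    induction a using FreeAlgebra.induction with
    | grade0 c =>
      intro u hu
      rw [AlgHom.commutes]
      exact S.smul_mem c hu
    | grade1 g => exact hS g
    | mul a b ha hb =>
      intro u hu
      rw [map_mul]
      exact ha _ (hb u hu)
    | add a b ha hb =>
      intro u hu
      rw [map_add]
      exact S.add_mem (ha u hu) (hb u hu)
  let T : Submodule (QAff G q) V :=
    { S with
      smul_mem' := fun a u hu => by
        obtain ⟨b, rfl⟩ := RingQuot.mkAlgHom_surjective ℂ (Rel G q) a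
        exact hfree b u hu }
  have hT : T ≠ ⊥ := fun h => hne <| by
    rw [Submodule.eq_bot_iff] at h ⊢
    exact h
  have hT' := (eq_bot_or_eq_top T).resolve_left hT
  rw [Submodule.eq_top_iff'] at hT' ⊢
  exact hT'

/-- The logarithmic derivative relation expresses `(r + 1) φ_{r+1}` through the `h` and the earlier
`φ`, starting from `φ_0 = k`. -/
theorem act_phi_mem (S : Submodule ℂ V) (hk : ∀ ε i, ∀ u ∈ S, act G q V (Gen.k ε i) u ∈ S)
    (hh : ∀ i r, r ≠ 0 → ∀ u ∈ S, act G q V (Gen.h i r) u ∈ S) (ε : ℤˣ) (i : I) (n : ℤ)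
    (u : V) (hu : u ∈ S) : act G q V (Gen.φ ε i n) u ∈ S := by
  have hε : (ε : ℤ) * ε = 1 := by
    rcases Int.units_eq_one_or ε with rfl | rfl <;> simp
  have key : ∀ m : ℕ, act G q V (Gen.φ ε i ((ε : ℤ) * m)) u ∈ S := by
    intro m
    induction m using Nat.strong_induction_on with
    | _ m ih =>
      rcases m with _ | r
      · simpa [act_phi_zero] using hk ε i u hu
      · have h := act_phi_succ (G := G) (q := q) ε i r u
        have hr : ((r : ℂ) + 1) ≠ 0 := by exact_mod_cast r.succ_ne_zero
        push_cast
        rw [← inv_smul_smul₀ hr (act G q V (Gen.φ ε i ((ε : ℤ) * (r + 1))) u), h]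
        refine S.smul_mem _ (S.smul_mem _ (S.sum_mem fun s hs => S.smul_mem _ (hh _ _ ?_ _ ?_)))
        · have : (ε : ℤ) ≠ 0 := ε.ne_zero
          exact mul_ne_zero this (by positivity)
        · rw [Finset.mem_range] at hs
          have h2 := ih (r - s) (by omega)
          rwa [Nat.cast_sub (by omega)] at h2
  have hn : n = (ε : ℤ) * (ε * n) := by rw [← mul_assoc, hε, one_mul]
  by_cases h0 : (ε : ℤ) * n < 0
  · rw [act_phi_vanish ε i n h0]
    exact S.zero_mem
  · obtain ⟨m, hm⟩ := Int.eq_ofNat_of_zero_le (not_lt.1 h0)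
    rw [hn, hm]
    exact key m

/-- The vectors obtained from a subspace by applying lowering operators. -/
inductive IsLowered (G : SimpleGraph I) [DecidableRel G.Adj] (q : ℂˣ) {V : Type*}
    [AddCommGroup V] [Module ℂ V] [Module (QAff G q) V] [IsScalarTower ℂ (QAff G q) V]
    (S : Submodule ℂ V) : V → Prop
  | base (u : V) (hu : u ∈ S) : IsLowered G q S u
  | step (j : I) (r : ℤ) (u : V) (hu : IsLowered G q S u) :
      IsLowered G q S (act G q V (Gen.x (-1) j r) u)

/-- A subspace of singular vectors stable under the loop-Cartan subalgebra generates, by the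
lowering operators only, the whole simple module. -/
theorem span_isLowered_eq_top (hs : IsSimpleModule (QAff G q) V) (S : Submodule ℂ V)
    (hne : S ≠ ⊥) (hk : ∀ ε i, ∀ u ∈ S, act G q V (Gen.k ε i) u ∈ S)
    (hh : ∀ i r, r ≠ 0 → ∀ u ∈ S, act G q V (Gen.h i r) u ∈ S)
    (hx : ∀ i r, ∀ u ∈ S, act G q V (Gen.x 1 i r) u = 0) :
    Submodule.span ℂ {u | IsLowered G q S u} = ⊤ := by
  set T := Submodule.span ℂ {u | IsLowered G q S u} with hT
  have hsub : S ≤ T := fun u hu => Submodule.subset_span (IsLowered.base u hu)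
  have hext : ∀ f : End ℂ V, (∀ u, IsLowered G q S u → f u ∈ T) →
      ∀ u ∈ T, f u ∈ T := by
    intro f hf u hu
    induction hu using Submodule.span_induction with
    | mem u hu => exact hf u hu
    | zero => rw [map_zero]; exact T.zero_mem
    | add a b _ _ ha hb => rw [map_add]; exact T.add_mem ha hb
    | smul c a _ ha => rw [map_smul]; exact T.smul_mem c ha
  have hxm : ∀ j r, ∀ u ∈ T, act G q V (Gen.x (-1) j r) u ∈ T := fun j r =>
    hext _ fun u hu => Submodule.subset_span (IsLowered.step j r u hu)
  have hk' : ∀ ε i, ∀ u ∈ T, act G q V (Gen.k ε i) u ∈ T := fun ε i => by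
    refine hext _ fun u hu => ?_
    induction hu with
    | base u hu => exact hsub (hk ε i u hu)
    | step j r u _ ih =>
      rw [← Module.End.mul_apply, act_k_x]
      exact T.smul_mem _ (hxm j r _ ih)
  have hh' : ∀ i r, r ≠ 0 → ∀ u ∈ T, act G q V (Gen.h i r) u ∈ T := fun i r hr => by
    refine hext _ fun u hu => ?_
    induction hu with
    | base u hu => exact hsub (hh i r hr u hu)
    | step j s u hu ih =>
      have h := LinearMap.congr_fun (act_h_x (G := G) (q := q) (V := V) (-1) i j r s hr) u
      rw [LinearMap.sub_apply, sub_eq_iff_eq_add'] at h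
      rw [← Module.End.mul_apply, h]
      exact T.add_mem (hxm j s _ ih)
        (T.smul_mem _ (hxm j (r + s) _ (Submodule.subset_span hu)))
  have hφ := act_phi_mem T hk' hh'
  -- Moving a raising operator past a lowering one only costs `φ` terms, which preserve `T`; on `S`
  -- itself raising operators vanish.
  have hxp : ∀ i r, ∀ u ∈ T, act G q V (Gen.x 1 i r) u ∈ T := fun i r => by
    refine hext _ fun u hu => ?_
    induction hu with
    | base u hu => rw [hx i r u hu]; exact T.zero_mem
    | step j s u hu ih =>
      have huT : u ∈ T := Submodule.subset_span hu
      rw [act_xp_xm]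
      refine T.add_mem (hxm j s _ ih) ?_
      split_ifs
      · exact T.smul_mem _ (T.sub_mem (hφ _ _ _ u huT) (hφ _ _ _ u huT))
      · exact T.zero_mem
  refine eq_top_of_stable hs T (fun g => ?_) fun h => hne (le_bot_iff.1 (h ▸ hsub))
  match g with
  | .x ε i r =>
    rcases Int.units_eq_one_or ε with rfl | rfl
    · exact hxp i r
    · exact hxm i r
  | .k ε i => exact hk' ε i
  | .h i r =>
    by_cases hr : r = 0
    · intro u _
      rw [hr, act_h_zero]
      exact T.zero_mem
    · exact hh' i r hr
  | .φ ε i r => exact hφ ε i r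

/-! ## Monomials -/

/-- The monomial `A_{j,b}^{-1}`. -/
def aInv (G : SimpleGraph I) [DecidableRel G.Adj] (q : ℂˣ) (j : I) (b : ℂˣ) : LMonomial I :=
  (∑ k, if G.Adj k j then Finsupp.single (k, b) 1 else 0) -
    (Finsupp.single (j, b * q) 1 + Finsupp.single (j, b * q⁻¹) 1)

/-- The power sum `∑_a u_{i,a} a ^ r` of the monomial `∏ Y_{i,a}^{u_{i,a}}`. -/
def powerSum (i : I) (r : ℤ) : LMonomial I →+ ℂ :=
  Finsupp.liftAddHom fun y => if y.1 = i then
    (AddMonoidHom.mulRight ((y.2 ^ r : ℂˣ) : ℂ)).comp (Int.castAddHom ℂ) else 0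

/-- The total exponent `∑_a u_{i,a}`. -/
def totalDegree (i : I) : LMonomial I →+ ℤ :=
  Finsupp.liftAddHom fun y => if y.1 = i then AddMonoidHom.id ℤ else 0

theorem powerSum_single (i : I) (r : ℤ) (y : I × ℂˣ) (u : ℤ) :
    powerSum i r (Finsupp.single y u) = if y.1 = i then (u : ℂ) * ((y.2 ^ r : ℂˣ) : ℂ) else 0 := by
  rw [powerSum, Finsupp.liftAddHom_apply_single]
  split_ifs <;> simp

theorem totalDegree_single (i : I) (y : I × ℂˣ) (u : ℤ) :
    totalDegree i (Finsupp.single y u) = if y.1 = i then u else 0 := by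
  rw [totalDegree, Finsupp.liftAddHom_apply_single]
  split_ifs <;> simp

theorem hValue_eq (m : LMonomial I) (i : I) (r : ℤ) :
    hValue q m i r = qInt q r / (r : ℂ) * powerSum i r m := by
  rw [hValue, powerSum, Finsupp.liftAddHom_apply]
  congr 1
  refine Finsupp.sum_congr fun y _ => ?_
  split_ifs <;> simp

theorem kValue_eq (m : LMonomial I) (i : I) :
    kValue q m i = ((q ^ totalDegree i m : ℂˣ) : ℂ) := by
  rw [kValue, totalDegree, Finsupp.liftAddHom_apply]
  congr 2
  refine Finsupp.sum_congr fun y _ => ?_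
  split_ifs <;> simp

theorem powerSum_zero (m : LMonomial I) (i : I) : powerSum i 0 m = (totalDegree i m : ℂ) := by
  induction m using Finsupp.induction_linear with
  | zero => simp
  | add a b ha hb => rw [map_add, map_add, ha, hb]; push_cast; rfl
  | single y u =>
    rw [powerSum_single, totalDegree_single]
    split_ifs <;> simp

theorem totalDegree_aInv (i j : I) (b : ℂˣ) :
    totalDegree i (aInv G q j b) = -cartan G i j := by
  have h : ∀ k, totalDegree i (if G.Adj k j then Finsupp.single (k, b) 1 else 0) =
      if k = i then (if G.Adj k j then 1 else 0) else 0 := fun k => by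
    by_cases hk : G.Adj k j
    · simp [hk, totalDegree_single]
    · simp [hk]
  simp only [aInv, map_sub, map_add, map_sum, h, totalDegree_single, Finset.sum_ite_eq',
    Finset.mem_univ, if_true, cartan]
  by_cases hij : i = j
  · subst hij
    simp
  · simp only [hij, Ne.symm hij, if_false]
    split_ifs <;> simp

theorem qInt_zero : qInt q 0 = 0 := by simp [qInt]

theorem qInt_neg (n : ℤ) : qInt q (-n) = -qInt q n := by
  rw [qInt, qInt, neg_neg, ← neg_div, neg_sub]

theorem qInt_two_mul (r : ℤ) :
    qInt q (r * 2) = qInt q r * (((q ^ r : ℂˣ) : ℂ) + ((q ^ (-r) : ℂˣ) : ℂ)) := by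
  rw [qInt, qInt, div_mul_eq_mul_div]
  congr 1
  rw [mul_two, neg_add, zpow_add, zpow_add]
  push_cast
  ring

/-- The factor before `b ^ r` is the coefficient of `x^-_{j,s+r}` in `[h_{i,r}, x^-_{j,s}]`. Hence
an eigenvector of the shift `s ↦ s + 1` with eigenvalue `b` changes `l`-weights by `A_{j,b}^{-1}`.
-/
theorem hValue_aInv (i j : I) (b : ℂˣ) (r : ℤ) :
    hValue q (aInv G q j b) i r =
      -(qInt q (r * cartan G i j) / (r : ℂ)) * ((b ^ r : ℂˣ) : ℂ) := by
  have h : ∀ k, powerSum i r (if G.Adj k j then Finsupp.single (k, b) 1 else 0) =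
      if k = i then (if G.Adj k j then ((b ^ r : ℂˣ) : ℂ) else 0) else 0 := fun k => by
    by_cases hk : G.Adj k j
    · simp [hk, powerSum_single]
    · simp [hk]
  simp only [hValue_eq, aInv, map_sub, map_add, map_sum, h, powerSum_single, Finset.sum_ite_eq',
    Finset.mem_univ, if_true, cartan]
  by_cases hij : i = j
  · subst hij
    simp only [SimpleGraph.irrefl, if_false, if_true, qInt_two_mul, mul_zpow, inv_zpow', zpow_neg]
    push_cast
    ring
  · simp only [hij, Ne.symm hij, if_false]
    split_ifs
    · rw [mul_neg, mul_one, qInt_neg]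
      ring
    · rw [mul_zero, qInt_zero]
      ring

theorem zpow_injective_of_not_root (hq : ∀ n : ℕ, 0 < n → q ^ n ≠ 1) :
    Function.Injective fun s : ℤ => q ^ s := by
  refine injective_zpow_iff_not_isOfFinOrder.2 fun h => ?_
  obtain ⟨n, hn, h1⟩ := isOfFinOrder_iff_pow_eq_one.1 h
  exact hq n hn h1

theorem sub_inv_ne_zero (hq : ∀ n : ℕ, 0 < n → q ^ n ≠ 1) :
    (q : ℂ) - ((q⁻¹ : ℂˣ) : ℂ) ≠ 0 := by
  intro h
  have h1 : q = q⁻¹ := Units.ext (sub_eq_zero.1 h)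
  refine hq 2 two_pos ?_
  rw [pow_two]
  nth_rewrite 2 [h1]
  exact mul_inv_cancel q

theorem qInt_ne_zero (hq : ∀ n : ℕ, 0 < n → q ^ n ≠ 1) {r : ℤ} (hr : r ≠ 0) :
    qInt q r ≠ 0 := by
  refine div_ne_zero (fun h => ?_) (sub_inv_ne_zero hq)
  have h1 := zpow_injective_of_not_root hq (Units.ext (sub_eq_zero.1 h))
  omega

/-- A monomial is determined by the corresponding eigenvalues. -/
theorem eq_of_kValue_eq_of_hValue_eq (hq : ∀ n : ℕ, 0 < n → q ^ n ≠ 1) {m m' : LMonomial I}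
    (hk : ∀ i, kValue q m i = kValue q m' i)
    (hh : ∀ i r, r ≠ 0 → hValue q m i r = hValue q m' i r) : m = m' := by
  have hp : ∀ i r, powerSum i r (m - m') = 0 := fun i r => by
    rw [map_sub, sub_eq_zero]
    by_cases hr : r = 0
    · subst hr
      have h := hk i
      rw [kValue_eq, kValue_eq] at h
      rw [powerSum_zero, powerSum_zero,
        show totalDegree i m = totalDegree i m' from
          zpow_injective_of_not_root hq (Units.ext h)]
    · have h := hh i r hr
      rw [hValue_eq, hValue_eq] at h
      exact mul_left_cancel₀ (div_ne_zero (qInt_ne_zero hq hr) (by exact_mod_cast hr)) h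
  -- The vanishing of all power sums is a linear relation between the distinct characters `r ↦ a ^
  -- r` of `ℤ`, which are linearly independent. The case `r = 0` was supplied by the eigenvalues of
  -- the `k_i`.
  have hinj : Function.Injective fun a : ℂˣ =>
      (Units.coeHom ℂ).comp (zpowersHom ℂˣ a) := fun a b hab => by
    have := DFunLike.congr_fun hab (Multiplicative.ofAdd 1)
    exact Units.ext (by simpa using this)
  have hli := (linearIndependent_monoidHom (Multiplicative ℤ) ℂ).comp _ hinj
  rw [← sub_eq_zero]
  set d := m - m' with hd
  ext ⟨i, a⟩
  set e : ℂˣ →₀ ℂ := (d.comapDomain (Prod.mk i) (Prod.mk_right_injective i).injOn).mapRange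
    (Int.cast : ℤ → ℂ) Int.cast_zero with he
  have he0 : e = 0 := by
    refine linearIndependent_iff.1 hli e ?_
    ext r
    have h := hp i r.toAdd
    rw [powerSum, Finsupp.liftAddHom_apply] at h
    rw [Finsupp.linearCombination_apply, Pi.zero_apply, Finsupp.sum, Finset.sum_apply]
    rw [Finsupp.sum] at h
    rw [← h]
    have hsub : e.support.map ⟨Prod.mk i, Prod.mk_right_injective i⟩ ⊆ d.support := by
      intro y hy
      obtain ⟨b, hb, rfl⟩ := Finset.mem_map.1 hy
      rw [Finsupp.mem_support_iff] at hb ⊢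
      intro h0
      refine hb ?_
      simp only [Function.Embedding.coeFn_mk] at h0
      simp [he, h0]
    rw [← Finset.sum_subset hsub, Finset.sum_map]
    · refine Finset.sum_congr rfl fun b _ => ?_
      simp [he]
    · rintro ⟨k, b⟩ _ hb
      by_cases hki : k = i
      · subst hki
        have : e b = 0 := by
          by_contra h0
          exact hb (Finset.mem_map.2 ⟨b, Finsupp.mem_support_iff.2 h0, rfl⟩)
        have h2 : d (k, b) = 0 := by simpa [he] using this
        simp [h2]
      · simp [hki]
  have := DFunLike.congr_fun he0 a
  simpa [he] using this

end Representations

end HernandezLeclerc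

namespace HernandezLeclerc

/-! ### Generalized eigenspaces of commutators and of powers. -/

section GeneralizedEigenspaces

open Module Polynomial

/-- From `(H - (c + a)) (f u) = ((ad H - a) f) u + f ((H - c) u)`, each application uses up one of
the `n + k` available powers. -/
theorem pow_sub_apply_eq_zero {V : Type*} [AddCommGroup V] [Module ℂ V] (H : End ℂ V) (a c : ℂ)
    (s : ℕ) : ∀ (n k : ℕ) (_ : n + k = s) (f : End ℂ V) (u : V),
      ((LinearMap.mulLeft ℂ H - LinearMap.mulRight ℂ H - a • (1 : End ℂ (End ℂ V))) ^ n) f = 0 →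
      ((H - c • (1 : End ℂ V)) ^ k) u = 0 →
      ((H - (c + a) • (1 : End ℂ V)) ^ s) (f u) = 0 := by
  induction s with
  | zero =>
    intro n k hs f u hf _
    obtain rfl : n = 0 := by omega
    have : f = 0 := by simpa using hf
    simp [this]
  | succ s ih =>
    intro n k hs f u hf hu
    rcases n with _ | n
    · have : f = 0 := by simpa using hf
      simp [this]
    rcases k with _ | k
    · have : u = 0 := by simpa using hu
      simp [this]
    rw [pow_succ, Module.End.mul_apply] at hf hu ⊢
    have hsplit : (H - (c + a) • (1 : End ℂ V)) (f u) =
        ((LinearMap.mulLeft ℂ H - LinearMap.mulRight ℂ H - a • (1 : End ℂ (End ℂ V))) f) u +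
          f ((H - c • (1 : End ℂ V)) u) := by
      simp only [LinearMap.sub_apply, LinearMap.smul_apply, Module.End.one_apply,
        LinearMap.mulLeft_apply, LinearMap.mulRight_apply, Module.End.mul_apply, map_sub, map_smul]
      module
    rw [hsplit, map_add, ih n (k + 1) (by omega) _ _ hf (by rw [pow_succ, Module.End.mul_apply, hu]),
      ih (n + 1) k (by omega) _ _ (by rw [pow_succ, Module.End.mul_apply, hf]) hu, add_zero]

/-- For `r ≥ 0` this is the divisibility of `X^r - b^r` by `X - b`; for `r < 0`, use `T^{-n} -
b^{-n} = -b^{-n} T^{-n} (T^n - b^n)`. Because the factor commutes with `T - b`, generalized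
eigenvectors of `T` are also generalized eigenvectors of `T^r`. -/
theorem exists_zpow_sub_eq_mul {R : Type*} [Ring R] [Algebra ℂ R] (T : Rˣ) (b : ℂˣ) (r : ℤ) :
    ∃ g : R, Commute g ((T : R) - (b : ℂ) • (1 : R)) ∧
      ((T ^ r : Rˣ) : R) - ((b ^ r : ℂˣ) : ℂ) • (1 : R) = g * ((T : R) - (b : ℂ) • (1 : R)) := by
  have hsub : (T : R) - (b : ℂ) • (1 : R) = aeval (T : R) (X - C (b : ℂ)) := by
    simp [Algebra.algebraMap_eq_smul_one]
  have hnat : ∀ n : ℕ, ∃ p : ℂ[X],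
      (T : R) ^ n - ((b : ℂ) ^ n) • (1 : R) = aeval (T : R) p * ((T : R) - (b : ℂ) • (1 : R)) := by
    intro n
    obtain ⟨p, hp⟩ := sub_dvd_pow_sub_pow (X : ℂ[X]) (C (b : ℂ)) n
    refine ⟨p, ?_⟩
    rw [hsub, ← map_mul, mul_comm p, ← hp]
    rw [← C_pow, map_sub, map_pow, aeval_X, aeval_C, Algebra.algebraMap_eq_smul_one]
  have hcomm : ∀ p : ℂ[X], Commute (aeval (T : R) p) ((T : R) - (b : ℂ) • (1 : R)) := fun p => by
    rw [hsub, commute_iff_eq, ← map_mul, ← map_mul, mul_comm]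
  rcases Int.eq_nat_or_neg r with ⟨n, rfl | rfl⟩
  · obtain ⟨p, hp⟩ := hnat n
    exact ⟨_, hcomm p, by simpa using hp⟩
  · obtain ⟨p, hp⟩ := hnat n
    have hT : Commute (((T ^ n)⁻¹ : Rˣ) : R) ((T : R) - (b : ℂ) • (1 : R)) := by
      refine Commute.units_inv_left ?_
      rw [Units.val_pow_eq_pow_val, hsub, commute_iff_eq]
      have : (T : R) ^ n = aeval (T : R) (X ^ n : ℂ[X]) := by simp
      rw [this, ← map_mul, ← map_mul, mul_comm]
    refine ⟨(-((b ^ n)⁻¹ : ℂˣ) : ℂ) • ((((T ^ n)⁻¹ : Rˣ) : R) * aeval (T : R) p),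
      (hT.mul_left (hcomm p)).smul_left _, ?_⟩
    rw [smul_mul_assoc, mul_assoc, ← hp, mul_sub, zpow_neg, zpow_natCast, zpow_neg, zpow_natCast,
      ← Units.val_pow_eq_pow_val, Units.inv_mul, mul_smul_comm, mul_one, smul_sub, smul_smul,
      ← Units.val_pow_eq_pow_val, neg_mul, Units.inv_mul]
    module

theorem pow_smul_zpow_sub_apply {M : Type*} [AddCommGroup M] [Module ℂ M] (T : (End ℂ M)ˣ)
    (b : ℂˣ) (n : ℕ) (f : M) (hf : (((T : End ℂ M) - (b : ℂ) • (1 : End ℂ M)) ^ n) f = 0)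
    (c : ℂ) (r : ℤ) :
    ((c • ((T ^ r : (End ℂ M)ˣ) : End ℂ M) - (c * ((b ^ r : ℂˣ) : ℂ)) • (1 : End ℂ M)) ^ n) f =
      0 := by
  obtain ⟨g, hg, h⟩ := exists_zpow_sub_eq_mul T b r
  have h2 : c • ((T ^ r : (End ℂ M)ˣ) : End ℂ M) - (c * ((b ^ r : ℂˣ) : ℂ)) • (1 : End ℂ M) =
      (c • g) * ((T : End ℂ M) - (b : ℂ) • (1 : End ℂ M)) := by
    rw [smul_mul_assoc, ← h, smul_sub, smul_smul]
  rw [h2, (hg.smul_left c).mul_pow, Module.End.mul_apply, hf, map_zero]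

end GeneralizedEigenspaces

/-! ### The effect of lowering operators on `l`-weights. -/

section LWeights

open Module

variable {I : Type*} [Fintype I] [DecidableEq I] {G : SimpleGraph I} [DecidableRel G.Adj] {q : ℂˣ}
  {V : Type*} [AddCommGroup V] [Module ℂ V] [Module (QAff G q) V] [IsScalarTower ℂ (QAff G q) V]

theorem mem_lWeightSpace (m : LMonomial I) (u : V) : u ∈ lWeightSpace G q V m ↔
    (∀ i, ∃ n : ℕ, ((act G q V (Gen.k 1 i) - kValue q m i • (1 : End ℂ V)) ^ n) u = 0) ∧
    ∀ i r, r ≠ 0 → ∃ n : ℕ,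
      ((act G q V (Gen.h i r) - hValue q m i r • (1 : End ℂ V)) ^ n) u = 0 := by
  simp only [lWeightSpace, Submodule.mem_inf, Submodule.mem_iInf, End.mem_maxGenEigenspace]

theorem apply_mem_lWeightSpace (m : LMonomial I) (f : End ℂ V)
    (hk : ∀ i, Commute (act G q V (Gen.k 1 i)) f)
    (hh : ∀ i r, Commute (act G q V (Gen.h i r)) f) (u : V) (hu : u ∈ lWeightSpace G q V m) :
    f u ∈ lWeightSpace G q V m := by
  simp only [lWeightSpace, Submodule.mem_inf, Submodule.mem_iInf] at hu ⊢
  exact ⟨fun i => End.mapsTo_maxGenEigenspace_of_comm (hk i) _ (hu.1 i),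
    fun i r hr => End.mapsTo_maxGenEigenspace_of_comm (hh i r) _ (hu.2 i r hr)⟩

/-- Joint generalized eigenspaces of commuting operators are independent, and distinct monomials
have distinct eigenvalues. -/
theorem iSupIndep_lWeightSpace (hq : ∀ n : ℕ, 0 < n → q ^ n ≠ 1) :
    iSupIndep fun m : LMonomial I => lWeightSpace G q V m := by
  set F : I ⊕ I × ℤ → End ℂ V := Sum.elim (fun i => act G q V (Gen.k 1 i))
    fun y => act G q V (Gen.h y.1 y.2) with hF
  have hcomm : ∀ a b, Commute (F a) (F b) := by
    rintro (i | ⟨i, r⟩) (j | ⟨j, s⟩)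
    · exact act_k_comm 1 1 i j
    · exact act_k_h_comm 1 i j s
    · exact (act_k_h_comm 1 j i r).symm
    · exact act_h_comm i j r s
  have hind := End.independent_iInf_maxGenEigenspace_of_forall_mapsTo F
    fun a b φ => End.mapsTo_maxGenEigenspace_of_comm (hcomm b a) φ
  set χ : LMonomial I → I ⊕ I × ℤ → ℂ := fun m => Sum.elim (fun i => kValue q m i)
    fun y => hValue q m y.1 y.2 with hχ
  have hinj : Function.Injective χ := fun m m' h =>
    eq_of_kValue_eq_of_hValue_eq hq (fun i => congrFun h (Sum.inl i))
      fun i r _ => congrFun h (Sum.inr (i, r))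
  refine (hind.comp hinj).mono fun m u hu => ?_
  rw [mem_lWeightSpace] at hu
  simp only [Function.comp_apply, Submodule.mem_iInf, End.mem_maxGenEigenspace]
  rintro (i | ⟨i, r⟩)
  · exact hu.1 i
  · by_cases hr : r = 0
    · subst hr
      refine ⟨1, ?_⟩
      simp [hF, hχ, act_h_zero, hValue, qInt_zero]
    · exact hu.2 i r hr

/-- The span of the lowering operators attached to the vertex `j`. -/
def loweringSpan (G : SimpleGraph I) [DecidableRel G.Adj] (q : ℂˣ) (V : Type*) [AddCommGroup V]
    [Module ℂ V] [Module (QAff G q) V] [IsScalarTower ℂ (QAff G q) V] (j : I) :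
    Submodule ℂ (End ℂ V) :=
  Submodule.span ℂ (Set.range fun s : ℤ => act G q V (Gen.x (-1) j s))

/-- The commutator with `h_{i,r}`. -/
def adH (G : SimpleGraph I) [DecidableRel G.Adj] (q : ℂˣ) (V : Type*) [AddCommGroup V]
    [Module ℂ V] [Module (QAff G q) V] [IsScalarTower ℂ (QAff G q) V] (i : I) (r : ℤ) :
    End ℂ (End ℂ V) :=
  LinearMap.mulLeft ℂ (act G q V (Gen.h i r)) - LinearMap.mulRight ℂ (act G q V (Gen.h i r))

theorem adH_apply (i j : I) {r : ℤ} (hr : r ≠ 0) (s : ℤ) :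
    adH G q V i r (act G q V (Gen.x (-1) j s)) =
      (-(qInt q (r * cartan G i j) / (r : ℂ))) • act G q V (Gen.x (-1) j (s + r)) := by
  rw [adH, LinearMap.sub_apply, LinearMap.mulLeft_apply, LinearMap.mulRight_apply,
    act_h_x _ _ _ _ _ hr, add_comm r s]
  congr 1
  simp

theorem qInt_two_ne_zero (hq : ∀ n : ℕ, 0 < n → q ^ n ≠ 1) : qInt q 2 ≠ 0 :=
  qInt_ne_zero hq two_ne_zero

/-- The shift `x^-_{j,s} ↦ x^-_{j,s+1}` is well defined on the span, whatever linear relations hold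
there, because it is a multiple of the commutator with `h_{j,1}`; `h_{j,-1}` gives its inverse.
Every commutator with `h_{i,r}` is then a scalar multiple of the `r`-th power of the shift. -/
theorem exists_shift (hq : ∀ n : ℕ, 0 < n → q ^ n ≠ 1) (j : I) :
    ∃ T : (End ℂ (loweringSpan G q V j))ˣ, ∀ (i : I) (r : ℤ), r ≠ 0 →
      ∀ f : loweringSpan G q V j, adH G q V i r f =
        (((-(qInt q (r * cartan G i j) / (r : ℂ))) •
          ((T ^ r : (End ℂ (loweringSpan G q V j))ˣ) : End ℂ (loweringSpan G q V j))) f :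
            loweringSpan G q V j) := by
  set x : ℤ → loweringSpan G q V j := fun s =>
    ⟨act G q V (Gen.x (-1) j s), Submodule.subset_span ⟨s, rfl⟩⟩ with hx
  have hspan : ∀ {N : Type _} [AddCommGroup N] [Module ℂ N]
      (A B : loweringSpan G q V j →ₗ[ℂ] N), (∀ s, A (x s) = B (x s)) → A = B := by
    intro N _ _ A B hAB
    refine LinearMap.ext fun ⟨f, hf⟩ => ?_
    induction hf using Submodule.span_induction with
    | mem f hf => obtain ⟨s, rfl⟩ := hf; exact hAB s
    | zero => exact (map_zero A).trans (map_zero B).symm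
    | add f g hf hg h1 h2 =>
      exact (map_add A ⟨f, hf⟩ ⟨g, hg⟩).trans
        ((congrArg₂ (· + ·) h1 h2).trans (map_add B ⟨f, hf⟩ ⟨g, hg⟩).symm)
    | smul c f hf h1 =>
      exact (map_smul A c ⟨f, hf⟩).trans
        ((congrArg (c • ·) h1).trans (map_smul B c ⟨f, hf⟩).symm)
  have hmaps : ∀ r : ℤ, r ≠ 0 → ∀ f ∈ loweringSpan G q V j,
      adH G q V j r f ∈ loweringSpan G q V j := by
    intro r hr f hf
    induction hf using Submodule.span_induction with
    | mem f hf =>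
      obtain ⟨s, rfl⟩ := hf
      rw [adH_apply _ _ hr]
      exact Submodule.smul_mem _ _ (Submodule.subset_span ⟨s + r, rfl⟩)
    | zero => rw [map_zero]; exact Submodule.zero_mem _
    | add f g _ _ h1 h2 => rw [map_add]; exact Submodule.add_mem _ h1 h2
    | smul c f _ h1 => rw [map_smul]; exact Submodule.smul_mem _ _ h1
  set T₁ : End ℂ (loweringSpan G q V j) :=
    (-(qInt q 2)⁻¹) • (adH G q V j 1).restrict (hmaps 1 one_ne_zero) with hT₁
  set T₂ : End ℂ (loweringSpan G q V j) :=
    (-(qInt q 2)⁻¹) • (adH G q V j (-1)).restrict (hmaps (-1) (by norm_num)) with hT₂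
  have h2 := qInt_two_ne_zero hq
  have hT₁x : ∀ s, T₁ (x s) = x (s + 1) := fun s => by
    apply Subtype.ext
    simp only [hT₁, hx, LinearMap.smul_apply, Submodule.coe_smul, LinearMap.coe_restrict_apply,
      adH_apply _ _ one_ne_zero, cartan, if_true, smul_smul]
    simp [h2]
  have hT₂x : ∀ s, T₂ (x s) = x (s - 1) := fun s => by
    apply Subtype.ext
    simp only [hT₂, hx, LinearMap.smul_apply, Submodule.coe_smul, LinearMap.coe_restrict_apply,
      adH_apply _ _ (show (-1 : ℤ) ≠ 0 by norm_num), cartan, if_true, smul_smul]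
    rw [neg_one_mul, qInt_neg]
    simp [h2, sub_eq_add_neg]
  refine ⟨⟨T₁, T₂, hspan _ _ fun s => ?_, hspan _ _ fun s => ?_⟩, ?_⟩
  · simp [Module.End.mul_apply, hT₁x, hT₂x]
  · simp [Module.End.mul_apply, hT₁x, hT₂x]
  set T : (End ℂ (loweringSpan G q V j))ˣ := ⟨T₁, T₂, _, _⟩ with hT
  have hpow : ∀ r : ℤ, ∀ s, ((T ^ r : (End ℂ (loweringSpan G q V j))ˣ) :
      End ℂ (loweringSpan G q V j)) (x s) = x (s + r) := by
    intro r
    induction r with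
    | zero => simp
    | succ n ih =>
      intro s
      rw [zpow_add_one, Units.val_mul, Module.End.mul_apply]
      rw [show (T : End ℂ (loweringSpan G q V j)) = T₁ from rfl, hT₁x, ih]
      congr 1
      ring
    | pred n ih =>
      intro s
      rw [zpow_sub_one, Units.val_mul, Module.End.mul_apply,
        show ((T⁻¹ : (End ℂ (loweringSpan G q V j))ˣ) : End ℂ (loweringSpan G q V j)) = T₂ from rfl,
        hT₂x, ih]
      congr 1
      ring
  intro i r hr f
  refine LinearMap.congr_fun (hspan ((adH G q V i r).comp (Submodule.subtype _))
    ((Submodule.subtype _).comp ((-(qInt q (r * cartan G i j) / (r : ℂ))) •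
      ((T ^ r : (End ℂ (loweringSpan G q V j))ˣ) : End ℂ (loweringSpan G q V j))))
    fun s => ?_) f
  simp only [LinearMap.comp_apply, LinearMap.smul_apply, hpow, map_smul, Submodule.subtype_apply]
  exact adH_apply i j hr s

theorem kValue_add (m m' : LMonomial I) (i : I) :
    kValue q (m + m') i = kValue q m i * kValue q m' i := by
  simp only [kValue_eq, map_add, zpow_add, Units.val_mul]

theorem hValue_add (m m' : LMonomial I) (i : I) (r : ℤ) :
    hValue q (m + m') i r = hValue q m i r + hValue q m' i r := by
  simp only [hValue_eq, map_add, mul_add]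

/-- A lowering operator maps an `l`-weight space into the sum of those whose `l`-weight differs by
some `A_{j,b}^{-1}`. -/
theorem act_x_mem_iSup [FiniteDimensional ℂ V] (hq : ∀ n : ℕ, 0 < n → q ^ n ≠ 1)
    (m : LMonomial I) (j : I) (s : ℤ) (u : V) (hu : u ∈ lWeightSpace G q V m) :
    act G q V (Gen.x (-1) j s) u ∈ ⨆ b : ℂˣ, lWeightSpace G q V (m + aInv G q j b) := by
  obtain ⟨T, hT⟩ := exists_shift (G := G) (V := V) hq j
  set P := ⨆ b : ℂˣ, lWeightSpace G q V (m + aInv G q j b) with hP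
  rw [mem_lWeightSpace] at hu
  have hk : ∀ f ∈ loweringSpan G q V j, ∀ i, act G q V (Gen.k 1 i) * f =
      kValue q (aInv G q j 1) i • (f * act G q V (Gen.k 1 i)) := by
    intro f hf i
    induction hf using Submodule.span_induction with
    | mem f hf =>
      obtain ⟨s, rfl⟩ := hf
      beta_reduce
      rw [act_k_x, kValue_eq, totalDegree_aInv]
      simp
    | zero => simp
    | add f g _ _ h1 h2 => rw [mul_add, h1, h2, add_mul, smul_add]
    | smul c f _ h1 => rw [mul_smul_comm, h1, smul_mul_assoc, smul_comm]
  -- Generalized eigenvectors of the shift with eigenvalue `b` multiply `l`-weights by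
  -- `A_{j,b}^{-1}`; `b = 0` does not occur as the shift is invertible. By finite-dimensionality
  -- they span all lowering operators at `j`.
  have key : ∀ (b : ℂ) (f : loweringSpan G q V j),
      f ∈ (T : End ℂ (loweringSpan G q V j)).maxGenEigenspace b → (f : End ℂ V) u ∈ P := by
    intro b f hf
    obtain ⟨n, hn⟩ := End.mem_maxGenEigenspace _ _ _ |>.1 hf
    by_cases hb : b = 0
    · subst hb
      have h0 : f = 0 := by
        have hz : (T : End ℂ (loweringSpan G q V j)) - (0 : ℂ) • (1 : End ℂ (loweringSpan G q V j)) =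
            T := by
          ext1 x
          simp
        rw [hz, ← Units.val_pow_eq_pow_val] at hn
        have h1 := congrArg (((T ^ n)⁻¹ : (End ℂ (loweringSpan G q V j))ˣ) :
          End ℂ (loweringSpan G q V j)) hn
        rwa [← Module.End.mul_apply, Units.inv_mul, map_zero] at h1
      rw [h0]
      exact P.zero_mem
    · obtain ⟨b, rfl⟩ : ∃ b' : ℂˣ, (b' : ℂ) = b := ⟨Units.mk0 b hb, rfl⟩
      refine Submodule.mem_iSup_of_mem b ?_
      rw [mem_lWeightSpace]
      constructor
      · intro i
        obtain ⟨k, hk'⟩ := hu.1 i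
        refine ⟨k, ?_⟩
        have hkv : kValue q (m + aInv G q j b) i =
            kValue q (aInv G q j 1) i * kValue q m i := by
          rw [kValue_add, mul_comm, kValue_eq (aInv G q j b), kValue_eq (aInv G q j 1),
            totalDegree_aInv, totalDegree_aInv]
        have hone : (act G q V (Gen.k 1 i) - kValue q (m + aInv G q j b) i • (1 : End ℂ V)) *
            (f : End ℂ V) = kValue q (aInv G q j 1) i • ((f : End ℂ V) *
              (act G q V (Gen.k 1 i) - kValue q m i • (1 : End ℂ V))) := by
          rw [sub_mul, hk f f.2, hkv, mul_sub, smul_sub, smul_mul_assoc, one_mul, mul_smul_comm,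
            mul_one, smul_smul]
        have hpow : ∀ k : ℕ, (act G q V (Gen.k 1 i) -
            kValue q (m + aInv G q j b) i • (1 : End ℂ V)) ^ k * (f : End ℂ V) =
            kValue q (aInv G q j 1) i ^ k • ((f : End ℂ V) *
              (act G q V (Gen.k 1 i) - kValue q m i • (1 : End ℂ V)) ^ k) := by
          intro k
          induction k with
          | zero => simp
          | succ k ih =>
            rw [pow_succ, mul_assoc, hone, mul_smul_comm, ← mul_assoc, ih, smul_mul_assoc,
              smul_smul, mul_assoc, ← pow_succ, ← pow_succ']
        rw [← Module.End.mul_apply, hpow, LinearMap.smul_apply, Module.End.mul_apply, hk',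
          map_zero, smul_zero]
      · intro i r hr
        obtain ⟨k, hk'⟩ := hu.2 i r hr
        refine ⟨n + k, ?_⟩
        rw [hValue_add]
        refine pow_sub_apply_eq_zero _ _ _ _ n k rfl _ _ ?_ hk'
        rw [hValue_aInv]
        have h1 := pow_smul_zpow_sub_apply T b n f hn
          (-(qInt q (r * cartan G i j) / (r : ℂ))) r
        have h2 : ∀ (n : ℕ) (f : loweringSpan G q V j), ((adH G q V i r -
            (-(qInt q (r * cartan G i j) / (r : ℂ)) * ((b ^ r : ℂˣ) : ℂ)) •
              (1 : End ℂ (End ℂ V))) ^ n) (f : End ℂ V) =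
            ((((-(qInt q (r * cartan G i j) / (r : ℂ))) •
              ((T ^ r : (End ℂ (loweringSpan G q V j))ˣ) : End ℂ (loweringSpan G q V j)) -
              (-(qInt q (r * cartan G i j) / (r : ℂ)) * ((b ^ r : ℂˣ) : ℂ)) • 1) ^ n) f :
                loweringSpan G q V j) := by
          intro n
          induction n with
          | zero => simp
          | succ n ih =>
            intro f
            rw [pow_succ, pow_succ, Module.End.mul_apply, Module.End.mul_apply, ← ih]
            congr 1
            rw [LinearMap.sub_apply, hT i r hr f]
            simp
        have h3 := h2 n f
        rw [h1] at h3
        exact h3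
  have htop := End.iSup_maxGenEigenspace_eq_top (T : End ℂ (loweringSpan G q V j))
  have hmem : (⟨act G q V (Gen.x (-1) j s), Submodule.subset_span ⟨s, rfl⟩⟩ :
      loweringSpan G q V j) ∈
      ⨆ b, (T : End ℂ (loweringSpan G q V j)).maxGenEigenspace b := htop ▸ Submodule.mem_top
  have hle : (⨆ b, (T : End ℂ (loweringSpan G q V j)).maxGenEigenspace b) ≤
      P.comap ((LinearMap.applyₗ u).comp (Submodule.subtype (loweringSpan G q V j))) :=
    iSup_le fun b f hf => key b f hf
  exact hle hmem

end LWeights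

end HernandezLeclerc

namespace HernandezLeclerc

/-! ### Truncated `q`-characters of Kirillov–Reshetikhin modules. -/

section KirillovReshetikhin

open Module

variable {I : Type*} [Fintype I] [DecidableEq I] {G : SimpleGraph I} [DecidableRel G.Adj] {q : ℂˣ}
  {V : Type*} [AddCommGroup V] [Module ℂ V] [Module (QAff G q) V] [IsScalarTower ℂ (QAff G q) V]

/-! ## Eigenvalues of the loop-Cartan currents -/

theorem sum_range_pow_sub_pow_mul (α β : ℂ) (n : ℕ) :
    ∑ s ∈ Finset.range n, (α ^ (s + 1) - β ^ (s + 1)) * ((α - β) * α ^ (n - 1 - s)) =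
      n * α ^ n * (α - β) - β * (α ^ n - β ^ n) := by
  induction n with
  | zero => simp
  | succ n ih =>
    rw [Finset.sum_range_succ]
    have h : ∑ s ∈ Finset.range n,
        (α ^ (s + 1) - β ^ (s + 1)) * ((α - β) * α ^ (n + 1 - 1 - s)) =
        α * ∑ s ∈ Finset.range n,
          (α ^ (s + 1) - β ^ (s + 1)) * ((α - β) * α ^ (n - 1 - s)) := by
      rw [Finset.mul_sum]
      refine Finset.sum_congr rfl fun s hs => ?_
      rw [Finset.mem_range] at hs
      have : n + 1 - 1 - s = (n - 1 - s) + 1 := by omega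
      rw [this, pow_succ]
      ring
    rw [h, ih]
    have : n + 1 - 1 - n = 0 := by omega
    rw [this]
    push_cast
    ring

/-- The coefficients of the series `κ (1 - β z) / (1 - α z)`. -/
def currentCoeff (κ α β : ℂ) : ℕ → ℂ
  | 0 => κ
  | n + 1 => κ * (α - β) * α ^ n

/-- The coefficientwise form of the logarithmic derivative of `κ (1 - β z) / (1 - α z)`, matching
the defining relation of the `φ`. -/
theorem sum_range_mul_currentCoeff (κ α β : ℂ) (n : ℕ) :
    ∑ s ∈ Finset.range (n + 1), (α ^ (s + 1) - β ^ (s + 1)) * currentCoeff κ α β (n - s) =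
      (n + 1) * currentCoeff κ α β (n + 1) := by
  rw [Finset.sum_range_succ, Nat.sub_self]
  have h : ∑ s ∈ Finset.range n, (α ^ (s + 1) - β ^ (s + 1)) * currentCoeff κ α β (n - s) =
      κ * ∑ s ∈ Finset.range n,
        (α ^ (s + 1) - β ^ (s + 1)) * ((α - β) * α ^ (n - 1 - s)) := by
    rw [Finset.mul_sum]
    refine Finset.sum_congr rfl fun s hs => ?_
    rw [Finset.mem_range] at hs
    have : n - s = (n - 1 - s) + 1 := by omega
    rw [this, currentCoeff]
    ring
  rw [h, sum_range_pow_sub_pow_mul, currentCoeff, currentCoeff]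
  ring

theorem act_k_apply {v : V} {i : I} {κ : ℂˣ} (hk : act G q V (Gen.k 1 i) v = (κ : ℂ) • v)
    (ε : ℤˣ) : act G q V (Gen.k ε i) v = ((κ ^ (ε : ℤ) : ℂˣ) : ℂ) • v := by
  rcases Int.units_eq_one_or ε with rfl | rfl
  · simpa using hk
  · have h := LinearMap.congr_fun (act_k_mul_inv (G := G) (q := q) (V := V) (-1) i) v
    rw [neg_neg, Module.End.mul_apply, hk, map_smul, Module.End.one_apply] at h
    nth_rewrite 2 [← h]
    rw [smul_smul]
    simp

theorem act_phi_apply (hq : ∀ n : ℕ, 0 < n → q ^ n ≠ 1) {v : V} {i : I} {κ A B : ℂˣ}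
    (hk : act G q V (Gen.k 1 i) v = (κ : ℂ) • v)
    (hh : ∀ r : ℤ, r ≠ 0 → act G q V (Gen.h i r) v =
      ((((A ^ r : ℂˣ) : ℂ) - ((B ^ r : ℂˣ) : ℂ)) / (r * ((q : ℂ) - ((q⁻¹ : ℂˣ) : ℂ)))) • v)
    (ε : ℤˣ) (n : ℕ) : act G q V (Gen.φ ε i ((ε : ℤ) * n)) v =
      currentCoeff ((κ ^ (ε : ℤ) : ℂˣ) : ℂ) ((A ^ (ε : ℤ) : ℂˣ) : ℂ) ((B ^ (ε : ℤ) : ℂˣ) : ℂ) n •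
        v := by
  have hqq := sub_inv_ne_zero hq
  induction n using Nat.strong_induction_on with
  | _ n ih =>
    rcases n with _ | r
    · simpa [act_phi_zero, currentCoeff] using act_k_apply hk ε
    · have h := act_phi_succ (G := G) (q := q) ε i r v
      have hr : ((r : ℂ) + 1) ≠ 0 := by exact_mod_cast r.succ_ne_zero
      rw [← smul_right_injective V hr |>.eq_iff]
      push_cast
      rw [h, smul_smul, ← sum_range_mul_currentCoeff, Finset.sum_smul, Finset.smul_sum]
      refine Finset.sum_congr rfl fun s hs => ?_
      rw [Finset.mem_range] at hs
      have hε0 : (ε : ℤ) ≠ 0 := ε.ne_zero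
      have hs0 : (ε : ℤ) * (s + 1) ≠ 0 := mul_ne_zero hε0 (by positivity)
      have hsr : ((r : ℤ) - s) = ((r - s : ℕ) : ℤ) := by omega
      rw [hsr, ih (r - s) (by omega), map_smul, hh _ hs0, smul_smul, smul_smul, smul_smul,
        zpow_mul, zpow_mul]
      congr 1
      have h1 : ((ε : ℤ) : ℂ) ≠ 0 := by exact_mod_cast hε0
      have h2 : ((s : ℂ) + 1) ≠ 0 := by exact_mod_cast s.succ_ne_zero
      have h3 : ∀ X : ℂˣ, X ^ ((s : ℤ) + 1) = X ^ (s + 1) := fun X => by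
        rw [← zpow_natCast]; push_cast; rfl
      rw [h3, h3]
      generalize (q : ℂ) - ((q⁻¹ : ℂˣ) : ℂ) = c at hqq
      push_cast
      field_simp

/-- The condition `A = κ² B` says that both currents expand the same function `κ (1 - B z) / (1 - A
z)`, at `0` and at `∞`. With a single simple pole, the difference of the expansions is one two-sided
geometric series. -/
theorem act_phi_sub_apply (hq : ∀ n : ℕ, 0 < n → q ^ n ≠ 1) {v : V} {i : I} {κ A B : ℂˣ}
    (hAB : A = κ ^ 2 * B) (hk : act G q V (Gen.k 1 i) v = (κ : ℂ) • v)
    (hh : ∀ r : ℤ, r ≠ 0 → act G q V (Gen.h i r) v =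
      ((((A ^ r : ℂˣ) : ℂ) - ((B ^ r : ℂˣ) : ℂ)) / (r * ((q : ℂ) - ((q⁻¹ : ℂˣ) : ℂ)))) • v)
    (n : ℤ) : act G q V (Gen.φ 1 i n) v - act G q V (Gen.φ (-1) i n) v =
      (((A ^ n : ℂˣ) : ℂ) * ((κ : ℂ) - ((κ⁻¹ : ℂˣ) : ℂ))) • v := by
  have h1 := act_phi_apply hq hk hh 1
  have h2 := act_phi_apply hq hk hh (-1)
  have hκ : (κ : ℂ) * (κ : ℂ)⁻¹ = 1 := mul_inv_cancel₀ κ.ne_zero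
  have hA : (A : ℂ) = (κ : ℂ) ^ 2 * B := by rw [hAB]; push_cast; rfl
  have hB : (B : ℂ) = (κ : ℂ)⁻¹ ^ 2 * A := by
    rw [hA]
    linear_combination -((κ : ℂ) * (κ : ℂ)⁻¹ + 1) * B * hκ
  have hB' : (B : ℂ)⁻¹ = (κ : ℂ) ^ 2 * (A : ℂ)⁻¹ := by
    rw [hB, mul_inv, inv_pow, inv_inv]
  simp only [Units.val_one, one_mul, zpow_one] at h1
  simp only [Units.val_neg, Units.val_one, neg_one_mul, zpow_neg, zpow_one] at h2
  rcases lt_trichotomy n 0 with hn | rfl | hn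
  · obtain ⟨m, rfl⟩ : ∃ m : ℕ, n = -((m + 1 : ℕ) : ℤ) := ⟨(-n - 1).toNat, by omega⟩
    rw [act_phi_vanish 1 i _ (by simpa using hn), h2, LinearMap.zero_apply, zero_sub, ← neg_smul,
      currentCoeff]
    congr 1
    rw [zpow_neg, zpow_natCast]
    push_cast
    rw [hB', ← inv_pow]
    linear_combination (A : ℂ)⁻¹ ^ (m + 1) * κ * hκ
  · have h3 := h1 0
    have h4 := h2 0
    simp only [Nat.cast_zero, neg_zero] at h3 h4
    rw [h3, h4, ← sub_smul, currentCoeff, currentCoeff]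
    simp
  · obtain ⟨m, rfl⟩ : ∃ m : ℕ, n = ((m + 1 : ℕ) : ℤ) := ⟨(n - 1).toNat, by omega⟩
    rw [act_phi_vanish (-1) i _ (by rw [Units.val_neg, Units.val_one]; omega), h1, LinearMap.zero_apply, sub_zero,
      currentCoeff]
    congr 1
    rw [zpow_natCast]
    push_cast
    rw [hB]
    linear_combination -(A : ℂ) ^ (m + 1) * (κ : ℂ)⁻¹ * hκ

/-! ## Sums of `l`-weight spaces -/

/-- The sum of the `l`-weight spaces attached to a set of monomials. -/
def lWeightSum (G : SimpleGraph I) [DecidableRel G.Adj] (q : ℂˣ) (V : Type*) [AddCommGroup V]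
    [Module ℂ V] [Module (QAff G q) V] [IsScalarTower ℂ (QAff G q) V] (M : Set (LMonomial I)) :
    Submodule ℂ V :=
  ⨆ m ∈ M, lWeightSpace G q V m

theorem lWeightSpace_le_lWeightSum {M : Set (LMonomial I)} {m : LMonomial I} (hm : m ∈ M) :
    lWeightSpace G q V m ≤ lWeightSum G q V M :=
  le_iSup₂_of_le m hm le_rfl

theorem act_x_mem_lWeightSum [FiniteDimensional ℂ V] (hq : ∀ n : ℕ, 0 < n → q ^ n ≠ 1)
    {M M' : Set (LMonomial I)} (j : I) (h : ∀ m ∈ M, ∀ b, m + aInv G q j b ∈ M') (s : ℤ) {u : V}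
    (hu : u ∈ lWeightSum G q V M) :
    act G q V (Gen.x (-1) j s) u ∈ lWeightSum G q V M' := by
  have hle : lWeightSum G q V M ≤ (lWeightSum G q V M').comap (act G q V (Gen.x (-1) j s)) :=
    iSup₂_le fun m hm u hu => by
      have h1 := act_x_mem_iSup hq m j s u hu
      have h2 : (⨆ b : ℂˣ, lWeightSpace G q V (m + aInv G q j b)) ≤ lWeightSum G q V M' :=
        iSup_le fun b => lWeightSpace_le_lWeightSum (h m hm b)
      exact h2 h1
  exact hle hu

theorem apply_mem_lWeightSum {M : Set (LMonomial I)} (f : End ℂ V)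
    (hk : ∀ i, Commute (act G q V (Gen.k 1 i)) f)
    (hh : ∀ i r, Commute (act G q V (Gen.h i r)) f) {u : V} (hu : u ∈ lWeightSum G q V M) :
    f u ∈ lWeightSum G q V M := by
  have hle : lWeightSum G q V M ≤ (lWeightSum G q V M).comap f :=
    iSup₂_le fun m hm u hu =>
      lWeightSpace_le_lWeightSum hm (apply_mem_lWeightSpace m f hk hh u hu)
  exact hle hu

theorem mem_lWeightSum_of_isLowered [FiniteDimensional ℂ V] (hq : ∀ n : ℕ, 0 < n → q ^ n ≠ 1)
    {M : Set (LMonomial I)} (h : ∀ m ∈ M, ∀ j b, m + aInv G q j b ∈ M) {S : Submodule ℂ V}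
    (hS : S ≤ lWeightSum G q V M) {u : V} (hu : IsLowered G q S u) :
    u ∈ lWeightSum G q V M := by
  induction hu with
  | base u hu => exact hS hu
  | step j r u _ ih => exact act_x_mem_lWeightSum hq j (fun m hm b => h m hm j b) r ih

theorem disjoint_lWeightSum (hq : ∀ n : ℕ, 0 < n → q ^ n ≠ 1) {M : Set (LMonomial I)}
    {m : LMonomial I} (hm : m ∉ M) :
    Disjoint (lWeightSpace G q V m) (lWeightSum G q V M) :=
  (iSupIndep_lWeightSpace hq).disjoint_biSup hm

/-- A product of monomials `A_{j,b}^{-1}`. -/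
def aInvProd (G : SimpleGraph I) [DecidableRel G.Adj] (q : ℂˣ) (l : List (I × ℂˣ)) :
    LMonomial I :=
  (l.map fun y => aInv G q y.1 y.2).sum

theorem totalDegree_aInvProd (l : List (I × ℂˣ)) (i : I) :
    totalDegree i (aInvProd G q l) =
      -((cartan G).mulVec fun j => ((l.map Prod.fst).count j : ℤ)) i := by
  induction l with
  | nil =>
    have : (fun j : I => ((([] : List (I × ℂˣ)).map Prod.fst).count j : ℤ)) = 0 := by
      ext j; simp
    rw [this]
    simp [aInvProd]
  | cons y l ih =>
    have h : (fun j => (((y :: l).map Prod.fst).count j : ℤ)) =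
        (fun j => ((l.map Prod.fst).count j : ℤ)) + Pi.single y.1 1 := by
      ext j
      simp only [List.map_cons, List.count_cons, Pi.add_apply, Pi.single_apply, beq_iff_eq]
      push_cast
      simp only [eq_comm]
    have h2 : aInvProd G q (y :: l) = aInv G q y.1 y.2 + aInvProd G q l := by
      simp [aInvProd]
    rw [h2, map_add, ih, totalDegree_aInv, h, Matrix.mulVec_add, Pi.add_apply,
      Matrix.mulVec_single_one]
    simp only [Matrix.col_apply]
    ring

/-- The total degrees are minus the Cartan matrix applied to the vector of multiplicities, and that
matrix is injective. -/
theorem aInvProd_ne_zero (hG : IsSimplyLacedDynkin G) {l : List (I × ℂˣ)} (hl : l ≠ []) :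
    aInvProd G q l ≠ 0 := by
  intro h
  have h0 : (cartan G).mulVec (fun j => ((l.map Prod.fst).count j : ℤ)) = 0 := by
    ext i
    have := totalDegree_aInvProd (G := G) (q := q) l i
    rw [h, map_zero] at this
    rw [Pi.zero_apply]
    omega
  have h1 := cartan_mulVec_injective hG h0
  obtain ⟨y, l', rfl⟩ := List.exists_cons_of_ne_nil hl
  have h2 := congrFun h1 y.1
  simp at h2
  omega

/-- Singular vectors of `l`-weight strictly below `m` form a space stable under the loop-Cartan
subalgebra. If nonzero, it would generate the simple module by lowering operators alone, and the
`l`-weight `m` could not occur. -/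
theorem eq_zero_of_singular [FiniteDimensional ℂ V] (hG : IsSimplyLacedDynkin G)
    (hq : ∀ n : ℕ, 0 < n → q ^ n ≠ 1) (hs : IsSimpleModule (QAff G q) V) {m : LMonomial I}
    (hm : lWeightSpace G q V m ≠ ⊥) {u : V}
    (hu : u ∈ lWeightSum G q V {m' | ∃ l, l ≠ [] ∧ m' = m + aInvProd G q l})
    (hx : ∀ i r, act G q V (Gen.x 1 i r) u = 0) : u = 0 := by
  set M : Set (LMonomial I) := {m' | ∃ l, l ≠ [] ∧ m' = m + aInvProd G q l} with hM
  set S : Submodule ℂ V :=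
    lWeightSum G q V M ⊓ ⨅ (i) (r), LinearMap.ker (act G q V (Gen.x 1 i r)) with hS
  have hmemS : ∀ u, u ∈ S ↔ u ∈ lWeightSum G q V M ∧
      ∀ i r, act G q V (Gen.x 1 i r) u = 0 := fun u => by
    simp [hS, Submodule.mem_iInf]
  by_contra hne
  have hSne : S ≠ ⊥ := fun h => hne <| by
    have : u ∈ S := (hmemS u).2 ⟨hu, hx⟩
    rwa [h, Submodule.mem_bot] at this
  have hk : ∀ ε i, ∀ u ∈ S, act G q V (Gen.k ε i) u ∈ S := by
    intro ε i u hu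
    rw [hmemS] at hu ⊢
    refine ⟨apply_mem_lWeightSum _ (fun j => act_k_comm _ _ _ _)
      (fun j r => (act_k_h_comm _ _ _ _).symm) hu.1, fun j r => ?_⟩
    have h := LinearMap.congr_fun (act_k_x (G := G) (q := q) (V := V) ε 1 i j r) u
    rw [Module.End.mul_apply, hu.2, map_zero, LinearMap.smul_apply, Module.End.mul_apply] at h
    exact (smul_eq_zero.1 h.symm).resolve_left (Units.ne_zero _)
  have hh : ∀ i r, r ≠ 0 → ∀ u ∈ S, act G q V (Gen.h i r) u ∈ S := by
    intro i r hr u hu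
    rw [hmemS] at hu ⊢
    refine ⟨apply_mem_lWeightSum _ (fun j => act_k_h_comm _ _ _ _)
      (fun j s => act_h_comm _ _ _ _) hu.1, fun j s => ?_⟩
    have h := LinearMap.congr_fun (act_h_x (G := G) (q := q) (V := V) 1 i j r s hr) u
    rw [LinearMap.sub_apply, Module.End.mul_apply, Module.End.mul_apply, hu.2, map_zero,
      LinearMap.smul_apply, hu.2, smul_zero, zero_sub, neg_eq_zero] at h
    exact h
  have htop := span_isLowered_eq_top hs S hSne hk hh fun i r u hu => ((hmemS u).1 hu).2 i r
  have hclosed : ∀ m' ∈ M, ∀ j b, m' + aInv G q j b ∈ M := by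
    rintro _ ⟨l, hl, rfl⟩ j b
    refine ⟨l ++ [(j, b)], by simp, ?_⟩
    simp [aInvProd, add_assoc]
  have hle : ⊤ ≤ lWeightSum G q V M := by
    rw [← htop, Submodule.span_le]
    exact fun u hu => mem_lWeightSum_of_isLowered hq hclosed inf_le_left hu
  have hmM : m ∉ M := by
    rintro ⟨l, hl, h⟩
    exact aInvProd_ne_zero hG hl (by simpa using h)
  have hd := disjoint_lWeightSum (G := G) (V := V) hq hmM
  rw [top_le_iff.1 hle, disjoint_top] at hd
  exact hm hd

/-! ## Truncation -/

theorem toLMonomial_krMonomial {ξ : I → ℤ} (y : ILE ξ) :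
    toLMonomial q (krMonomial y) = ∑ d ∈ Finset.range (depth y + 1),
      Finsupp.single (y.1.1, q ^ (ξ y.1.1 - 2 * (d : ℤ))) 1 := by
  rw [krMonomial, toLMonomial, Finsupp.mapDomain_finsetSum]
  exact Finset.sum_congr rfl fun d _ => Finsupp.mapDomain_single

theorem toLMonomial_index_injective (hq : ∀ n : ℕ, 0 < n → q ^ n ≠ 1) (ξ : I → ℤ) :
    Function.Injective fun y : ILE ξ => (y.1.1, q ^ y.1.2) := fun y y' h => by
  rw [Prod.mk.injEq] at h
  exact Subtype.ext (Prod.ext h.1 (zpow_injective_of_not_root hq h.2))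

theorem toLMonomial_apply_of_lt (hq : ∀ n : ℕ, 0 < n → q ^ n ≠ 1) {ξ : I → ℤ}
    (m : ILE ξ →₀ ℤ) {j : I} {s : ℤ} (hs : ξ j < s) : toLMonomial q m (j, q ^ s) = 0 := by
  refine Finsupp.mapDomain_of_notMem_range _ _ ?_
  rintro ⟨⟨⟨k, p⟩, d, hd⟩, h⟩
  simp only [Prod.mk.injEq] at h hd
  obtain ⟨rfl, h2⟩ := h
  have := zpow_injective_of_not_root hq h2
  omega

theorem aInv_apply (j k : I) (a b : ℂˣ) : aInv G q k b (j, a) =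
    (if G.Adj j k ∧ b = a then 1 else 0) - ((if k = j ∧ b * q = a then 1 else 0) +
      if k = j ∧ b * q⁻¹ = a then 1 else 0) := by
  have h : ∀ l, (if G.Adj l k then Finsupp.single (l, b) (1 : ℤ) else 0) (j, a) =
      if l = j then (if G.Adj j k ∧ b = a then 1 else 0) else 0 := fun l => by
    by_cases hl : l = j
    · subst hl
      by_cases hadj : G.Adj l k <;> simp [hadj, Finsupp.single_apply]
    · by_cases hadj : G.Adj l k <;> simp [hadj, hl]
  rw [aInv, Finsupp.sub_apply, Finsupp.add_apply, Finsupp.finsetSum_apply]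
  simp only [h, Finset.sum_ite_eq', Finset.mem_univ, if_true, Finsupp.single_apply,
    Prod.mk.injEq]

/-- A product of monomials `A_{j,b}^{-1}`, one of which has `b = q^s` with `s > ξ(j)`, involves a
variable outside `I^{≤ ξ}`. -/
theorem exists_aInvProd_apply_ne_zero (hq : ∀ n : ℕ, 0 < n → q ^ n ≠ 1) {ξ : I → ℤ}
    (hξ : IsHeight G ξ) (l : List (I × ℂˣ)) {i : I} {s₀ : ℤ} (hs₀ : ξ i < s₀)
    (hi : (i, q ^ s₀) ∈ l) : ∃ j s, ξ j < s ∧ aInvProd G q l (j, q ^ s) ≠ 0 := by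
  classical
  have hinj := zpow_injective_of_not_root hq
  -- Among the factors `A_{j,q^s}^{-1}` with `s > ξ(j)`, take one with `s` maximal and look at the
  -- variable `Y_{j,q^{s+1}}`. A positive contribution to its exponent would need
  -- `A_{k,q^{s+1}}^{-1}` with `k` adjacent to `j`; as `ξ(k) ≤ ξ(j) + 1 < s + 1`, this contradicts
  -- maximality.
  set P := l.toFinset.filter fun y => ∃ s : ℤ, y.2 = q ^ s ∧ ξ y.1 < s with hP
  obtain ⟨⟨j, b⟩, hjb, hmax⟩ := P.exists_max_image
    (fun y => Function.invFun (fun s : ℤ => q ^ s) y.2) ⟨(i, q ^ s₀), by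
      simp only [hP, Finset.mem_filter, List.mem_toFinset]
      exact ⟨hi, s₀, rfl, hs₀⟩⟩
  simp only [hP, Finset.mem_filter, List.mem_toFinset] at hjb hmax
  obtain ⟨hjl, s, rfl, hs⟩ := hjb
  refine ⟨j, s + 1, by omega, ?_⟩
  have hterm : ∀ y ∈ l, aInv G q y.1 y.2 (j, q ^ (s + 1)) ≤ 0 := by
    rintro ⟨k, b⟩ hk
    rw [aInv_apply, if_neg]
    · split_ifs <;> simp
    rintro ⟨h1, h2⟩
    dsimp only at h1 h2
    subst h2
    have h3 := hξ j k h1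
    have h4 := hmax (k, q ^ (s + 1)) ⟨hk, s + 1, rfl, by dsimp only; omega⟩
    have h5 := Function.leftInverse_invFun hinj
    have h6 := h5 (s + 1)
    have h7 := h5 s
    dsimp only at h4 h6 h7
    omega
  have hneg : aInv G q j (q ^ s) (j, q ^ (s + 1)) ≤ -1 := by
    rw [aInv_apply]
    simp only [SimpleGraph.irrefl, false_and, if_false, true_and, zpow_add_one, if_true]
    split_ifs <;> simp
  obtain ⟨l₁, l₂, rfl⟩ := List.append_of_mem hjl
  have hsum : ∀ l' : List (I × ℂˣ), (∀ y ∈ l', aInv G q y.1 y.2 (j, q ^ (s + 1)) ≤ 0) →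
      aInvProd G q l' (j, q ^ (s + 1)) ≤ 0 := by
    intro l' h
    induction l' with
    | nil => simp [aInvProd]
    | cons y l' ih =>
      have h1 := h y List.mem_cons_self
      have h2 := ih fun z hz => h z (List.mem_cons_of_mem _ hz)
      have h3 : aInvProd G q (y :: l') = aInv G q y.1 y.2 + aInvProd G q l' := by simp [aInvProd]
      rw [h3, Finsupp.add_apply]
      omega
  have h1 := hsum l₁ fun y hy => hterm y (by simp [hy])
  have h2 := hsum l₂ fun y hy => hterm y (by simp [hy])
  have h3 : aInvProd G q (l₁ ++ (j, q ^ s) :: l₂) =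
      aInvProd G q l₁ + (aInv G q j (q ^ s) + aInvProd G q l₂) := by simp [aInvProd]
  rw [h3, Finsupp.add_apply, Finsupp.add_apply]
  omega

/-! ## Kirillov–Reshetikhin modules -/

theorem totalDegree_kr {ξ : I → ℤ} (y : ILE ξ) (j : I) :
    totalDegree j (toLMonomial q (krMonomial y)) =
      if y.1.1 = j then (depth y : ℤ) + 1 else 0 := by
  rw [toLMonomial_krMonomial, map_sum]
  simp only [totalDegree_single]
  split_ifs <;> simp

/-- The sum over the `q`-string telescopes, leaving the two ends. This is the one-pole shape
required by `act_phi_sub_apply`. -/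
theorem hValue_kr {ξ : I → ℤ} (y : ILE ξ) {r : ℤ} :
    hValue q (toLMonomial q (krMonomial y)) y.1.1 r =
      ((((q ^ (ξ y.1.1 + 1)) ^ r : ℂˣ) : ℂ) -
        (((q ^ (ξ y.1.1 + 1 - 2 * ((depth y : ℤ) + 1))) ^ r : ℂˣ) : ℂ)) /
          (r * ((q : ℂ) - ((q⁻¹ : ℂˣ) : ℂ))) := by
  rw [hValue_eq, toLMonomial_krMonomial, map_sum]
  simp only [powerSum_single, if_true]
  rw [qInt, div_div, div_mul_eq_mul_div, mul_comm (_ - _) (r : ℂ), Finset.mul_sum]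
  congr 1
  have h := Finset.sum_range_sub'
    (fun d : ℕ => (((q ^ (ξ y.1.1 + 1 - 2 * (d : ℤ))) ^ r : ℂˣ) : ℂ)) (depth y + 1)
  simp only [Nat.cast_add, Nat.cast_one, Nat.cast_zero, mul_zero, sub_zero] at h
  rw [← h]
  refine Finset.sum_congr rfl fun d _ => ?_
  rw [Int.cast_one, one_mul, sub_mul, ← Units.val_mul, ← Units.val_mul, ← zpow_mul, ← zpow_mul,
    ← zpow_mul, ← zpow_add, ← zpow_add]
  congr 4 <;> ring

theorem hValue_kr_of_ne {ξ : I → ℤ} (y : ILE ξ) {j : I} (hj : y.1.1 ≠ j) (r : ℤ) :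
    hValue q (toLMonomial q (krMonomial y)) j r = 0 := by
  rw [hValue_eq, toLMonomial_krMonomial, map_sum]
  simp [powerSum_single, hj]

/-- The `l`-weights of a Kirillov–Reshetikhin module other than the highest one are products of
the latter with `A_{i, q^{ξ(i) + 1}}^{-1}` and further monomials `A_{j,b}^{-1}`. -/
theorem IsKR.exists_decomposition (hG : IsSimplyLacedDynkin G)
    (hq : ∀ n : ℕ, 0 < n → q ^ n ≠ 1) {ξ : I → ℤ} {y : ILE ξ} (hV : IsKR G q V y) :
    ∃ v : V, v ≠ 0 ∧ v ∈ lWeightSpace G q V (toLMonomial q (krMonomial y)) ∧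
      (Submodule.span ℂ {v} ⊔ lWeightSum G q V
        {m | ∃ l, m = toLMonomial q (krMonomial y) +
          aInvProd G q ((y.1.1, q ^ (ξ y.1.1 + 1)) :: l)}) = ⊤ := by
  have hfd := hV.finiteDimensional
  have hs := hV.simple
  obtain ⟨v, hv0, hvx, hvk, hvh⟩ := hV.exists_highest
  set m := toLMonomial q (krMonomial y) with hm
  set i := y.1.1 with hi
  set a : ℂˣ := q ^ (ξ i + 1) with ha
  set M : Set (LMonomial I) := {m' | ∃ l, m' = m + aInvProd G q ((i, a) :: l)} with hM
  have hvm : v ∈ lWeightSpace G q V m := by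
    rw [mem_lWeightSpace]
    refine ⟨fun j => ⟨1, ?_⟩, fun j r hr => ⟨1, ?_⟩⟩
    · simp [hvk]
    · simp [hvh j r hr]
  have hm0 : lWeightSpace G q V m ≠ ⊥ := fun h => hv0 (by rwa [h, Submodule.mem_bot] at hvm)
  have hφ : ∀ n : ℤ, act G q V (Gen.φ 1 i n) v - act G q V (Gen.φ (-1) i n) v =
      (((a ^ n : ℂˣ) : ℂ) * (((q ^ ((depth y : ℤ) + 1) : ℂˣ) : ℂ) -
        (((q ^ ((depth y : ℤ) + 1))⁻¹ : ℂˣ) : ℂ))) • v := by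
    refine act_phi_sub_apply hq (B := q ^ (ξ i + 1 - 2 * ((depth y : ℤ) + 1))) ?_ ?_ ?_
    · rw [ha, ← zpow_natCast, ← zpow_mul, ← zpow_add]
      congr 1
      push_cast
      ring
    · rw [hvk, kValue_eq, hm, totalDegree_kr, if_pos rfl]
    · intro r hr
      rw [hvh i r hr, hm, hValue_kr]
  have hφ' : ∀ j, i ≠ j → ∀ n : ℤ,
      act G q V (Gen.φ 1 j n) v - act G q V (Gen.φ (-1) j n) v = 0 := by
    intro j hj n
    rw [act_phi_sub_apply hq (κ := 1) (A := 1) (B := 1) (by simp) (by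
        rw [hvk, kValue_eq, hm, totalDegree_kr, if_neg hj]; simp) (fun r hr => by
        rw [hvh j r hr, hm, hValue_kr_of_ne y hj]; simp)]
    simp
  have hlow : ∀ j s, act G q V (Gen.x (-1) j s) v ∈
      lWeightSum G q V {m' | ∃ l, l ≠ [] ∧ m' = m + aInvProd G q l} := by
    intro j s
    refine act_x_mem_lWeightSum hq (M := {m}) j ?_ s
      (lWeightSpace_le_lWeightSum (Set.mem_singleton m) hvm)
    rintro _ rfl b
    exact ⟨[(j, b)], by simp, by simp [aInvProd]⟩
  -- For `j ≠ i` the currents at `j` act trivially on `v`, so these vectors are singular.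
  have hxne : ∀ j, i ≠ j → ∀ s, act G q V (Gen.x (-1) j s) v = 0 := by
    intro j hj s
    refine eq_zero_of_singular hG hq hs hm0 (hlow j s) fun k r => ?_
    rw [act_xp_xm, hvx, map_zero, zero_add]
    split_ifs with h
    · subst h
      rw [hφ' k hj, smul_zero]
    · rfl
  -- The difference is singular, because the `φ` differences on `v` form a geometric series of ratio
  -- `a = q^{ξ(i)+1}`. So the first lowering step gives at most a line, of `l`-weight `m
  -- A_{i,a}^{-1}`.
  have hxsucc : ∀ s : ℤ, act G q V (Gen.x (-1) i (s + 1)) v =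
      (a : ℂ) • act G q V (Gen.x (-1) i s) v := by
    intro s
    rw [← sub_eq_zero]
    refine eq_zero_of_singular hG hq hs hm0
      (Submodule.sub_mem _ (hlow i _) (Submodule.smul_mem _ _ (hlow i _))) fun k r => ?_
    rw [map_sub, map_smul, act_xp_xm, act_xp_xm, hvx, map_zero, map_zero, zero_add, zero_add]
    split_ifs with h
    · subst h
      rw [hφ, hφ, ← add_assoc, zpow_add_one]
      push_cast
      module
    · simp
  have hxpow : ∀ s : ℤ, act G q V (Gen.x (-1) i s) v =
      ((a ^ s : ℂˣ) : ℂ) • act G q V (Gen.x (-1) i 0) v := by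
    intro s
    induction s with
    | zero => simp
    | succ n ih => rw [hxsucc, ih, zpow_add_one, smul_smul, mul_comm]; push_cast; rfl
    | pred n ih =>
      have h := hxsucc (-(n : ℤ) - 1)
      rw [sub_add_cancel, ih] at h
      rw [zpow_sub_one, Units.val_mul, mul_comm, ← smul_smul, h, smul_smul, Units.inv_mul,
        one_smul]
  have hxm : act G q V (Gen.x (-1) i 0) v ∈ lWeightSpace G q V (m + aInv G q i a) := by
    rw [mem_lWeightSpace]
    refine ⟨fun j => ⟨1, ?_⟩, fun j r hr => ⟨1, ?_⟩⟩
    · have h := LinearMap.congr_fun (act_k_x (G := G) (q := q) (V := V) 1 (-1) j i 0) v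
      rw [Module.End.mul_apply, LinearMap.smul_apply, Module.End.mul_apply, hvk, map_smul,
        smul_smul] at h
      rw [pow_one, LinearMap.sub_apply, h, LinearMap.smul_apply, Module.End.one_apply,
        kValue_add, kValue_eq (aInv G q i a), totalDegree_aInv, mul_comm, sub_eq_zero]
      simp
    · have h := LinearMap.congr_fun (act_h_x (G := G) (q := q) (V := V) (-1) j i r 0 hr) v
      rw [LinearMap.sub_apply, Module.End.mul_apply, Module.End.mul_apply, hvh j r hr, map_smul,
        LinearMap.smul_apply, add_zero, hxpow r, smul_smul, sub_eq_iff_eq_add', ← add_smul] at h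
      rw [pow_one, LinearMap.sub_apply, h, LinearMap.smul_apply, Module.End.one_apply,
        hValue_add, hValue_aInv, sub_eq_zero]
      congr 1
      simp
  have hbase : ∀ j s, act G q V (Gen.x (-1) j s) v ∈ lWeightSum G q V M := by
    intro j s
    by_cases hj : i = j
    · subst hj
      rw [hxpow]
      exact Submodule.smul_mem _ _
        (lWeightSpace_le_lWeightSum (M := M) ⟨[], by simp [aInvProd]⟩ hxm)
    · rw [hxne j hj]
      exact Submodule.zero_mem _
  have hclosed : ∀ m' ∈ M, ∀ j b, m' + aInv G q j b ∈ M := by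
    rintro _ ⟨l, rfl⟩ j b
    refine ⟨l ++ [(j, b)], ?_⟩
    simp [aInvProd, add_assoc]
  refine ⟨v, hv0, hvm, ?_⟩
  have hspan : ∀ u ∈ Submodule.span ℂ {v}, ∃ c : ℂ, c • v = u := fun u hu =>
    Submodule.mem_span_singleton.1 hu
  rw [← top_le_iff, ← span_isLowered_eq_top hs (Submodule.span ℂ {v}) (by simpa using hv0),
    Submodule.span_le]
  · intro u hu
    induction hu with
    | base u hu => exact Submodule.mem_sup_left hu
    | step j r u _ ih =>
      obtain ⟨u₁, hu₁, u₂, hu₂, rfl⟩ := Submodule.mem_sup.1 ih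
      obtain ⟨c, rfl⟩ := hspan u₁ hu₁
      refine Submodule.mem_sup_right ?_
      rw [map_add, map_smul]
      exact Submodule.add_mem _ (Submodule.smul_mem _ _ (hbase j r))
        (act_x_mem_lWeightSum hq j (fun m' hm' b => hclosed m' hm' j b) r hu₂)
  · intro ε j u hu
    obtain ⟨c, rfl⟩ := hspan u hu
    rw [map_smul, act_k_apply (κ := q ^ totalDegree j m) (by rw [hvk, kValue_eq])]
    exact Submodule.smul_mem _ _ (Submodule.smul_mem _ _ (Submodule.mem_span_singleton_self v))
  · intro j r hr u hu
    obtain ⟨c, rfl⟩ := hspan u hu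
    rw [map_smul, hvh j r hr]
    exact Submodule.smul_mem _ _ (Submodule.smul_mem _ _ (Submodule.mem_span_singleton_self v))
  · intro j r u hu
    obtain ⟨c, rfl⟩ := hspan u hu
    rw [map_smul, hvx, smul_zero]

/-- The truncated `q`-character of the Kirillov–Reshetikhin module `X_{i,p}` is its highest
monomial. -/
theorem IsKR.truncatedQChar_eq (hG : IsSimplyLacedDynkin G)
    (hq : ∀ n : ℕ, 0 < n → q ^ n ≠ 1) {ξ : I → ℤ} (hξ : IsHeight G ξ) {y : ILE ξ}
    (hV : IsKR G q V y) :
    truncatedQChar G q V ξ = AddMonoidAlgebra.single (krMonomial y) 1 := by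
  obtain ⟨v, hv0, hvm, htop⟩ := hV.exists_decomposition hG hq
  have hfd := hV.finiteDimensional
  set M : Set (LMonomial I) := {m | ∃ l, m = toLMonomial q (krMonomial y) +
    aInvProd G q ((y.1.1, q ^ (ξ y.1.1 + 1)) :: l)} with hM
  -- The factor `A_{i,q^{ξ(i)+1}}^{-1}` forces a variable above `ξ`, absent from the highest
  -- monomial and from all monomials of the truncation.
  have hnot : ∀ m : ILE ξ →₀ ℤ, toLMonomial q m ∉ M := by
    rintro m ⟨l, h⟩
    obtain ⟨j, s, hs, h1⟩ := exists_aInvProd_apply_ne_zero hq hξ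
      ((y.1.1, q ^ (ξ y.1.1 + 1)) :: l) (s₀ := ξ y.1.1 + 1) (by omega) List.mem_cons_self
    have h2 := DFunLike.congr_fun h (j, q ^ s)
    rw [Finsupp.add_apply, toLMonomial_apply_of_lt hq _ hs, toLMonomial_apply_of_lt hq _ hs,
      zero_add] at h2
    exact h1 h2.symm
  rw [truncatedQChar, finsum_eq_single _ (krMonomial y)]
  · have hspan : lWeightSpace G q V (toLMonomial q (krMonomial y)) = Submodule.span ℂ {v} := by
      refine le_antisymm (fun u hu => ?_) (by simpa using hvm)
      have hu' : u ∈ Submodule.span ℂ {v} ⊔ lWeightSum G q V M := htop ▸ Submodule.mem_top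
      obtain ⟨u₁, hu₁, u₂, hu₂, rfl⟩ := Submodule.mem_sup.1 hu'
      have h1 : u₁ ∈ lWeightSpace G q V (toLMonomial q (krMonomial y)) :=
        (Submodule.span_singleton_le_iff_mem _ _).2 hvm hu₁
      have h2 := (Submodule.add_mem_iff_right _ h1).1 hu
      have h3 := Submodule.disjoint_def.1 (disjoint_lWeightSum hq (hnot _)) u₂ h2 hu₂
      rw [h3, add_zero]
      exact hu₁
    rw [hspan, finrank_span_singleton hv0, Nat.cast_one]
  · intro m hne
    have hmne : toLMonomial q m ≠ toLMonomial q (krMonomial y) := fun h =>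
      hne (Finsupp.mapDomain_injective (toLMonomial_index_injective hq ξ) h)
    have hd := disjoint_lWeightSum (G := G) (V := V) hq
      (M := insert (toLMonomial q (krMonomial y)) M) (m := toLMonomial q m)
      (by rw [Set.mem_insert_iff, not_or]; exact ⟨hmne, hnot m⟩)
    have hle : (⊤ : Submodule ℂ V) ≤
        lWeightSum G q V (insert (toLMonomial q (krMonomial y)) M) := by
      rw [← htop]
      refine sup_le ?_ (biSup_mono fun m hm => Set.mem_insert_of_mem _ hm)
      rw [Submodule.span_singleton_le_iff_mem]
      exact lWeightSpace_le_lWeightSum (Set.mem_insert _ _) hvm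
    rw [top_le_iff.1 hle, disjoint_top] at hd
    rw [hd, finrank_bot, Nat.cast_zero, AddMonoidAlgebra.single_zero]

end KirillovReshetikhin

end HernandezLeclerc

namespace HernandezLeclerc

/-! ### The extended word and the comparison of `x_{t+2N}` with `x_t`. -/

section Main

variable {I : Type*} [Fintype I] [DecidableEq I] {G : SimpleGraph I} [DecidableRel G.Adj]

theorem prod_Y_eq_single {ξ : I → ℤ} {ι : Type*} (s : Finset ι) (x : ι → ILE ξ) :
    ∏ k ∈ s, (Y (x k) : Torus ξ) =
      AddMonoidAlgebra.single (∑ k ∈ s, Finsupp.single (x k) 1) 1 := by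
  classical
  induction s using Finset.induction_on with
  | empty => rfl
  | insert a s ha ih =>
    rw [Finset.prod_insert ha, Finset.sum_insert ha, ih, Y, AddMonoidAlgebra.single_mul_single,
      one_mul]

theorem dTilde_prod_Y (Q : Digraph I) {ξ : I → ℤ} {ι : Type*} (s : Finset ι) (x : ι → ILE ξ) :
    dTilde G Q ξ (∏ k ∈ s, Y (x k)) = ((∏ k ∈ s, dTildeY G Q ξ (x k) : (RatField I)ˣ) :
      RatField I) := by
  rw [map_prod, Units.coe_prod]
  exact Finset.prod_congr rfl fun k _ => dTilde_Y G Q ξ (x k)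

theorem single_krMonomial {ξ : I → ℤ} (y : ILE ξ) :
    (AddMonoidAlgebra.single (krMonomial y) 1 : Torus ξ) =
      ∏ d ∈ Finset.range (depth y + 1), Y (atDepth ξ y.1.1 d) := by
  rw [prod_Y_eq_single, krMonomial]

theorem hatWord_add_two_mul (w : ℕ → I) {t : ℕ} (ht : 1 ≤ t) :
    hatWord G w (t + 2 * numPos G) = hatWord G w t := by
  rcases Nat.eq_zero_or_pos (numPos G) with h0 | hpos
  · rw [h0, mul_zero, add_zero]
  -- The block number grows by `2`, so its parity is kept; `t ≥ 1` makes the truncated subtraction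
  -- exact.
  have h1 : t + 2 * numPos G - 1 = t - 1 + numPos G * 2 := by omega
  simp only [hatWord, h1, Nat.add_mul_div_left _ _ hpos, Nat.add_mul_mod_self_left,
    Nat.even_add, even_two, iff_true]

theorem hatWord_of_le (w : ℕ → I) {k : ℕ} (hk : k < numPos G) :
    hatWord G w (k + 1) = w (k + 1) := by
  simp [hatWord, Nat.div_eq_of_lt hk, Nat.mod_eq_of_lt hk]

theorem hatWord_add (w : ℕ → I) {k : ℕ} (hk : k < numPos G) :
    hatWord G w (numPos G + k + 1) = dualVertex G (w (k + 1)) := by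
  have hpos : 0 < numPos G := by omega
  simp [hatWord, Nat.add_div_left _ hpos, Nat.div_eq_of_lt hk, Nat.mod_eq_of_lt hk]

theorem card_filter_range_eq_count (f : ℕ → I) (n : ℕ) (j : I) :
    ((Finset.range n).filter fun k => f k = j).card = ((List.range n).map f).count j := by
  induction n with
  | zero => simp
  | succ n ih =>
    rw [Finset.range_add_one, Finset.filter_insert, List.range_succ, List.map_append,
      List.count_append, ← ih]
    by_cases h : f n = j
    · simp [h]
    · simp [h]

theorem card_filter_Icc_eq (f : ℕ → I) (n : ℕ) (j : I) :
    ((Finset.Icc 1 n).filter fun k => f k = j).card =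
      ((List.range n).map fun k => f (k + 1)).count j := by
  rw [← card_filter_range_eq_count]
  refine (Finset.card_bij (fun k _ => k + 1) ?_ ?_ ?_).symm
  · intro k hk
    simp only [Finset.mem_filter, Finset.mem_range, Finset.mem_Icc] at hk ⊢
    exact ⟨by omega, hk.2⟩
  · intro a _ b _ h
    omega
  · intro k hk
    simp only [Finset.mem_filter, Finset.mem_Icc] at hk
    have : k - 1 + 1 = k := by omega
    exact ⟨k - 1, by simp only [Finset.mem_filter, Finset.mem_range, this]; exact ⟨by omega, hk.2⟩,
      this⟩

/-- The first `t + 2N` letters are the word of `w₀`, its dual, and by `2N`-periodicity a copy of the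
first `t` letters. The two blocks contain `j` respectively `c_j` and `c_{j*}` times, that is `h`
times in all. -/
theorem occurrences_add (hG : IsSimplyLacedDynkin G) {ξ : I → ℤ} (hξ : IsHeight G ξ)
    (w : ℕ → I) (hw : IsAdaptedReducedWord G (heightQuiver G ξ) w) {t : ℕ} (ht : 1 ≤ t) :
    occurrences G w (t + 2 * numPos G) = occurrences G w t + coxeterNumber G := by
  obtain ⟨hl, had⟩ := hw
  set l := (List.range (numPos G)).map fun k => w (k + 1) with hldef
  have hlen : l.length = numPos G := by simp [hldef]
  rw [occurrences, occurrences, hatWord_add_two_mul w ht, card_filter_Icc_eq, card_filter_Icc_eq]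
  set j := hatWord G w t
  have h1 : t + 2 * numPos G = numPos G + (numPos G + t) := by ring
  rw [h1, List.range_add, List.range_add]
  simp only [List.map_append, List.map_map, List.count_append]
  have e1 : (List.range (numPos G)).map (fun k => hatWord G w (k + 1)) = l :=
    List.map_congr_left fun k hk => hatWord_of_le w (List.mem_range.1 hk)
  have e2 : (List.range (numPos G)).map
      ((fun k => hatWord G w (k + 1)) ∘ fun x => numPos G + x) = l.map (dualVertex G) := by
    rw [hldef, List.map_map]
    exact List.map_congr_left fun k hk => hatWord_add w (List.mem_range.1 hk)
  have e3 : (List.range t).map ((fun k => hatWord G w (k + 1)) ∘ (fun x => numPos G + x) ∘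
      fun x => numPos G + x) = (List.range t).map fun k => hatWord G w (k + 1) := by
    refine List.map_congr_left fun k _ => ?_
    have : numPos G + (numPos G + k) + 1 = (k + 1) + 2 * numPos G := by ring
    simp only [Function.comp_apply, this]
    exact hatWord_add_two_mul w (by omega)
  have hinv := hl.dualVertex_dualVertex hG
  have e4 : (l.map (dualVertex G)).count j = l.count (dualVertex G j) := by
    conv_lhs => rw [← hinv j]
    exact List.count_map_of_injective l _ (dualVertex_injective hG hl) _
  rw [e1, e2, e3, e4, ← count_add_count_dualVertex hG hξ hl hlen had j]
  ring

end Main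

end HernandezLeclerc

end

open HernandezLeclerc in
theorem proposition10p1 {I : Type*} [Fintype I] [DecidableEq I]
    (G : SimpleGraph I) [DecidableRel G.Adj] (hG : IsSimplyLacedDynkin G)
    (Q : Digraph I) (hQ : IsOrientation G Q)
    (ξ : I → ℤ) (hξ : ∀ i j, Q.Adj i j → ξ j = ξ i - 1)
    (q : ℂˣ) (hq : ∀ n : ℕ, 0 < n → q ^ n ≠ 1)
    (w : ℕ → I) (hw : IsAdaptedReducedWord G Q w) :
    (∀ (i : I) (p : ℤ) (hp : MemLE ξ i p) (hle : p ≤ ξ i - 2 * (coxeterNumber G : ℤ) + 2),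
      dTilde G Q ξ (∏ k : Fin (coxeterNumber G), Y ⟨(i, p + 2 * (k : ℕ)), hp.shift hle k.2⟩) = 1) ∧
    (∀ t : ℕ, 1 ≤ t →
      ∀ (V : Type*) [AddCommGroup V] [Module ℂ V] [Module (QAff G q) V]
        [IsScalarTower ℂ (QAff G q) V]
        (V' : Type*) [AddCommGroup V'] [Module ℂ V'] [Module (QAff G q) V']
        [IsScalarTower ℂ (QAff G q) V'],
        IsKR G q V (phiInv G ξ w t) →
        IsKR G q V' (phiInv G ξ w (t + 2 * numPos G)) →
        dTilde G Q ξ (truncatedQChar G q V' ξ) = dTilde G Q ξ (truncatedQChar G q V ξ)) := by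
  have hht : IsHeight G ξ := isHeight_of_isOrientation hQ hξ
  obtain rfl := heightQuiver_eq hQ hξ
  have hlen : ((List.range (numPos G)).map fun k => w (k + 1)).length = numPos G := by simp
  have hone : ∀ (i : I) (p : ℤ) (hp : MemLE ξ i p)
      (hle : p ≤ ξ i - 2 * (coxeterNumber G : ℤ) + 2), dTilde G (heightQuiver G ξ) ξ
        (∏ k : Fin (coxeterNumber G), Y ⟨(i, p + 2 * (k : ℕ)), hp.shift hle k.2⟩) = 1 := by
    intro i p hp hle
    rw [dTilde_prod_Y, prod_dTildeY_eq_one hG hht hw.1 hlen hw.2 rfl i p hle _ fun _ => rfl,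
      Units.val_one]
  refine ⟨hone, fun t ht V _ _ _ _ V' _ _ _ _ hV hV' => ?_⟩
  rw [hV.truncatedQChar_eq hG hq hht, hV'.truncatedQChar_eq hG hq hht, single_krMonomial,
    single_krMonomial]
  -- The position `t` counts itself, so the subtraction of `1` in `phiInv` is exact.
  have hocc : 1 ≤ occurrences G w t :=
    Finset.card_pos.2 ⟨t, by simp [ht]⟩
  set i := hatWord G w t with hi
  set D := occurrences G w t - 1 with hD
  set h := coxeterNumber G with hh
  have h1 : phiInv G ξ w t = atDepth ξ i D := rfl
  have h2 : phiInv G ξ w (t + 2 * numPos G) = atDepth ξ i (D + h) := by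
    rw [phiInv, hatWord_add_two_mul w ht, occurrences_add hG hht w hw ht]
    congr 1
    omega
  -- The first `D + 1` factors are the monomial of `x_t`; the remaining `h` consecutive variables
  -- are covered by part (1).
  rw [h1, h2, depth_atDepth, depth_atDepth, show D + h + 1 = D + 1 + h by ring,
    Finset.prod_range_add, map_mul]
  have hle : ξ i - 2 * ((D + h : ℕ) : ℤ) ≤ ξ i - 2 * (h : ℤ) + 2 := by push_cast; omega
  have h3 := hone i (ξ i - 2 * ((D + h : ℕ) : ℤ)) ⟨D + h, rfl⟩ hle
  have h4 : (∏ k : Fin h, Y ⟨(i, ξ i - 2 * ((D + h : ℕ) : ℤ) + 2 * (k : ℕ)),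
      MemLE.shift ⟨D + h, rfl⟩ hle k.2⟩ : Torus ξ) =
      ∏ k ∈ Finset.range h, Y (atDepth ξ i (D + 1 + k)) := by
    -- Part (1) lists the variables by increasing `p`, the monomial by increasing depth.
    rw [← Finset.prod_range_reflect, ← Fin.prod_univ_eq_prod_range
      (fun k => (Y (atDepth ξ i (D + 1 + (h - 1 - k))) : Torus ξ))]
    refine Finset.prod_congr rfl fun k _ => ?_
    congr 1
    apply Subtype.ext
    have := k.2
    simp only [atDepth, Prod.mk.injEq, true_and]
    omega
  rw [h4] at h3
  change dTilde G (heightQuiver G ξ) ξ _ * dTilde G (heightQuiver G ξ) ξ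
    (∏ k ∈ Finset.range h, Y (atDepth ξ i (D + 1 + k))) = _
  rw [h3, mul_one]
  rfl
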